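/- Consider the following game of $T$ rounds. In round $t=1,\dots,T$ the predictor chooses a probability distribution $\rho_t$ on $[0,1]$ as a function of the transcript $(p_1,\ell_1),\dots,(p_{t-1},\ell_{t-1})$; the adversary, who knows $\rho_t$ and the same transcript, reveals a convex $1$-Lipschitz function $\ell_t:[0,1]\to\mathbb R$; then $p_t$ is drawn from $\rho_t$. The swap regret is $$\mathsf{SR}(p_{1:T};\ell_{1:T})=\sup_{\sigma:[0,1]\to[0,1]}\sum_{t=1}^T\bigl(\ell_t(p_t)-\ell_t(\sigma(p_t))\bigr).$$ **Theorem.** There is an absolute constant $C>0$ such that for every integer $T\ge 2$ there is a prediction strategy with $$\mathbb E[\mathsf{SR}(p_{1:T};\ell_{1:T})]\le C\sqrt T\,\log T$$ against every adaptive adversary. Moreover, such strategies can be computed in $\mathsf{poly}(T)$ time: there are a single program and a polynomial $q$ such that, for every $T\ge2$ and every transcript of fewer than $T$ rounds, the program, given $T$, the number of past rounds and query access to the transcript, halts within time $q(T)$ and outputs $\rho_t$ as an explicit list of at most $q(T)$ rational points with rational probabilities. Here programs run on an integer random access machine with logarithmic (bit-length) cost; a query for a past round $s$ and integers $n\ge1$,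 $0\le i\le n$ returns $\lfloor n(\ell_s(i/n)-\ell_s(0))\rfloor$ or $\lfloor n\,p_s\rfloor$. -/

import Mathlib

noncomputable section

open scoped unitInterval

namespace SwapRegret

/-! ### The game -/

/-- A `1`-Lipschitz convex loss function on `[0,1]`. Convexity is Mathlib's `ConvexOn` on the
interval `[0,1] ⊆ ℝ`, where the extension agrees with `toFun`. -/
structure Loss where
  toFun : I → ℝ
  lipschitz : LipschitzWith 1 toFun
  convex : ConvexOn ℝ (Set.Icc (0 : ℝ) 1) (Set.IccExtend zero_le_one toFun)

instance : CoeFun Loss (fun _ => I → ℝ) := ⟨Loss.toFun⟩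

/-- The transcript `(p₁, ℓ₁), …, (p_t, ℓ_t)` of the rounds played so far, in order. -/
abbrev Transcript := List (I × Loss)

/-- A prediction strategy: the (discrete) distribution `ρ_t` on `[0,1]` of the next prediction, as
a function of the transcript of the previous rounds. -/
abbrev Strategy := Transcript → PMF I

/-- An adaptive adversary: the next loss as an arbitrary function of the transcript of the previous
rounds. The distribution `ρ_t` is itself a function of that transcript, so the adversary may depend
on it; the draw `p_t` of the current round is not available. -/
abbrev Adversary := Transcript → Loss

/-- The law of the transcript after `t` rounds: in each round the prediction is drawn from the
distribution chosen by the strategy, and the loss is the one chosen by the adversary. -/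
def play (S : Strategy) (A : Adversary) : ℕ → PMF Transcript
  | 0 => PMF.pure []
  | t + 1 => (play S A t).bind fun h => (S h).map fun p => h ++ [(p, A h)]

/-- The swap regret `sup_f ∑_t (ℓ_t(p_t) - ℓ_t(f(p_t)))`, over all `f : [0,1] → [0,1]`. The
supremum is over a nonempty set of reals that is bounded above by the number of rounds. -/
def swapRegret (h : Transcript) : ℝ :=
  ⨆ f : I → I, (h.map fun e => e.2 e.1 - e.2 (f e.1)).sum

/-- The expected swap regret after `T` rounds. The swap regret is nonnegative (take `f = id`), so
the expectation is a sum in `[0,∞]`. -/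
def expectedSwapRegret (S : Strategy) (A : Adversary) (T : ℕ) : ENNReal :=
  ∑' h : Transcript, play S A T h * ENNReal.ofReal (swapRegret h)

/-! ### The machine model

A random access machine on integers with logarithmic cost, programmed by while-programs. It reads
the transcript through finite-precision queries. -/

/-- The memory: finitely many arrays are named by a program; each cell holds an integer. -/
abbrev Store := ℕ → ℤ → ℤ

/-- The answer to a loss query: the loss of round `s` (counted from `0`) at the point `i / n`,
relative to its value at `0`, in units of `1 / n` and rounded down. Swap regret does not change when
a constant is added to a loss, and the value of a loss at `0` is not bounded, hence the
normalization. Rounds that are not in the transcript give `0`. -/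
def lossQuery (h : Transcript) (s i n : ℤ) : ℤ :=
  if 0 ≤ s then
    match h[s.toNat]? with
    | some e => ⌊(n : ℝ) * (e.2 (Set.projIcc 0 1 zero_le_one ((i : ℝ) / (n : ℝ))) - e.2 0)⌋
    | none => 0
  else 0

/-- The answer to a prediction query: the prediction of round `s` (counted from `0`) in units of
`1 / n`, rounded down. -/
def predQuery (h : Transcript) (s n : ℤ) : ℤ :=
  if 0 ≤ s then
    match h[s.toNat]? with
    | some e => ⌊(n : ℝ) * (e.1 : ℝ)⌋
    | none => 0
  else 0

/-- Integer expressions; `read a e` is the cell of array `a` with index `e`. -/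
inductive Expr where
  | const (c : ℤ)
  | read (a : ℕ) (e : Expr)
  | add (e₁ e₂ : Expr)
  | sub (e₁ e₂ : Expr)
  | mul (e₁ e₂ : Expr)
  | div (e₁ e₂ : Expr)
  | loss (s i n : Expr)
  | pred (s n : Expr)

def Expr.eval (h : Transcript) (m : Store) : Expr → ℤ
  | const c => c
  | read a e => m a (e.eval h m)
  | add e₁ e₂ => e₁.eval h m + e₂.eval h m
  | sub e₁ e₂ => e₁.eval h m - e₂.eval h m
  | mul e₁ e₂ => e₁.eval h m * e₂.eval h m
  | div e₁ e₂ => e₁.eval h m / e₂.eval h m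
  | loss s i n => lossQuery h (s.eval h m) (i.eval h m) (n.eval h m)
  | pred s n => predQuery h (s.eval h m) (n.eval h m)

/-- The number of binary digits of an integer. -/
def bits (z : ℤ) : ℕ := z.natAbs.size

/-- The logarithmic cost of evaluating an expression: every operation is charged one unit plus the
bit length of its result (the operands, addresses included, are charged as results in turn). -/
def Expr.cost (h : Transcript) (m : Store) : Expr → ℕ
  | const c => 1 + bits c
  | read a e => e.cost h m + 1 + bits ((read a e).eval h m)
  | add e₁ e₂ => e₁.cost h m + e₂.cost h m + 1 + bits ((add e₁ e₂).eval h m)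
  | sub e₁ e₂ => e₁.cost h m + e₂.cost h m + 1 + bits ((sub e₁ e₂).eval h m)
  | mul e₁ e₂ => e₁.cost h m + e₂.cost h m + 1 + bits ((mul e₁ e₂).eval h m)
  | div e₁ e₂ => e₁.cost h m + e₂.cost h m + 1 + bits ((div e₁ e₂).eval h m)
  | loss s i n => s.cost h m + i.cost h m + n.cost h m + 1 + bits ((loss s i n).eval h m)
  | pred s n => s.cost h m + n.cost h m + 1 + bits ((pred s n).eval h m)

/-- Programs. `assign a i e` writes `e` to the cell of array `a` with index `i`; the tests of
`cond` and `loop` ask whether the expression is positive. -/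
inductive Prog where
  | skip
  | assign (a : ℕ) (i e : Expr)
  | seq (P Q : Prog)
  | cond (b : Expr) (P Q : Prog)
  | loop (b : Expr) (P : Prog)

/-- `Exec h P m m' c`: with access to the transcript `h`, the program `P` started with memory `m`
halts with memory `m'` after time `c`. -/
inductive Exec (h : Transcript) : Prog → Store → Store → ℕ → Prop where
  | skip (m : Store) : Exec h .skip m m 1
  | assign (a : ℕ) (i e : Expr) (m : Store) :
      Exec h (.assign a i e) m
        (Function.update m a (Function.update (m a) (i.eval h m) (e.eval h m)))
        (i.cost h m + e.cost h m + 1)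
  | seq {P Q : Prog} {m₁ m₂ m₃ : Store} {c d : ℕ} :
      Exec h P m₁ m₂ c → Exec h Q m₂ m₃ d → Exec h (.seq P Q) m₁ m₃ (c + d)
  | cond_pos {b : Expr} {P Q : Prog} {m₁ m₂ : Store} {c : ℕ} :
      0 < b.eval h m₁ → Exec h P m₁ m₂ c → Exec h (.cond b P Q) m₁ m₂ (b.cost h m₁ + 1 + c)
  | cond_neg {b : Expr} {P Q : Prog} {m₁ m₂ : Store} {c : ℕ} :
      ¬ 0 < b.eval h m₁ → Exec h Q m₁ m₂ c → Exec h (.cond b P Q) m₁ m₂ (b.cost h m₁ + 1 + c)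
  | loop_stop {b : Expr} {P : Prog} {m : Store} :
      ¬ 0 < b.eval h m → Exec h (.loop b P) m m (b.cost h m + 1)
  | loop_step {b : Expr} {P : Prog} {m₁ m₂ m₃ : Store} {c d : ℕ} :
      0 < b.eval h m₁ → Exec h P m₁ m₂ c → Exec h (.loop b P) m₂ m₃ d →
        Exec h (.loop b P) m₁ m₃ (b.cost h m₁ + 1 + c + d)

/-- The initial memory: the horizon `T` and the number `t` of past rounds stand in the first two
cells of array `0`; all other cells are `0`. -/
def initStore (T t : ℕ) : Store :=
  fun a i => if a = 0 ∧ i = 0 then (T : ℤ) else if a = 0 ∧ i = 1 then (t : ℤ) else 0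

/-- `Outputs m N ρ`: the memory `m` holds an explicit list of `N` atoms that describes `ρ`. Array `1`
holds the number `N` of atoms and a common denominator `D > 0` of the points; the `k`-th atom is the
point `(m 2 k) / D ∈ [0,1]` with the nonnegative integer weight `m 3 k`. The distribution `ρ` is
given by the weights, divided by their sum. -/
def Outputs (m : Store) (N : ℕ) (ρ : PMF I) : Prop :=
  m 1 0 = (N : ℤ) ∧ 0 < m 1 1 ∧
  (∀ k < N, 0 ≤ m 2 k ∧ m 2 k ≤ m 1 1 ∧ 0 ≤ m 3 k) ∧
  0 < ∑ k ∈ Finset.range N, m 3 k ∧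
  ∀ x : I, (ρ x).toReal =
    (∑ k ∈ Finset.range N, if (m 2 k : ℝ) / (m 1 1 : ℝ) = (x : ℝ) then (m 3 k : ℝ) else 0) /
      ∑ k ∈ Finset.range N, (m 3 k : ℝ)

/-- The program `P` computes, for the horizon `T`, the strategy `S` in time `τ` per round: on every
transcript of fewer than `T` rounds it halts with an explicit description of the distribution that
`S` chooses next, where the time includes the length of the list of atoms. -/
def Prog.ComputesInTime (P : Prog) (T : ℕ) (S : Strategy) (τ : ℕ) : Prop :=
  ∀ h : Transcript, h.length < T →
    ∃ (m : Store) (c N : ℕ),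
      Exec h P (initStore T h.length) m c ∧ Outputs m N (S h) ∧ c + N ≤ τ

end SwapRegret

end

noncomputable section

open scoped unitInterval

namespace SwapRegret

/-! ### Bit lengths and the cost of expressions -/

/-! Predict on the grid of points `i / K` with `K = 2 ^ m` and `K ^ 2` of order `T`, and let `u =
gcd i K` be the dyadic scale of `i`. The regret of the rounds at `i` against a point `s` reduces to
two expert problems. If `s` is within `u / K` of `i / K`, compare with the local moves (`near`).
Otherwise, by convexity, a step of length `u / K` towards `s` earns at least the fraction `u / K` of
a positive gain of going to `s`, so it is enough to control `K / u` times the regret against the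
neighbours `i ± u` (`far`). Both problems use multiplicative weights with learning rate `K / (16 u ^
2)`. The logarithms of the total weights, with coefficients `16 u ^ 2 / K` and `16 u`, form
`potential`. Since the gcds sum to order `K log K` and their squares to order `K ^ 2`, it starts at
order `K log K` (`potential_nil_le`), and it bounds the swap regret up to `2 T / K`
(`cellRegret_le`, `swapRegret_le`).

The quadratic error of the weights is of order `1 / K` per round. That is harmless for local moves
but would be amplified by `K / u` for long ones. So every move receives a bonus of `1 / K` per
round, which absorbs this error (`le_log_one_add`), and the bonus is paid for elsewhere. By `log (1
+ x) ≤ x`, the potential grows by at most the gains, bonus included, along transitions with rates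
`realRate` (`cellPotential_append_le`). Under a stationary distribution every function of the state
has zero drift, so the losses cancel whatever the adversary does. The same holds for the loss plus a
depth penalty of `1 / K` per dyadic level (`score`). A long move at least doubles the gcd, so the
fall of the penalty pays its bonus. A local move may climb up to `m` levels, but the local rates sum
to at most one. The price is `(m + 1) / K` per round, hence `K log K` in total.

Exact stationarity is not needed: the average of `K ^ 2` iterates of the flow has drift `O(1 / K)`
(`drift_flowSum_le`), and rounding the rates to integers costs another `1 / K`. The resulting
one-round estimate is `sum_predWeight_mul_potential_le`. All numbers computed are bounded by `(32 K
^ 3) ^ (K ^ 2 + 4)`, so they have polynomially many digits. The program is verified with Hoare-style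
rules that track time, digit bounds and the arrays left untouched. -/

lemma bits_le_iff {z : ℤ} {β : ℕ} : bits z ≤ β ↔ z.natAbs < 2 ^ β := Nat.size_le

lemma bits_mono {y z : ℤ} (hyz : y.natAbs ≤ z.natAbs) : bits y ≤ bits z := Nat.size_le_size hyz

lemma lt_two_pow_bits (z : ℤ) : z.natAbs < 2 ^ bits z := Nat.lt_size_self _

lemma bits_le_natAbs (z : ℤ) : bits z ≤ z.natAbs :=
  bits_le_iff.2 Nat.lt_two_pow_self

lemma bits_add_le (y z : ℤ) : bits (y + z) ≤ bits y + bits z + 1 := by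
  rw [bits_le_iff]
  have h1 := lt_two_pow_bits y
  have h2 := lt_two_pow_bits z
  have h3 : 2 ^ bits y ≤ 2 ^ (bits y + bits z) := Nat.pow_le_pow_right (by norm_num) (by omega)
  have h4 : 2 ^ bits z ≤ 2 ^ (bits y + bits z) := Nat.pow_le_pow_right (by norm_num) (by omega)
  have h5 := Int.natAbs_add_le y z
  rw [pow_succ]
  omega

lemma bits_neg (z : ℤ) : bits (-z) = bits z := by simp [bits]

lemma bits_sub_le (y z : ℤ) : bits (y - z) ≤ bits y + bits z + 1 := by
  have := bits_add_le y (-z)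
  rwa [bits_neg, ← sub_eq_add_neg] at this

lemma bits_mul_le (y z : ℤ) : bits (y * z) ≤ bits y + bits z := by
  rw [bits_le_iff, Int.natAbs_mul, pow_add]
  exact Nat.mul_lt_mul'' (lt_two_pow_bits y) (lt_two_pow_bits z)

lemma bits_div_le (y z : ℤ) : bits (y / z) ≤ bits y :=
  bits_mono (Int.natAbs_ediv_le_natAbs y z)

lemma natAbs_floor_mul_le {n : ℤ} {x : ℝ} (hx : |x| ≤ 1) : ⌊(n : ℝ) * x⌋.natAbs ≤ n.natAbs := by
  have h : |(n : ℝ) * x| ≤ ((|n| : ℤ) : ℝ) := by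
    rw [abs_mul, Int.cast_abs]
    exact mul_le_of_le_one_right (abs_nonneg _) hx
  rw [abs_le] at h
  have h1 : -|n| ≤ ⌊(n : ℝ) * x⌋ := Int.le_floor.2 (by push_cast; push_cast at h; exact h.1)
  have h2 : ⌊(n : ℝ) * x⌋ ≤ |n| := by
    exact_mod_cast (Int.floor_le _).trans h.2
  rcases abs_cases n with hn | hn <;> omega

lemma Loss.abs_sub_le (l : Loss) (x y : I) : |l x - l y| ≤ |(x : ℝ) - y| := by
  have := l.lipschitz.dist_le_mul x y
  simpa [Real.dist_eq, Subtype.dist_eq] using this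

lemma abs_unitInterval_sub_le (x y : I) : |(x : ℝ) - y| ≤ 1 := by
  rw [abs_le]
  constructor <;> linarith [x.2.1, x.2.2, y.2.1, y.2.2]

lemma natAbs_lossQuery_le (h : Transcript) (s i n : ℤ) :
    (lossQuery h s i n).natAbs ≤ n.natAbs := by
  unfold lossQuery
  split_ifs
  · split
    · exact natAbs_floor_mul_le ((Loss.abs_sub_le _ _ _).trans (abs_unitInterval_sub_le _ _))
    · simp
  · simp

lemma natAbs_predQuery_le (h : Transcript) (s n : ℤ) :
    (predQuery h s n).natAbs ≤ n.natAbs := by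
  unfold predQuery
  split_ifs
  · split
    · rename_i e _
      exact natAbs_floor_mul_le (by rw [abs_of_nonneg e.1.2.1]; exact e.1.2.2)
    · simp
  · simp

/-- A bound on the cost of an expression, in units of the largest bit length in memory. -/
def Expr.weight : Expr → ℕ
  | const c => c.natAbs + 1
  | read _ e => e.weight + 2
  | add e₁ e₂ => 2 * (e₁.weight + e₂.weight) + 2
  | sub e₁ e₂ => 2 * (e₁.weight + e₂.weight) + 2
  | mul e₁ e₂ => 2 * (e₁.weight + e₂.weight) + 2
  | div e₁ e₂ => 2 * (e₁.weight + e₂.weight) + 2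
  | loss s i n => 2 * (s.weight + i.weight + n.weight) + 2
  | pred s n => 2 * (s.weight + n.weight) + 2

/-- Every cell of the memory has at most `β` binary digits. -/
def Bdd (β : ℕ) (m : Store) : Prop := ∀ a i, bits (m a i) ≤ β

lemma Expr.bits_eval_le_cost (h : Transcript) (m : Store) (e : Expr) :
    bits (e.eval h m) ≤ e.cost h m := by
  cases e <;> simp only [Expr.cost, Expr.eval] <;> omega

/-- The bit length of a result is at most the sum of those of its operands plus one, and these are
already charged; so a node at most doubles the cost below it, whence the factors 2 in `Expr.weight`.
The weight depends on the syntax alone, so a step of a fixed program costs a constant times `β`. -/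
lemma Expr.cost_le {h : Transcript} {m : Store} {β : ℕ} (hβ : 1 ≤ β) (hm : Bdd β m) (e : Expr) :
    e.cost h m ≤ e.weight * β := by
  induction e with
  | const c =>
    have := bits_le_natAbs c
    simp only [Expr.cost, Expr.weight]
    nlinarith
  | read a e ih =>
    have := hm a (e.eval h m)
    simp only [Expr.cost, Expr.weight, Expr.eval]
    nlinarith
  | add a b iha ihb =>
    have h1 := bits_add_le (a.eval h m) (b.eval h m)
    have h2 := a.bits_eval_le_cost h m
    have h3 := b.bits_eval_le_cost h m
    simp only [Expr.cost, Expr.weight, Expr.eval]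
    nlinarith
  | sub a b iha ihb =>
    have h1 := bits_sub_le (a.eval h m) (b.eval h m)
    have h2 := a.bits_eval_le_cost h m
    have h3 := b.bits_eval_le_cost h m
    simp only [Expr.cost, Expr.weight, Expr.eval]
    nlinarith
  | mul a b iha ihb =>
    have h1 := bits_mul_le (a.eval h m) (b.eval h m)
    have h2 := a.bits_eval_le_cost h m
    have h3 := b.bits_eval_le_cost h m
    simp only [Expr.cost, Expr.weight, Expr.eval]
    nlinarith
  | div a b iha ihb =>
    have h1 := bits_div_le (a.eval h m) (b.eval h m)
    have h2 := a.bits_eval_le_cost h m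
    simp only [Expr.cost, Expr.weight, Expr.eval]
    nlinarith
  | loss s i n ihs ihi ihn =>
    have h1 := bits_mono (natAbs_lossQuery_le h (s.eval h m) (i.eval h m) (n.eval h m))
    have h2 := n.bits_eval_le_cost h m
    simp only [Expr.cost, Expr.weight, Expr.eval]
    nlinarith
  | pred s n ihs ihn =>
    have h1 := bits_mono (natAbs_predQuery_le h (s.eval h m) (n.eval h m))
    have h2 := n.bits_eval_le_cost h m
    simp only [Expr.cost, Expr.weight, Expr.eval]
    nlinarith

/-! ### Rules for total correctness with time bounds -/

/-- Write `v` to the cell `i` of array `a`. -/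
def put (m : Store) (a : ℕ) (i v : ℤ) : Store :=
  Function.update m a (Function.update (m a) i v)

lemma put_same (m : Store) (a : ℕ) (i v : ℤ) : put m a i v a i = v := by simp [put]

lemma put_array (m : Store) (a : ℕ) (i v : ℤ) : put m a i v a = Function.update (m a) i v := by
  simp [put]

lemma put_of_ne (m : Store) {a b : ℕ} (hab : b ≠ a) (i v : ℤ) : put m a i v b = m b := by
  simp [put, hab]

lemma Bdd.put {β : ℕ} {m : Store} (hm : Bdd β m) {v : ℤ} (hv : bits v ≤ β) (a : ℕ) (i : ℤ) :
    Bdd β (put m a i v) := by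
  intro b j
  by_cases hb : b = a
  · subst hb
    rw [put_array]
    by_cases hj : j = i
    · subst hj; simpa using hv
    · simpa [hj] using hm b j
  · rw [put_of_ne m hb]
    exact hm b j

/-- The time of one step, for memory cells of at most `β` digits. -/
def unitTime (β : ℕ) : ℕ := 100000 * β

/-- The program `P` started in `m` halts within `s` units of time; the final memory satisfies `Q`
and its cells have at most `β` digits. -/
def Runs (h : Transcript) (β : ℕ) (P : Prog) (m : Store) (s : ℕ) (Q : Store → Prop) : Prop :=
  ∃ m' c, Exec h P m m' c ∧ c ≤ s * unitTime β ∧ Bdd β m' ∧ Q m'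

section Rules

variable {h : Transcript} {β : ℕ}

lemma Runs.assign (hβ : 1 ≤ β) {m : Store} (hm : Bdd β m) {a : ℕ} {i e : Expr} {Q : Store → Prop}
    (hi : i.weight ≤ 40000) (he : e.weight ≤ 40000) (hv : bits (e.eval h m) ≤ β)
    (hQ : Q (put m a (i.eval h m) (e.eval h m))) : Runs h β (.assign a i e) m 1 Q := by
  refine ⟨_, _, Exec.assign a i e m, ?_, hm.put hv a _, hQ⟩
  have h1 := Expr.cost_le (h := h) hβ hm i
  have h2 := Expr.cost_le (h := h) hβ hm e
  have h3 := Nat.mul_le_mul_right β hi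
  have h4 := Nat.mul_le_mul_right β he
  unfold unitTime
  omega

lemma Runs.seq {P P' : Prog} {m : Store} {s s' : ℕ} {R Q : Store → Prop}
    (h1 : Runs h β P m s R) (h2 : ∀ m', Bdd β m' → R m' → Runs h β P' m' s' Q) :
    Runs h β (.seq P P') m (s + s') Q := by
  obtain ⟨m', c, hc, hcs, hb, hR⟩ := h1
  obtain ⟨m'', d, hd, hds, hb', hQ⟩ := h2 m' hb hR
  exact ⟨m'', c + d, hc.seq hd, by rw [add_mul]; omega, hb', hQ⟩

lemma Runs.mono {P : Prog} {m : Store} {s s' : ℕ} {R Q : Store → Prop}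
    (h1 : Runs h β P m s R) (hs : s ≤ s') (hRQ : ∀ m', Bdd β m' → R m' → Q m') :
    Runs h β P m s' Q := by
  obtain ⟨m', c, hc, hcs, hb, hR⟩ := h1
  exact ⟨m', c, hc, hcs.trans (Nat.mul_le_mul_right _ hs), hb, hRQ m' hb hR⟩

lemma Expr.test_cost_le (hβ : 1 ≤ β) {m : Store} (hm : Bdd β m) {b : Expr}
    (hb : b.weight ≤ 40000) : b.cost h m + 1 ≤ unitTime β := by
  have h1 := Expr.cost_le (h := h) hβ hm b
  have h3 := Nat.mul_le_mul_right β hb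
  unfold unitTime
  omega

lemma Runs.cond (hβ : 1 ≤ β) {m : Store} (hm : Bdd β m) {b : Expr} {P P' : Prog} {s : ℕ}
    {Q : Store → Prop} (hb : b.weight ≤ 40000)
    (h1 : 0 < b.eval h m → Runs h β P m s Q) (h2 : ¬ 0 < b.eval h m → Runs h β P' m s Q) :
    Runs h β (.cond b P P') m (s + 1) Q := by
  have ht := Expr.test_cost_le (h := h) hβ hm hb
  by_cases hp : 0 < b.eval h m
  · obtain ⟨m', c, hc, hcs, hb, hR⟩ := h1 hp
    exact ⟨m', _, Exec.cond_pos hp hc, by rw [add_mul, one_mul]; omega, hb, hR⟩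
  · obtain ⟨m', c, hc, hcs, hb, hR⟩ := h2 hp
    exact ⟨m', _, Exec.cond_neg hp hc, by rw [add_mul, one_mul]; omega, hb, hR⟩

/-- `for r := 0, …, n - 1 do P`. -/
def forProg (r : ℕ) (n : Expr) (P : Prog) : Prog :=
  .seq (.assign r (.const 0) (.const 0))
    (.loop (.sub n (.read r (.const 0)))
      (.seq P (.assign r (.const 0) (.add (.read r (.const 0)) (.const 1)))))

/-- The bound `n` is evaluated anew in every round, so the invariant has to determine it, and the
invariant must survive any write to the counter. A round costs the body, one test and one increment;
the final `2` is the initialization and the failing test. -/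
lemma Runs.forProg (hβ : 1 ≤ β) {m : Store} (hm : Bdd β m) {r : ℕ} {n : Expr} {P : Prog} {N s : ℕ}
    {J : ℕ → Store → Prop} (hn : n.weight ≤ 1000) (hN : bits N ≤ β)
    (hJr : ∀ k m v, J k m → J k (put m r 0 v))
    (hJn : ∀ k m, J k m → n.eval h m = N) (h0 : J 0 m)
    (hP : ∀ k < N, ∀ m, Bdd β m → J k m → m r 0 = k →
      Runs h β P m s fun m' => J (k + 1) m' ∧ m' r 0 = k) :
    Runs h β (forProg r n P) m (N * (s + 2) + 2) (J N) := by
  have hbits : ∀ k : ℕ, k ≤ N → bits (k : ℤ) ≤ β := fun k hk =>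
    (bits_mono (by simpa using hk)).trans hN
  have key : ∀ d k : ℕ, k + d = N → ∀ m, Bdd β m → J k m → m r 0 = k →
      Runs h β (.loop (.sub n (.read r (.const 0)))
        (.seq P (.assign r (.const 0) (.add (.read r (.const 0)) (.const 1))))) m
        (d * (s + 2) + 1) (J N) := by
    intro d
    induction d with
    | zero =>
      intro k hk m hm hJ hr
      obtain rfl : k = N := by simpa using hk
      refine ⟨m, _, Exec.loop_stop ?_, ?_, hm, hJ⟩
      · simp [Expr.eval, hJn _ _ hJ, hr]
      · have := Expr.test_cost_le (h := h) hβ hm (b := .sub n (.read r (.const 0)))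
          (by simp [Expr.weight]; omega)
        simpa using this
    | succ d ih =>
      intro k hk m hm hJ hr
      have hb : Runs h β (.seq P (.assign r (.const 0) (.add (.read r (.const 0)) (.const 1)))) m
          (s + 1) (fun m' => J (k + 1) m' ∧ m' r 0 = ((k + 1 : ℕ) : ℤ)) := by
        refine (hP k (by omega) m hm hJ hr).seq fun m' hm' hm'' => ?_
        refine Runs.assign hβ hm' (by simp [Expr.weight]) (by simp [Expr.weight]) ?_ ?_
        · simp only [Expr.eval, hm''.2]
          exact_mod_cast hbits (k + 1) (by omega)
        · refine ⟨hJr _ _ _ hm''.1, ?_⟩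
          simp [Expr.eval, put_same, hm''.2]
      obtain ⟨m₁, c, hc, hcs, hm₁, hJ₁, hr₁⟩ := hb
      obtain ⟨m₂, e, he, hes, hm₂, hJ₂⟩ := ih (k + 1) (by omega) m₁ hm₁ hJ₁ hr₁
      refine ⟨m₂, _, Exec.loop_step ?_ hc he, ?_, hm₂, hJ₂⟩
      · simp only [Expr.eval, hJn _ _ hJ, hr]
        have : k < N := by omega
        omega
      · have := Expr.test_cost_le (h := h) hβ hm (b := .sub n (.read r (.const 0)))
          (by simp [Expr.weight]; omega)
        have e1 : ((d + 1) * (s + 2) + 1) * unitTime β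
          = unitTime β + (s + 1) * unitTime β + (d * (s + 2) + 1) * unitTime β := by ring
        omega
  have hfirst : Runs h β (.assign r (.const 0) (.const 0)) m 1
      (fun m' => J 0 m' ∧ m' r 0 = ((0 : ℕ) : ℤ)) :=
    Runs.assign hβ hm (by simp [Expr.weight]) (by simp [Expr.weight]) (by simp [Expr.eval, bits])
      ⟨hJr _ _ _ h0, by simp [Expr.eval, put_same]⟩
  exact (hfirst.seq fun m' hm' hJ => key N 0 (by simp) m' hm' hJ.1 hJ.2).mono (by omega)
    fun _ _ h => h

/-- `P` computes `v` into the cell `0` of array `r`, using only the arrays from `r` on. -/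
def Computes (h : Transcript) (β : ℕ) (P : Prog) (r : ℕ) (m : Store) (v : ℤ) (s : ℕ) : Prop :=
  Runs h β P m s fun m' => (∀ a < r, m' a = m a) ∧ m' r 0 = v

lemma Computes.mono {P : Prog} {r : ℕ} {m : Store} {v : ℤ} {s s' : ℕ}
    (h1 : Computes h β P r m v s) (hs : s ≤ s') : Computes h β P r m v s' :=
  Runs.mono h1 hs fun _ _ h => h

lemma Computes.expr (hβ : 1 ≤ β) {m : Store} (hm : Bdd β m) {e : Expr} {r : ℕ} {v : ℤ}
    (he : e.weight ≤ 40000) (hv : bits v ≤ β) (hev : e.eval h m = v) :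
    Computes h β (.assign r (.const 0) e) r m v 1 := by
  refine Runs.assign hβ hm (by simp [Expr.weight]) he (by rwa [hev]) ⟨fun a ha => ?_, ?_⟩
  · exact put_of_ne _ (by omega) _ _
  · simp only [Expr.eval, put_same, hev]

lemma Computes.cond (hβ : 1 ≤ β) {m : Store} (hm : Bdd β m) {b : Expr} {P P' : Prog} {r s : ℕ}
    {v : ℤ} (hb : b.weight ≤ 40000)
    (h1 : 0 < b.eval h m → Computes h β P r m v s)
    (h2 : ¬ 0 < b.eval h m → Computes h β P' r m v s) :
    Computes h β (.cond b P P') r m v (s + 1) :=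
  Runs.cond hβ hm hb h1 h2

/-- Compute an intermediate value into array `r`, then the result with scratch space from
`r + 1` on, and move the result to array `r`. -/
def letProg (r : ℕ) (P P' : Prog) : Prog :=
  .seq P (.seq P' (.assign r (.const 0) (.read (r + 1) (.const 0))))

/-- Arrays are used as a stack: everything below `r` is preserved, everything above is garbage.
Hence `h2` may rely only on agreement below `r` and on the value just computed. -/
lemma Computes.letProg (hβ : 1 ≤ β) {m : Store} {P P' : Prog} {r s s' : ℕ} {v v' : ℤ}
    (hv' : bits v' ≤ β)
    (h1 : Computes h β P r m v s)
    (h2 : ∀ m', Bdd β m' → (∀ a < r, m' a = m a) → m' r 0 = v →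
      Computes h β P' (r + 1) m' v' s') :
    Computes h β (letProg r P P') r m v' (s + s' + 1) := by
  refine Runs.mono (Runs.seq h1 fun m₁ hm₁ hR => Runs.seq (h2 m₁ hm₁ hR.1 hR.2)
    fun m₂ hm₂ hR₂ => Runs.assign (Q := fun m' => (∀ a < r, m' a = m a) ∧ m' r 0 = v') hβ hm₂
      (by simp [Expr.weight]) (by simp [Expr.weight]) ?_ ⟨fun a ha => ?_, ?_⟩)
    (by omega) fun _ _ h => h
  · simpa [Expr.eval, hR₂.2] using hv'
  · rw [put_of_ne _ (by omega), hR₂.1 a (by omega), hR.1 a ha]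
  · simp [Expr.eval, put_same, hR₂.2]

/-- Iterate `P` for `n` rounds: it computes into array `r + 2` the next value of the accumulator in
array `r` from the present one and the counter in array `r + 1`. -/
def foldProg (r : ℕ) (n init : Expr) (P : Prog) : Prog :=
  .seq (.assign r (.const 0) init)
    (forProg (r + 1) n (.seq P (.assign r (.const 0) (.read (r + 2) (.const 0)))))

lemma Computes.foldProg (hβ : 1 ≤ β) {m : Store} (hm : Bdd β m) {r : ℕ} {n init : Expr} {P : Prog}
    {N s : ℕ} {F : ℕ → ℤ} (hn : n.weight ≤ 1000) (hinit : init.weight ≤ 1000) (hN : bits N ≤ β)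
    (hne : ∀ m' : Store, (∀ a < r, m' a = m a) → n.eval h m' = N)
    (h0 : init.eval h m = F 0) (hF : ∀ k ≤ N, bits (F k) ≤ β)
    (hP : ∀ k < N, ∀ m', Bdd β m' → (∀ a < r, m' a = m a) → m' r 0 = F k → m' (r + 1) 0 = k →
      Computes h β P (r + 2) m' (F (k + 1)) s) :
    Computes h β (foldProg r n init P) r m (F N) (N * (s + 3) + 3) := by
  have h1 : Runs h β (.assign r (.const 0) init) m 1
      (fun m' => (∀ a < r, m' a = m a) ∧ m' r 0 = F 0) :=
    Runs.assign hβ hm (by simp [Expr.weight]) (by omega) (by rw [h0]; exact hF 0 (by omega))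
      ⟨fun a ha => put_of_ne _ (by omega) _ _, by simp only [Expr.eval, put_same, h0]⟩
  refine Runs.mono (h1.seq fun m₁ hm₁ hR => Runs.forProg (N := N) (s := s + 1)
    (J := fun k m' => (∀ a < r, m' a = m a) ∧ m' r 0 = F k) hβ hm₁ hn hN ?_ ?_ hR ?_)
    (by linarith) fun _ _ h => h
  · rintro k m' v ⟨ha, hb⟩
    exact ⟨fun a har => by rw [put_of_ne _ (by omega), ha a har],
      by rw [put_of_ne _ (by omega), hb]⟩
  · exact fun k m' hJ => hne m' hJ.1
  · intro k hk m' hm' hJ hr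
    refine (hP k hk m' hm' hJ.1 hJ.2 hr).seq fun m₂ hm₂ hR₂ => Runs.assign hβ hm₂
      (by simp [Expr.weight]) (by simp [Expr.weight]) ?_ ⟨⟨fun a ha => ?_, ?_⟩, ?_⟩
    · simpa [Expr.eval, hR₂.2] using hF (k + 1) (by omega)
    · rw [put_of_ne _ (by omega), hR₂.1 a (by omega), hJ.1 a ha]
    · simp [Expr.eval, put_same, hR₂.2]
    · rw [put_of_ne _ (by omega), hR₂.1 _ (by omega), hr]

/-- `for r := 0, …, n - 1` compute a value with `P` and write it to the cell `i` of array `a`. -/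
def fillProg (r a : ℕ) (n i : Expr) (P : Prog) : Prog :=
  forProg r n (.seq P (.assign a i (.read (r + 1) (.const 0))))

/-- `G k` is the array after `k` writes. The body may use it, which makes recursions possible where
an entry depends on earlier entries of the same array. -/
lemma Runs.fillProg (hβ : 1 ≤ β) {m : Store} (hm : Bdd β m) {r a : ℕ} (har : a < r) {n i : Expr}
    {P : Prog} {N s : ℕ} {G : ℕ → ℤ → ℤ} {v idx : ℕ → ℤ}
    (hn : n.weight ≤ 1000) (hi : i.weight ≤ 1000) (hN : bits N ≤ β)
    (hne : ∀ m' : Store, (∀ b < r, b ≠ a → m' b = m b) → n.eval h m' = N)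
    (hie : ∀ k < N, ∀ m' : Store, (∀ b < r, b ≠ a → m' b = m b) → m' r 0 = k → i.eval h m' = idx k)
    (h0 : m a = G 0) (hG : ∀ k < N, G (k + 1) = Function.update (G k) (idx k) (v k))
    (hv : ∀ k < N, bits (v k) ≤ β)
    (hP : ∀ k < N, ∀ m', Bdd β m' → (∀ b < r, b ≠ a → m' b = m b) → m' a = G k → m' r 0 = k →
      Computes h β P (r + 1) m' (v k) s) :
    Runs h β (fillProg r a n i P) m (N * (s + 3) + 2)
      fun m' => (∀ b < r, b ≠ a → m' b = m b) ∧ m' a = G N := by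
  refine Runs.mono (Runs.forProg (N := N) (s := s + 1)
    (J := fun k m' => (∀ b < r, b ≠ a → m' b = m b) ∧ m' a = G k) hβ hm hn hN ?_ ?_ ?_ ?_)
    le_rfl fun _ _ h => h
  · rintro k m' w ⟨h1, h2⟩
    exact ⟨fun b hb hba => by rw [put_of_ne _ (by omega), h1 b hb hba],
      by rw [put_of_ne _ (by omega), h2]⟩
  · exact fun k m' hJ => hne m' hJ.1
  · exact ⟨fun _ _ _ => rfl, h0⟩
  · intro k hk m' hm' hJ hr
    refine (hP k hk m' hm' hJ.1 hJ.2 hr).seq fun m₂ hm₂ hR₂ => ?_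
    have h1 : ∀ b < r, b ≠ a → m₂ b = m b := fun b hb hba => by
      rw [hR₂.1 b (by omega), hJ.1 b hb hba]
    have h2 : m₂ r 0 = k := by rw [hR₂.1 r (by omega), hr]
    refine Runs.assign hβ hm₂ (by omega) (by simp [Expr.weight]) ?_ ⟨⟨fun b hb hba => ?_, ?_⟩, ?_⟩
    · simpa [Expr.eval, hR₂.2] using hv k hk
    · rw [put_of_ne _ hba, h1 b hb hba]
    · rw [put_array, hie k hk m₂ h1 h2, hG k hk, hR₂.1 a (by omega), hJ.2]
      simp [Expr.eval, hR₂.2]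
    · rw [put_of_ne _ (by omega), h2]

end Rules

/-! ### Approximately stationary distributions -/

section Cesaro

open Finset

/-- The iterates of the flow with integer rates `A i j` on the states `0, …, n - 1`, scaled by `B`
in every step and started in the state `0`. -/
def flowIter (n : ℕ) (B : ℤ) (A : ℕ → ℕ → ℤ) : ℕ → ℕ → ℤ
  | 0, j => if j = 0 then 1 else 0
  | k + 1, j => B * flowIter n B A k j +
      ∑ i ∈ range n, (flowIter n B A k i * A i j - flowIter n B A k j * A j i)

/-- The sum of the first iterates of the flow, brought to a common scale. -/
def flowSum (n : ℕ) (B : ℤ) (A : ℕ → ℕ → ℤ) : ℕ → ℕ → ℤ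
  | 0, _ => 0
  | k + 1, j => B * flowSum n B A k j + flowIter n B A k j

variable {n : ℕ} {B : ℤ} {A : ℕ → ℕ → ℤ}

/-- The outflow from `j` is at most `B`, so the diagonal coefficient of the update is nonnegative.
-/
lemma flowIter_nonneg (hA : ∀ i < n, ∀ j < n, 0 ≤ A i j) (hB : ∀ i < n, ∑ j ∈ range n, A i j ≤ B)
    (k : ℕ) : ∀ j < n, 0 ≤ flowIter n B A k j := by
  induction k with
  | zero => intro j _; simp only [flowIter]; split_ifs <;> norm_num
  | succ k ih =>
    intro j hj
    have h1 : 0 ≤ ∑ i ∈ range n, flowIter n B A k i * A i j := sum_nonneg fun i hi =>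
      mul_nonneg (ih i (mem_range.1 hi)) (hA i (mem_range.1 hi) j hj)
    have h2 := mul_le_mul_of_nonneg_left (hB j hj) (ih j hj)
    simp only [flowIter, sum_sub_distrib, ← mul_sum]
    linarith

/-- The exchange terms are antisymmetric and cancel in the sum, so the mass is only multiplied by
`B`. -/
lemma sum_flowIter (hn : 0 < n) (k : ℕ) : ∑ j ∈ range n, flowIter n B A k j = B ^ k := by
  induction k with
  | zero => simp [flowIter, hn]
  | succ k ih =>
    simp only [flowIter, sum_add_distrib, ← mul_sum, ih, sum_sub_distrib]
    rw [sum_comm]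
    simp only [← mul_sum]
    ring

lemma flowIter_le (hn : 0 < n) (hA : ∀ i < n, ∀ j < n, 0 ≤ A i j)
    (hB : ∀ i < n, ∑ j ∈ range n, A i j ≤ B) (k : ℕ) {j : ℕ} (hj : j < n) :
    flowIter n B A k j ≤ B ^ k := by
  rw [← sum_flowIter (A := A) hn k]
  exact single_le_sum (f := fun j => flowIter n B A k j)
    (fun i hi => flowIter_nonneg hA hB k i (mem_range.1 hi)) (mem_range.2 hj)

lemma flowSum_nonneg (hA : ∀ i < n, ∀ j < n, 0 ≤ A i j) (hB : ∀ i < n, ∑ j ∈ range n, A i j ≤ B)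
    (hB0 : 0 ≤ B) (k : ℕ) : ∀ j < n, 0 ≤ flowSum n B A k j := by
  induction k with
  | zero => intro j _; simp [flowSum]
  | succ k ih =>
    intro j hj
    simp only [flowSum]
    have := flowIter_nonneg hA hB k j hj
    have := ih j hj
    positivity

lemma sum_flowSum (hn : 0 < n) (k : ℕ) :
    ∑ j ∈ range n, flowSum n B A (k + 1) j = (k + 1) * B ^ k := by
  induction k with
  | zero => simp [flowSum, sum_flowIter hn]
  | succ k ih =>
    have : ∑ j ∈ range n, flowSum n B A (k + 1 + 1) j
        = B * ∑ j ∈ range n, flowSum n B A (k + 1) j + B ^ (k + 1) := by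
      rw [← sum_flowIter (A := A) hn (k + 1), mul_sum, ← sum_add_distrib]
      rfl
    rw [this, ih]
    push_cast
    ring

/-- One step of the flow is `B` times the identity plus the flux, so the flux of the rescaled sum of
the iterates telescopes to its two ends. -/
lemma flux_flowSum (k j : ℕ) :
    ∑ i ∈ range n, (flowSum n B A k i * A i j - flowSum n B A k j * A j i)
      = flowIter n B A k j - B ^ k * flowIter n B A 0 j := by
  induction k with
  | zero => simp [flowSum]
  | succ k ih =>
    have h1 : ∑ i ∈ range n, (flowSum n B A (k + 1) i * A i j - flowSum n B A (k + 1) j * A j i)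
        = B * ∑ i ∈ range n, (flowSum n B A k i * A i j - flowSum n B A k j * A j i)
          + ∑ i ∈ range n, (flowIter n B A k i * A i j - flowIter n B A k j * A j i) := by
      rw [mul_sum, ← sum_add_distrib]
      refine sum_congr rfl fun i _ => ?_
      simp only [flowSum]
      ring
    have h2 : flowIter n B A (k + 1) j = B * flowIter n B A k j +
      ∑ i ∈ range n, (flowIter n B A k i * A i j - flowIter n B A k j * A j i) := rfl
    rw [h1, ih, h2]
    ring

/-- The flow sum is approximately stationary: the drift of every potential is small. -/
lemma drift_flowSum_le (hn : 0 < n) (hA : ∀ i < n, ∀ j < n, 0 ≤ A i j)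
    (hB : ∀ i < n, ∑ j ∈ range n, A i j ≤ B) (k : ℕ) {ψ : ℕ → ℝ} {D : ℝ}
    (hψ : ∀ j < n, ψ 0 - ψ j ≤ D) :
    ∑ i ∈ range n, (flowSum n B A k i : ℝ) * ∑ j ∈ range n, (A i j : ℝ) * (ψ i - ψ j)
      ≤ (B : ℝ) ^ k * D := by
  -- Summation by parts: the drift of `ψ` is minus the pairing of `ψ` with the flux, which is known
  -- exactly. As the flow starts in state `0`, only differences with `ψ 0` remain.
  have h1 : ∑ i ∈ range n, (flowSum n B A k i : ℝ) * ∑ j ∈ range n, (A i j : ℝ) * (ψ i - ψ j)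
      = - ∑ j ∈ range n, ψ j * ((flowIter n B A k j - B ^ k * flowIter n B A 0 j : ℤ) : ℝ) := by
    simp only [← flux_flowSum]
    push_cast
    simp only [mul_sum, mul_sub, sum_sub_distrib]
    rw [neg_sub, sum_comm (f := fun x i => ψ x * ((flowSum n B A k i : ℝ) * (A i x : ℝ)))]
    congr 1 <;> refine sum_congr rfl fun i _ => sum_congr rfl fun j _ => by ring
  have h2 : ∑ j ∈ range n, ψ j * ((B ^ k * flowIter n B A 0 j : ℤ) : ℝ) = (B : ℝ) ^ k * ψ 0 := by
    simp [flowIter, hn, mul_comm]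
  have h3 : ((B : ℝ)) ^ k = ∑ j ∈ range n, (flowIter n B A k j : ℝ) := by
    rw [← Int.cast_sum, sum_flowIter hn]
    push_cast
    rfl
  have h4 : ∑ j ∈ range n, (flowIter n B A k j : ℝ) * (ψ 0 - ψ j)
      ≤ ∑ j ∈ range n, (flowIter n B A k j : ℝ) * D := sum_le_sum fun j hj =>
    mul_le_mul_of_nonneg_left (hψ j (mem_range.1 hj))
      (by exact_mod_cast flowIter_nonneg hA hB k j (mem_range.1 hj))
  rw [h1]
  have h5 : ∑ j ∈ range n, ψ j * ((flowIter n B A k j - B ^ k * flowIter n B A 0 j : ℤ) : ℝ)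
      = ∑ j ∈ range n, ψ j * (flowIter n B A k j : ℝ) - (B : ℝ) ^ k * ψ 0 := by
    rw [← h2, ← sum_sub_distrib]
    refine sum_congr rfl fun j _ => by push_cast; ring
  rw [h5]
  rw [← sum_mul, ← h3] at h4
  have h6 : ∑ j ∈ range n, (flowIter n B A k j : ℝ) * (ψ 0 - ψ j)
      = (B : ℝ) ^ k * ψ 0 - ∑ j ∈ range n, ψ j * (flowIter n B A k j : ℝ) := by
    rw [h3, sum_mul, ← sum_sub_distrib]
    refine sum_congr rfl fun j _ => by ring
  linarith

end Cesaro

/-! ### Logarithmic potentials -/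

/-- The term `d` is the weight of not moving, whose factor is exactly `D`. After dividing by it, the
new total is the old one times one plus the average of `y / D`, and `log (1 + x) ≤ x` finishes. -/
lemma log_potential_step {ι : Type*} (E : Finset ι) {W y : ι → ℝ} {d D : ℝ} (hd : 0 < d)
    (hD : 0 < D) (hW : ∀ j ∈ E, 0 ≤ W j) (hy : ∀ j ∈ E, 0 ≤ D + y j) :
    Real.log ((D * d + ∑ j ∈ E, W j * (D + y j)) / (D * d)) ≤
      Real.log ((d + ∑ j ∈ E, W j) / d) + ∑ j ∈ E, W j / (d + ∑ j ∈ E, W j) * (y j / D) := by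
  set Z := d + ∑ j ∈ E, W j with hZ
  have hZ0 : 0 < Z := by
    have := Finset.sum_nonneg hW
    linarith
  have h1 : ∑ j ∈ E, W j / Z * (y j / D) = (∑ j ∈ E, W j * y j) / (Z * D) := by
    rw [Finset.sum_div]
    refine Finset.sum_congr rfl fun j _ => by rw [div_mul_div_comm]
  have h2 : D * d + ∑ j ∈ E, W j * (D + y j) = Z * D + ∑ j ∈ E, W j * y j := by
    simp only [mul_add, Finset.sum_add_distrib, ← Finset.sum_mul, hZ]
    ring
  have h3 : 0 < Z * D + ∑ j ∈ E, W j * y j := by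
    rw [← h2]
    have := Finset.sum_nonneg fun j hj => mul_nonneg (hW j hj) (hy j hj)
    positivity
  have h4 : (Z * D + ∑ j ∈ E, W j * y j) / (D * d)
      = Z / d * (1 + (∑ j ∈ E, W j * y j) / (Z * D)) := by
    field_simp
  have h5 : 0 < 1 + (∑ j ∈ E, W j * y j) / (Z * D) := by
    have : 1 + (∑ j ∈ E, W j * y j) / (Z * D) = (Z * D + ∑ j ∈ E, W j * y j) / (Z * D) := by
      field_simp
    rw [this]
    positivity
  rw [h2, h4, h1, Real.log_mul (by positivity) h5.ne']
  linarith [Real.log_le_sub_one_of_pos h5]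

/-- A quadratic lower bound for the logarithm of `1 + (g + K) / (16 u² K)`. -/
lemma le_log_one_add {u K g : ℝ} (hu : 1 ≤ u) (hK : 0 < K) (hg : |g + K| ≤ 3 * K * u) :
    g / (16 * u ^ 2 * K) ≤ Real.log ((16 * u ^ 2 * K + (g + K)) / (16 * u ^ 2 * K)) := by
  set x := (g + K) / (16 * u ^ 2 * K) with hx
  have hu0 : 0 < u := by linarith
  have hx1 : |x| ≤ 3 / (16 * u) := by
    rw [hx, abs_div, abs_of_pos (show 0 < 16 * u ^ 2 * K by positivity),
      div_le_div_iff₀ (by positivity) (by positivity)]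
    nlinarith [mul_pos hu0 hK]
  have hx3 : 3 / (16 * u) ≤ 3 / 16 := by
    gcongr
    linarith
  have hx2 : x ^ 2 ≤ 9 / (256 * u ^ 2) := by
    rw [← sq_abs]
    calc |x| ^ 2 ≤ (3 / (16 * u)) ^ 2 := by gcongr
      _ = _ := by rw [div_pow]; ring_nf
  have hx4 : 13 / 16 ≤ 1 + x := by
    have := neg_abs_le x
    linarith
  have e1 : (16 * u ^ 2 * K + (g + K)) / (16 * u ^ 2 * K) = 1 + x := by
    rw [hx]
    field_simp
  have e2 : g / (16 * u ^ 2 * K) = x - 1 / (16 * u ^ 2) := by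
    rw [hx]
    field_simp
    ring
  rw [e1, e2]
  have h1 := Real.one_sub_inv_le_log_of_pos (show 0 < 1 + x by linarith)
  have h2 : 1 - (1 + x)⁻¹ = x - x ^ 2 / (1 + x) := by
    have : 1 + x ≠ 0 := by linarith
    field_simp
    ring
  -- The right side is exactly what the bonus `K` contributes to `x`; the constants suffice because
  -- `9 / 256 * (16 / 13) < 1 / 16`.
  have h3 : x ^ 2 / (1 + x) ≤ 1 / (16 * u ^ 2) := by
    rw [div_le_div_iff₀ (by linarith) (by positivity)]
    rw [le_div_iff₀ (by positivity)] at hx2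
    nlinarith
  linarith

open Finset

/-! ### The grid and the weights of the moves -/

/-- The grid point `i / K`. -/
def gridPt (K i : ℕ) : I := Set.projIcc 0 1 zero_le_one ((i : ℝ) / K)

/-- The index of the grid cell of a prediction. -/
def cellOf (K : ℕ) (e : I × Loss) : ℤ := ⌊(K : ℝ) * (e.1 : ℝ)⌋

/-- The loss at the grid point `i / K`, relative to the point `0`, in units of `1 / K ^ 2`. -/
def gridVal (K : ℕ) (e : I × Loss) (i : ℕ) : ℤ := ⌊(K : ℝ) * K * (e.2 (gridPt K i) - e.2 0)⌋

/-- The common denominator of the factors by which the weights of the moves from `i` change. -/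
def baseFactor (K i : ℕ) : ℤ := 16 * (i.gcd K : ℤ) ^ 2 * K

/-- The factor by which a round in the cell `i` changes the weight of the move from `i` to `j`. -/
def stepFactor (K : ℕ) (e : I × Loss) (i j : ℕ) : ℤ :=
  baseFactor K i + (gridVal K e i - gridVal K e j + K)

/-- The weight of the move from `i` to `j`, over the denominator `den`. -/
def weight (K : ℕ) (h : Transcript) (i j : ℕ) : ℤ :=
  (h.map fun e => if cellOf K e = i then stepFactor K e i j else 1).prod

def den (K : ℕ) (h : Transcript) (i : ℕ) : ℤ :=
  (h.map fun e => if cellOf K e = i then baseFactor K i else 1).prod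

/-- The targets of local moves from `i`. -/
def near (K i : ℕ) : Finset ℕ := {j ∈ range (K + 1) | |(i : ℤ) - j| ≤ i.gcd K}

/-- The targets of long moves from `i`: the two neighbours at distance `gcd i K`. -/
def far (K i : ℕ) : Finset ℕ := {j ∈ range (K + 1) | i.gcd K < K ∧ |(i : ℤ) - j| = i.gcd K}

/-- The summand `den` is the weight of staying at `i`. It keeps the ratio of total to `den` at least
one, so the logarithmic potentials are nonnegative. -/
def nearTotal (K : ℕ) (h : Transcript) (i : ℕ) : ℤ := den K h i + ∑ j ∈ near K i, weight K h i j

def farTotal (K : ℕ) (h : Transcript) (i : ℕ) : ℤ := den K h i + ∑ j ∈ far K i, weight K h i j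

/-- The resolution of the transition rates. -/
def resolution (K : ℕ) : ℤ := 12 * (K : ℤ) ^ 2

/-- The integer rate of the transition from `i` to `j`, in units of `1 / resolution K`. -/
def rate (K : ℕ) (h : Transcript) (i j : ℕ) : ℤ :=
  (if j ∈ far K i then
    resolution K * K * weight K h i j / ((i.gcd K : ℤ) * farTotal K h i) else 0) +
  if j ∈ near K i then resolution K * weight K h i j / nearTotal K h i else 0

lemma far_subset_near (K i : ℕ) : far K i ⊆ near K i := by
  intro j hj
  simp only [far, near, mem_filter] at *
  exact ⟨hj.1, hj.2.2.le⟩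

lemma coe_gridPt {K i : ℕ} (hi : i ≤ K) : (gridPt K i : ℝ) = (i : ℝ) / K := by
  have : (i : ℝ) / K ∈ Set.Icc (0 : ℝ) 1 :=
    ⟨by positivity, div_le_one_of_le₀ (by exact_mod_cast hi) (by positivity)⟩
  simp [gridPt, Set.projIcc_of_mem _ this]

lemma cellOf_gridPt {K i : ℕ} (hK : 0 < K) (hi : i ≤ K) (l : Loss) :
    cellOf K (gridPt K i, l) = i := by
  have hK' : (K : ℝ) ≠ 0 := by positivity
  simp only [cellOf, coe_gridPt hi]
  rw [mul_div_cancel₀ _ hK', Int.floor_natCast]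

/-! ### Size and sign of grid values, factors and rates. -/

lemma abs_gridVal_sub_sub_le (K : ℕ) (e : I × Loss) (i j : ℕ) :
    |((gridVal K e i - gridVal K e j : ℤ) : ℝ) -
      (K : ℝ) * K * (e.2 (gridPt K i) - e.2 (gridPt K j))| ≤ 1 := by
  have h1 := Int.floor_le ((K : ℝ) * K * (e.2 (gridPt K i) - e.2 0))
  have h2 := Int.lt_floor_add_one ((K : ℝ) * K * (e.2 (gridPt K i) - e.2 0))
  have h3 := Int.floor_le ((K : ℝ) * K * (e.2 (gridPt K j) - e.2 0))
  have h4 := Int.lt_floor_add_one ((K : ℝ) * K * (e.2 (gridPt K j) - e.2 0))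
  unfold gridVal
  push_cast
  rw [abs_le]
  constructor <;> linarith

lemma abs_gridVal_sub_le {K : ℕ} (hK : 0 < K) (e : I × Loss) {i j : ℕ} (hi : i ≤ K) (hj : j ≤ K) :
    |gridVal K e i - gridVal K e j| ≤ K * |(i : ℤ) - j| + 1 := by
  have h1 := abs_gridVal_sub_sub_le K e i j
  have h2 := e.2.abs_sub_le (gridPt K i) (gridPt K j)
  rw [coe_gridPt hi, coe_gridPt hj, ← sub_div, abs_div, abs_of_pos (show (0 : ℝ) < K by positivity),
    le_div_iff₀ (by positivity)] at h2
  have h3 : |(K : ℝ) * K * (e.2 (gridPt K i) - e.2 (gridPt K j))| ≤ K * |(i : ℝ) - j| := by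
    rw [abs_mul, abs_of_nonneg (by positivity)]
    nlinarith [show (0 : ℝ) < K by positivity]
  have h4 : |((gridVal K e i - gridVal K e j : ℤ) : ℝ)| ≤ K * |(i : ℝ) - j| + 1 := by
    have := abs_sub_abs_le_abs_sub ((gridVal K e i - gridVal K e j : ℤ) : ℝ)
      ((K : ℝ) * K * (e.2 (gridPt K i) - e.2 (gridPt K j)))
    linarith
  exact_mod_cast h4

lemma one_le_gcd {K : ℕ} (hK : 0 < K) (i : ℕ) : 1 ≤ i.gcd K := Nat.gcd_pos_of_pos_right i hK

/-- The Lipschitz bound gives `K * u`, the rounding `1`, the bonus `K`; each is at most `K * u`. -/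
lemma abs_gap_le {K : ℕ} (hK : 0 < K) (e : I × Loss) {i j : ℕ} (hi : i ≤ K) (hj : j ∈ near K i) :
    |gridVal K e i - gridVal K e j + K| ≤ 3 * K * i.gcd K := by
  simp only [near, mem_filter, mem_range] at hj
  have h1 := abs_gridVal_sub_le hK e hi (show j ≤ K by omega)
  have h2 : (1 : ℤ) ≤ i.gcd K := by exact_mod_cast one_le_gcd hK i
  have h3 : (1 : ℤ) ≤ K := by exact_mod_cast hK
  have h4 := abs_add_le (gridVal K e i - gridVal K e j) K
  rw [abs_of_nonneg (show (0 : ℤ) ≤ K by positivity)] at h4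
  nlinarith [hj.2]

lemma baseFactor_pos {K : ℕ} (hK : 0 < K) (i : ℕ) : 0 < baseFactor K i := by
  have h2 : 0 < i.gcd K := one_le_gcd hK i
  unfold baseFactor
  positivity

lemma stepFactor_pos {K : ℕ} (hK : 0 < K) (e : I × Loss) {i j : ℕ} (hi : i ≤ K)
    (hj : j ∈ near K i) : 0 < stepFactor K e i j := by
  have h1 := (abs_le.1 (abs_gap_le hK e hi hj)).1
  have h2 : (1 : ℤ) ≤ i.gcd K := by exact_mod_cast one_le_gcd hK i
  have h3 : (1 : ℤ) ≤ K := by exact_mod_cast hK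
  unfold stepFactor baseFactor
  nlinarith [mul_pos (show (0 : ℤ) < K by omega) (show (0 : ℤ) < i.gcd K by omega)]

lemma weight_append (K : ℕ) (h : Transcript) (e : I × Loss) (i j : ℕ) :
    weight K (h ++ [e]) i j =
      weight K h i j * if cellOf K e = i then stepFactor K e i j else 1 := by
  simp [weight]

lemma den_append (K : ℕ) (h : Transcript) (e : I × Loss) (i : ℕ) :
    den K (h ++ [e]) i = den K h i * if cellOf K e = i then baseFactor K i else 1 := by
  simp [den]

lemma den_pos {K : ℕ} (hK : 0 < K) (h : Transcript) (i : ℕ) : 0 < den K h i := by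
  refine List.prod_pos fun x hx => ?_
  simp only [List.mem_map] at hx
  obtain ⟨e, _, rfl⟩ := hx
  split_ifs
  · exact baseFactor_pos hK i
  · norm_num

lemma weight_pos {K : ℕ} (hK : 0 < K) (h : Transcript) {i j : ℕ} (hi : i ≤ K)
    (hj : j ∈ near K i) : 0 < weight K h i j := by
  refine List.prod_pos fun x hx => ?_
  simp only [List.mem_map] at hx
  obtain ⟨e, _, rfl⟩ := hx
  split_ifs
  · exact stepFactor_pos hK e hi hj
  · norm_num

lemma nearTotal_pos {K : ℕ} (hK : 0 < K) (h : Transcript) {i : ℕ} (hi : i ≤ K) :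
    0 < nearTotal K h i :=
  add_pos_of_pos_of_nonneg (den_pos hK h i) (sum_nonneg fun _ hj => (weight_pos hK h hi hj).le)

lemma farTotal_pos {K : ℕ} (hK : 0 < K) (h : Transcript) {i : ℕ} (hi : i ≤ K) :
    0 < farTotal K h i :=
  add_pos_of_pos_of_nonneg (den_pos hK h i)
    (sum_nonneg fun _ hj => (weight_pos hK h hi (far_subset_near K i hj)).le)

lemma resolution_pos {K : ℕ} (hK : 0 < K) : 0 < resolution K := by
  unfold resolution
  positivity

lemma rate_nonneg {K : ℕ} (hK : 0 < K) (h : Transcript) {i : ℕ} (hi : i ≤ K) (j : ℕ) :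
    0 ≤ rate K h i j := by
  have h0 := (resolution_pos hK).le
  unfold rate
  refine add_nonneg ?_ ?_ <;> split_ifs with hj
  · have := (weight_pos hK h hi (far_subset_near K i hj)).le
    have := (farTotal_pos hK h hi).le
    exact Int.ediv_nonneg (by positivity) (by positivity)
  · exact le_rfl
  · have := (weight_pos hK h hi hj).le
    exact Int.ediv_nonneg (by positivity) (nearTotal_pos hK h hi).le
  · exact le_rfl

lemma sum_ediv_le {ι : Type*} (E : Finset ι) {W : ι → ℤ} {c d u Z : ℤ}
    (hc : 0 ≤ c) (hd : 0 ≤ d) (hu : 1 ≤ u) (hZ : 0 < Z) (hZE : d + ∑ j ∈ E, W j = Z)  :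
    ∑ j ∈ E, c * W j / (u * Z) ≤ c := by
  have huZ : 0 < u * Z := by positivity
  refine le_of_mul_le_mul_right (a := u * Z) ?_ huZ
  rw [sum_mul]
  calc ∑ j ∈ E, c * W j / (u * Z) * (u * Z) ≤ ∑ j ∈ E, c * W j :=
        sum_le_sum fun j _ => Int.ediv_mul_le _ huZ.ne'
    _ = c * ∑ j ∈ E, W j := by rw [mul_sum]
    _ ≤ c * (u * Z) := by
        refine mul_le_mul_of_nonneg_left ?_ hc
        nlinarith

/-- The long rates sum to at most `K * resolution K` since the gcd is at least one, the local ones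
to at most `resolution K`; rounding down only helps. This is the scale `B` of the flow. -/
lemma sum_rate_le {K : ℕ} (hK : 0 < K) (h : Transcript) {i : ℕ} (hi : i ≤ K) :
    ∑ j ∈ range (K + 1), rate K h i j ≤ 2 * K * resolution K := by
  have h0 := (resolution_pos hK).le
  have h1 := sum_ediv_le (far K i) (W := weight K h i) (c := resolution K * K) (by positivity)
    (den_pos hK h i).le (show (1 : ℤ) ≤ i.gcd K by exact_mod_cast one_le_gcd hK i)
    (farTotal_pos hK h hi) rfl
  have h2 := sum_ediv_le (near K i) (W := weight K h i) (c := resolution K) h0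
    (den_pos hK h i).le le_rfl (nearTotal_pos hK h hi) rfl
  have h3 : (1 : ℤ) ≤ K := by exact_mod_cast hK
  have e1 : range (K + 1) ∩ far K i = far K i := inter_eq_right.2 (filter_subset _ _)
  have e2 : range (K + 1) ∩ near K i = near K i := inter_eq_right.2 (filter_subset _ _)
  simp only [one_mul] at h2
  simp only [rate, sum_add_distrib, sum_ite_mem, e1, e2]
  nlinarith

lemma rate_le {K : ℕ} (hK : 0 < K) (h : Transcript) {i j : ℕ} (hi : i ≤ K) (hj : j ≤ K) :
    rate K h i j ≤ 2 * K * resolution K :=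
  (single_le_sum (f := fun j => rate K h i j) (fun j _ => rate_nonneg hK h hi j)
    (mem_range.2 (by omega : j < K + 1))).trans (sum_rate_le hK h hi)

/-! ### The potential -/

/-- The potential of the local moves from `i`. -/
def nearLog (K : ℕ) (h : Transcript) (i : ℕ) : ℝ :=
  Real.log ((nearTotal K h i : ℝ) / (den K h i : ℝ))

/-- The potential of the long moves from `i`. -/
def farLog (K : ℕ) (h : Transcript) (i : ℕ) : ℝ :=
  Real.log ((farTotal K h i : ℝ) / (den K h i : ℝ))

/-- The factor `16 u ^ 2 / K` is the inverse learning rate in units of the loss. The long moves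
carry a further factor `K / u`, by which convexity may amplify their regret. -/
def cellPotential (K : ℕ) (h : Transcript) (i : ℕ) : ℝ :=
  16 * (i.gcd K : ℝ) * farLog K h i + 16 * (i.gcd K : ℝ) ^ 2 / K * nearLog K h i

def potential (K : ℕ) (h : Transcript) : ℝ := ∑ i ∈ range (K + 1), cellPotential K h i

lemma nearLog_nonneg {K : ℕ} (hK : 0 < K) (h : Transcript) {i : ℕ} (hi : i ≤ K) :
    0 ≤ nearLog K h i := by
  have h1 : (0 : ℝ) < den K h i := by exact_mod_cast den_pos hK h i
  refine Real.log_nonneg ((one_le_div h1).2 ?_)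
  exact_mod_cast le_add_of_nonneg_right (sum_nonneg fun _ hj => (weight_pos hK h hi hj).le)

lemma farLog_nonneg {K : ℕ} (hK : 0 < K) (h : Transcript) {i : ℕ} (hi : i ≤ K) :
    0 ≤ farLog K h i := by
  have h1 : (0 : ℝ) < den K h i := by exact_mod_cast den_pos hK h i
  refine Real.log_nonneg ((one_le_div h1).2 ?_)
  exact_mod_cast le_add_of_nonneg_right
    (sum_nonneg fun _ hj => (weight_pos hK h hi (far_subset_near K i hj)).le)

lemma cellPotential_nonneg {K : ℕ} (hK : 0 < K) (h : Transcript) {i : ℕ} (hi : i ≤ K) :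
    0 ≤ cellPotential K h i := by
  have := nearLog_nonneg hK h hi
  have := farLog_nonneg hK h hi
  unfold cellPotential
  positivity

lemma potential_nonneg {K : ℕ} (hK : 0 < K) (h : Transcript) : 0 ≤ potential K h :=
  sum_nonneg fun i hi => cellPotential_nonneg hK h (by have := mem_range.1 hi; omega)

lemma cellPotential_append_of_ne {K : ℕ} (h : Transcript) {e : I × Loss} {i : ℕ}
    (hi : cellOf K e ≠ i) : cellPotential K (h ++ [e]) i = cellPotential K h i := by
  simp only [cellPotential, nearLog, farLog, nearTotal, farTotal, weight_append, den_append, hi,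
    if_false, mul_one]

lemma log_total_append_le {K : ℕ} (hK : 0 < K) (h : Transcript) {e : I × Loss} {i : ℕ} (hi : i ≤ K)
    (he : cellOf K e = i) {E : Finset ℕ} (hE : E ⊆ near K i) :
    Real.log (((den K (h ++ [e]) i + ∑ j ∈ E, weight K (h ++ [e]) i j : ℤ) : ℝ) /
        (den K (h ++ [e]) i : ℝ)) ≤
      Real.log (((den K h i + ∑ j ∈ E, weight K h i j : ℤ) : ℝ) / (den K h i : ℝ)) +
      ∑ j ∈ E, (weight K h i j : ℝ) / ((den K h i + ∑ j ∈ E, weight K h i j : ℤ) : ℝ) *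
        (((gridVal K e i - gridVal K e j + K : ℤ) : ℝ) / (baseFactor K i : ℝ)) := by
  have := log_potential_step E (W := fun j => (weight K h i j : ℝ))
    (y := fun j => ((gridVal K e i - gridVal K e j + K : ℤ) : ℝ))
    (d := den K h i) (D := baseFactor K i) (by exact_mod_cast den_pos hK h i)
    (by exact_mod_cast baseFactor_pos hK i)
    (fun j hj => by exact_mod_cast (weight_pos hK h hi (hE hj)).le)
    (fun j hj => by exact_mod_cast (stepFactor_pos hK e hi (hE hj)).le)
  simp only [weight_append, den_append, he, if_true]
  push_cast [stepFactor] at this ⊢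
  rwa [mul_comm (den K h i : ℝ)]

/-- The real-valued transition rate that the integer rate approximates. -/
def realRate (K : ℕ) (h : Transcript) (i j : ℕ) : ℝ :=
  (if j ∈ far K i then
    (K : ℝ) / (i.gcd K : ℝ) * ((weight K h i j : ℝ) / (farTotal K h i : ℝ)) else 0) +
  if j ∈ near K i then (weight K h i j : ℝ) / (nearTotal K h i : ℝ) else 0

/-- The rates in `realRate` are forced here: dividing the coefficients `16 u` and `16 u ^ 2 / K` by
`baseFactor` leaves `(K / u) / K ^ 2` and `1 / K ^ 2`. -/
lemma cellPotential_append_le {K : ℕ} (hK : 0 < K) (h : Transcript) {e : I × Loss} {i : ℕ}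
    (hi : i ≤ K) (he : cellOf K e = i) :
    cellPotential K (h ++ [e]) i ≤ cellPotential K h i +
      ∑ j ∈ range (K + 1), realRate K h i j *
        ((gridVal K e i - gridVal K e j + K : ℤ) : ℝ) / (K : ℝ) ^ 2 := by
  have hf : farLog K (h ++ [e]) i ≤ _ := log_total_append_le hK h hi he (far_subset_near K i)
  have hn : nearLog K (h ++ [e]) i ≤ _ := log_total_append_le hK h hi he (Subset.refl _)
  have hu : (0 : ℝ) < i.gcd K := by exact_mod_cast one_le_gcd hK i
  have hK' : (0 : ℝ) < K := by exact_mod_cast hK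
  have e1 : range (K + 1) ∩ far K i = far K i := inter_eq_right.2 (filter_subset _ _)
  have e2 : range (K + 1) ∩ near K i = near K i := inter_eq_right.2 (filter_subset _ _)
  have h1 := mul_le_mul_of_nonneg_left hf (show 0 ≤ 16 * (i.gcd K : ℝ) by positivity)
  have h2 := mul_le_mul_of_nonneg_left hn (show 0 ≤ 16 * (i.gcd K : ℝ) ^ 2 / K by positivity)
  rw [mul_add, mul_sum] at h1 h2
  have h3 : ∑ j ∈ range (K + 1), realRate K h i j *
        ((gridVal K e i - gridVal K e j + K : ℤ) : ℝ) / (K : ℝ) ^ 2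
      = ∑ j ∈ far K i, 16 * (i.gcd K : ℝ) * ((weight K h i j : ℝ) / (farTotal K h i : ℝ) *
          (((gridVal K e i - gridVal K e j + K : ℤ) : ℝ) / (baseFactor K i : ℝ)))
        + ∑ j ∈ near K i, 16 * (i.gcd K : ℝ) ^ 2 / K *
          ((weight K h i j : ℝ) / (nearTotal K h i : ℝ) *
          (((gridVal K e i - gridVal K e j + K : ℤ) : ℝ) / (baseFactor K i : ℝ))) := by
    rw [← e1, ← e2, ← sum_ite_mem, ← sum_ite_mem, ← sum_add_distrib]
    refine sum_congr rfl fun j _ => ?_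
    have hb : (baseFactor K i : ℝ) = 16 * (i.gcd K : ℝ) ^ 2 * K := by simp [baseFactor]
    rw [realRate, hb, add_mul, add_div]
    congr 1 <;> split_ifs
    · field_simp
    · simp
    · field_simp
    · simp
  rw [h3]
  unfold cellPotential
  unfold farLog nearLog at *
  unfold farTotal nearTotal at *
  linarith

/-! ### The drift of the potential -/

/-- Write `i` as `u` times an odd number, with `u` a proper power of two below `2 ^ m`. Then `i ± u`
is `u` times an even number, so `2 u` divides both it and `2 ^ m`. -/
lemma two_mul_gcd_le_of_mem_far {m i j : ℕ} (hj : j ∈ far (2 ^ m) i) :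
    2 * i.gcd (2 ^ m) ≤ j.gcd (2 ^ m) := by
  simp only [far, mem_filter] at hj
  obtain ⟨-, hlt, hd⟩ := hj
  obtain ⟨a, ham, ha⟩ := (Nat.dvd_prime_pow Nat.prime_two).1 (Nat.gcd_dvd_right i (2 ^ m))
  have h2 : 2 * 2 ^ a ∣ 2 ^ m := by
    rw [← pow_succ']
    refine pow_dvd_pow 2 ?_
    rw [ha] at hlt
    exact (Nat.pow_lt_pow_iff_right (by norm_num)).1 hlt
  obtain ⟨c, hc⟩ : 2 ^ a ∣ i := ha ▸ Nat.gcd_dvd_left i (2 ^ m)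
  have hpos : 0 < 2 ^ a := by positivity
  have hodd : ¬ 2 ∣ c := by
    rintro ⟨b, rfl⟩
    have h3 : 2 * 2 ^ a ∣ i := ⟨b, by rw [hc]; ring⟩
    have := Nat.le_of_dvd (by rw [ha]; exact hpos) (Nat.dvd_gcd h3 h2)
    omega
  rw [ha] at hd ⊢
  refine Nat.le_of_dvd (Nat.gcd_pos_of_pos_right j (by positivity)) (Nat.dvd_gcd ?_ h2)
  have hd' : (i : ℤ) - j = (2 ^ a : ℕ) ∨ (i : ℤ) - j = -(2 ^ a : ℕ) := by
    exact abs_eq (by positivity) |>.1 hd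
  rcases hd' with hd' | hd'
  · have hi : i = j + 2 ^ a := by zify; push_cast at hd'; linarith
    obtain ⟨b, hb⟩ : ∃ b, c = 2 * b + 1 := ⟨c / 2, by omega⟩
    refine ⟨b, ?_⟩
    have : j + 2 ^ a = 2 ^ a * (2 * b + 1) := by rw [← hi, hc, hb]
    linarith
  · have hi : j = i + 2 ^ a := by zify; push_cast at hd'; linarith
    obtain ⟨b, hb⟩ : ∃ b, c = 2 * b + 1 := ⟨c / 2, by omega⟩
    refine ⟨b + 1, ?_⟩
    rw [hi, hc, hb]
    ring

/-- The loss at a grid point of `{i / 2 ^ m}`, plus a penalty for its depth. -/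
def score (m : ℕ) (e : I × Loss) (j : ℕ) : ℝ :=
  (gridVal (2 ^ m) e j : ℝ) + (2 : ℝ) ^ m * ((m : ℝ) - Nat.log 2 (j.gcd (2 ^ m)))

lemma log_gcd_le (m j : ℕ) : Nat.log 2 (j.gcd (2 ^ m)) ≤ m := by
  calc Nat.log 2 (j.gcd (2 ^ m)) ≤ Nat.log 2 (2 ^ m) :=
        Nat.log_mono_right (Nat.gcd_le_right j (by positivity))
    _ = m := Nat.log_pow (by norm_num) m

/-- A long move rises by at least one dyadic level, and the penalty saved is at least the bonus `2 ^
m`. There is no error term, so the large rate `K / u` does no harm. -/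
lemma gap_le_of_mem_far {m i j : ℕ} (e : I × Loss) (hj : j ∈ far (2 ^ m) i) :
    ((gridVal (2 ^ m) e i - gridVal (2 ^ m) e j + (2 ^ m : ℕ) : ℤ) : ℝ) ≤
      score m e i - score m e j := by
  have h1 : Nat.log 2 (i.gcd (2 ^ m)) + 1 ≤ Nat.log 2 (j.gcd (2 ^ m)) := by
    rw [← Nat.log_mul_base (by norm_num)
      (Nat.gcd_pos_of_pos_right i (Nat.two_pow_pos m)).ne', mul_comm]
    exact Nat.log_mono_right (two_mul_gcd_le_of_mem_far hj)
  have h2 : (Nat.log 2 (i.gcd (2 ^ m)) : ℝ) + 1 ≤ Nat.log 2 (j.gcd (2 ^ m)) := by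
    exact_mod_cast h1
  have h3 : (0 : ℝ) < 2 ^ m := by positivity
  unfold score
  push_cast
  nlinarith

/-- A general move may sink by up to `m` levels; together with its bonus this accounts for `m + 1`.
-/
lemma gap_le {m : ℕ} (e : I × Loss) (i j : ℕ) :
    ((gridVal (2 ^ m) e i - gridVal (2 ^ m) e j + (2 ^ m : ℕ) : ℤ) : ℝ) ≤
      score m e i - score m e j + 2 ^ m * (m + 1) := by
  have h2 : (Nat.log 2 (i.gcd (2 ^ m)) : ℝ) ≤ m := by exact_mod_cast log_gcd_le m i
  have h1 : (0 : ℝ) ≤ Nat.log 2 (j.gcd (2 ^ m)) := by positivity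
  have h3 : (0 : ℝ) < 2 ^ m := by positivity
  unfold score
  push_cast
  nlinarith

/-- The values differ by at most `K ^ 2 + 1`, the penalties by at most `K * m ≤ K ^ 2`. This crude
range suffices for the averaging and rounding errors. -/
lemma abs_score_sub_le {m i j : ℕ} (e : I × Loss) (hi : i ≤ 2 ^ m) (hj : j ≤ 2 ^ m) :
    |score m e i - score m e j| ≤ 3 * (2 ^ m) ^ 2 := by
  have h0 := abs_gridVal_sub_le (K := 2 ^ m) (by positivity) e hi hj
  have h1 : |(i : ℤ) - j| ≤ (2 ^ m : ℕ) := by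
    rw [abs_le]
    constructor <;> omega
  have h2 : |gridVal (2 ^ m) e i - gridVal (2 ^ m) e j| ≤ (2 ^ m : ℕ) * (2 ^ m : ℕ) + 1 :=
    h0.trans (by gcongr)
  have h3 : |(gridVal (2 ^ m) e i : ℝ) - gridVal (2 ^ m) e j| ≤ 2 ^ m * 2 ^ m + 1 := by
    exact_mod_cast h2
  have hi1 : (Nat.log 2 (i.gcd (2 ^ m)) : ℝ) ≤ m := by exact_mod_cast log_gcd_le m i
  have hj1 : (Nat.log 2 (j.gcd (2 ^ m)) : ℝ) ≤ m := by exact_mod_cast log_gcd_le m j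
  have hi2 : (0 : ℝ) ≤ Nat.log 2 (i.gcd (2 ^ m)) := by positivity
  have hj2 : (0 : ℝ) ≤ Nat.log 2 (j.gcd (2 ^ m)) := by positivity
  have hm : (m : ℝ) ≤ 2 ^ m := by exact_mod_cast Nat.lt_two_pow_self.le
  have h4 : (1 : ℝ) ≤ 2 ^ m := one_le_pow₀ (by norm_num)
  rw [abs_le] at h3 ⊢
  unfold score
  constructor <;> nlinarith

lemma sum_near_realRate_le {K : ℕ} (hK : 0 < K) (h : Transcript) {i : ℕ} (hi : i ≤ K) :
    ∑ j ∈ near K i, (weight K h i j : ℝ) / (nearTotal K h i : ℝ) ≤ 1 := by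
  have h1 : (0 : ℝ) < nearTotal K h i := by exact_mod_cast nearTotal_pos hK h hi
  rw [← sum_div, div_le_one h1]
  have := den_pos hK h i
  have h2 : ∑ j ∈ near K i, weight K h i j ≤ nearTotal K h i := by
    unfold nearTotal
    linarith
  exact_mod_cast h2

/-- Only the local part incurs the excess `2 ^ m * (m + 1)`, and its rates sum to at most one. -/
lemma sum_realRate_mul_gap_le {m : ℕ} (h : Transcript) (e : I × Loss) {i : ℕ} (hi : i ≤ 2 ^ m) :
    ∑ j ∈ range (2 ^ m + 1), realRate (2 ^ m) h i j *
        ((gridVal (2 ^ m) e i - gridVal (2 ^ m) e j + (2 ^ m : ℕ) : ℤ) : ℝ) ≤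
      ∑ j ∈ range (2 ^ m + 1), realRate (2 ^ m) h i j * (score m e i - score m e j) +
        2 ^ m * (m + 1) := by
  have hK : 0 < 2 ^ m := by positivity
  have e2 : range (2 ^ m + 1) ∩ near (2 ^ m) i = near (2 ^ m) i :=
    inter_eq_right.2 (filter_subset _ _)
  have h1 := sum_near_realRate_le hK h hi
  rw [← e2, ← sum_ite_mem] at h1
  have h2 := mul_le_mul_of_nonneg_right h1 (show (0 : ℝ) ≤ 2 ^ m * (m + 1) by positivity)
  rw [one_mul, sum_mul] at h2
  refine le_trans ?_ (add_le_add_right h2 _)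
  rw [← sum_add_distrib]
  refine sum_le_sum fun j _ => ?_
  have hg := gap_le e i j (m := m)
  have hn : 0 ≤ if j ∈ near (2 ^ m) i then
      (weight (2 ^ m) h i j : ℝ) / (nearTotal (2 ^ m) h i : ℝ) else 0 := by
    split_ifs with hj
    · have h3 := weight_pos hK h hi hj
      have h4 := nearTotal_pos hK h hi
      positivity
    · exact le_rfl
  simp only [realRate, add_mul]
  by_cases hf : j ∈ far (2 ^ m) i
  · have hg' := gap_le_of_mem_far e hf
    have hf0 : 0 ≤ ((2 ^ m : ℕ) : ℝ) / (i.gcd (2 ^ m) : ℝ) *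
        ((weight (2 ^ m) h i j : ℝ) / (farTotal (2 ^ m) h i : ℝ)) := by
      have h3 := weight_pos hK h hi (far_subset_near _ _ hf)
      have h4 := farTotal_pos hK h hi
      positivity
    simp only [hf, if_true]
    nlinarith [mul_le_mul_of_nonneg_left hg hn, mul_le_mul_of_nonneg_left hg' hf0]
  · simp only [hf, if_false]
    nlinarith [mul_le_mul_of_nonneg_left hg hn]

/-- At most two quotients are rounded down, each losing at most one. -/
lemma abs_realRate_sub_rate_le {K : ℕ} (hK : 0 < K) (h : Transcript) {i : ℕ} (hi : i ≤ K) (j : ℕ) :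
    |resolution K * realRate K h i j - rate K h i j| ≤ 2 := by
  have hfl : ∀ a b : ℤ, 0 < b → 0 ≤ (a : ℝ) / b - ((a / b : ℤ) : ℝ) ∧
      (a : ℝ) / b - ((a / b : ℤ) : ℝ) ≤ 1 := by
    intro a b hb
    have hb' : (0 : ℝ) < b := by exact_mod_cast hb
    have h1 : ((a / b * b : ℤ) : ℝ) ≤ a := by exact_mod_cast Int.ediv_mul_le a hb.ne'
    have h2 : (a : ℝ) < ((a / b + 1) * b : ℤ) := by
      exact_mod_cast Int.lt_ediv_add_one_mul_self a hb
    push_cast at h1 h2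
    rw [le_sub_iff_add_le, zero_add, le_div_iff₀ hb', sub_le_iff_le_add, div_le_iff₀ hb']
    constructor <;> linarith
  have hu : (0 : ℤ) < i.gcd K := by exact_mod_cast one_le_gcd hK i
  have h1 := hfl (resolution K * K * weight K h i j) ((i.gcd K : ℤ) * farTotal K h i)
    (mul_pos hu (farTotal_pos hK h hi))
  have h2 := hfl (resolution K * weight K h i j) (nearTotal K h i) (nearTotal_pos hK h hi)
  have e1 : ((resolution K * K * weight K h i j : ℤ) : ℝ) /
        (((i.gcd K : ℤ) * farTotal K h i : ℤ) : ℝ)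
      = resolution K * ((K : ℝ) / (i.gcd K : ℝ) * ((weight K h i j : ℝ) / farTotal K h i)) := by
    push_cast
    rw [div_mul_div_comm, mul_div_assoc', mul_assoc]
  have e2 : ((resolution K * weight K h i j : ℤ) : ℝ) / ((nearTotal K h i : ℤ) : ℝ)
      = resolution K * ((weight K h i j : ℝ) / nearTotal K h i) := by
    push_cast
    rw [mul_div_assoc']
  rw [e1] at h1
  rw [e2] at h2
  unfold realRate rate
  rw [abs_le]
  push_cast
  split_ifs <;> constructor <;> simp only [mul_add, mul_zero] <;> linarith

/-- Only the cell of the prediction changes its potential. The constant becomes `m + 2` because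
rounding the rates costs one more `2 ^ m`. -/
lemma potential_append_le {m : ℕ} (h : Transcript) {e : I × Loss} {i : ℕ} (hi : i ≤ 2 ^ m)
    (he : cellOf (2 ^ m) e = i) :
    potential (2 ^ m) (h ++ [e]) ≤ potential (2 ^ m) h +
      (1 / (resolution (2 ^ m) : ℝ) *
        ∑ j ∈ range (2 ^ m + 1), (rate (2 ^ m) h i j : ℝ) * (score m e i - score m e j) +
        2 ^ m * (m + 2)) / (2 ^ m) ^ 2 := by
  have hK : 0 < 2 ^ m := by positivity
  have hi' : i ∈ range (2 ^ m + 1) := mem_range.2 (by omega)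
  have h1 := cellPotential_append_le hK h hi he
  have h2 := sum_realRate_mul_gap_le h e hi
  have hM : (resolution (2 ^ m) : ℝ) = 12 * (2 ^ m) ^ 2 := by simp [resolution]
  have hM0 : (0 : ℝ) < resolution (2 ^ m) := by rw [hM]; positivity
  have h3 : ∑ j ∈ range (2 ^ m + 1), realRate (2 ^ m) h i j * (score m e i - score m e j) ≤
      1 / (resolution (2 ^ m) : ℝ) *
        ∑ j ∈ range (2 ^ m + 1), (rate (2 ^ m) h i j : ℝ) * (score m e i - score m e j) + 2 ^ m := by
    -- The resolution `12 * K ^ 2` is chosen so that the error is at most `2 * (3 * K ^ 2) / (12 * K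
    -- ^ 2) = 1 / 2` per target; the `K + 1` targets then lose at most `K`.
    have h4 : ∀ j ∈ range (2 ^ m + 1), realRate (2 ^ m) h i j * (score m e i - score m e j) ≤
        1 / (resolution (2 ^ m) : ℝ) * ((rate (2 ^ m) h i j : ℝ) * (score m e i - score m e j)) +
          1 / 2 := by
      intro j hj
      have h5 := abs_realRate_sub_rate_le hK h hi j
      have h6 := abs_score_sub_le e hi (show j ≤ 2 ^ m by have := mem_range.1 hj; omega)
      have h7 : (resolution (2 ^ m) * realRate (2 ^ m) h i j - rate (2 ^ m) h i j) *
          (score m e i - score m e j) ≤ 2 * (3 * (2 ^ m) ^ 2) := by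
        refine (le_abs_self _).trans ?_
        rw [abs_mul]
        gcongr
      have h8 : realRate (2 ^ m) h i j * (score m e i - score m e j)
          = 1 / (resolution (2 ^ m) : ℝ) *
              ((rate (2 ^ m) h i j : ℝ) * (score m e i - score m e j)) +
            (resolution (2 ^ m) * realRate (2 ^ m) h i j - rate (2 ^ m) h i j) *
              (score m e i - score m e j) / (resolution (2 ^ m) : ℝ) := by
        field_simp
        ring
      rw [h8]
      refine add_le_add le_rfl ?_
      rw [div_le_iff₀ hM0]
      linarith
    refine (sum_le_sum h4).trans ?_
    rw [sum_add_distrib, ← mul_sum]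
    have h9 : (1 : ℝ) ≤ 2 ^ m := one_le_pow₀ (by norm_num)
    gcongr
    simp
    linarith
  have h10 : potential (2 ^ m) (h ++ [e]) - potential (2 ^ m) h
      = cellPotential (2 ^ m) (h ++ [e]) i - cellPotential (2 ^ m) h i := by
    unfold potential
    rw [← sum_sub_distrib]
    refine sum_eq_single_of_mem i hi' fun j _ hji => ?_
    rw [cellPotential_append_of_ne h, sub_self]
    rw [he]
    exact_mod_cast hji.symm
  rw [← sum_div] at h1
  have h11 : (∑ j ∈ range (2 ^ m + 1), realRate (2 ^ m) h i j *
        ((gridVal (2 ^ m) e i - gridVal (2 ^ m) e j + (2 ^ m : ℕ) : ℤ) : ℝ)) /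
        ((2 ^ m : ℕ) : ℝ) ^ 2 ≤ (1 / (resolution (2 ^ m) : ℝ) *
        ∑ j ∈ range (2 ^ m + 1), (rate (2 ^ m) h i j : ℝ) * (score m e i - score m e j) +
        2 ^ m * (m + 2)) / (2 ^ m) ^ 2 := by
    push_cast at h2 ⊢
    gcongr
    linarith
  linarith

/-! ### The strategy -/

/-- The integer weights of the distribution over the grid points. -/
def predWeight (K : ℕ) (h : Transcript) (j : ℕ) : ℤ :=
  flowSum (K + 1) (2 * K * resolution K) (rate K h) (K * K) j

lemma predWeight_nonneg {K : ℕ} (hK : 0 < K) (h : Transcript) {j : ℕ} (hj : j ≤ K) :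
    0 ≤ predWeight K h j := by
  have hB : 0 ≤ 2 * (K : ℤ) * resolution K := by
    have := resolution_pos hK
    positivity
  exact flowSum_nonneg (fun i hi j _ => rate_nonneg hK h (Nat.lt_succ_iff.1 hi) j)
    (fun i hi => sum_rate_le hK h (Nat.lt_succ_iff.1 hi)) hB _ j (Nat.lt_succ_iff.2 hj)

lemma sum_predWeight {K : ℕ} (hK : 0 < K) (h : Transcript) :
    ∑ j ∈ range (K + 1), predWeight K h j
      = (K : ℤ) * K * (2 * K * resolution K) ^ (K * K - 1) := by
  obtain ⟨k, hk⟩ : ∃ k, K * K = k + 1 := ⟨K * K - 1, by have := Nat.mul_pos hK hK; omega⟩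
  have h1 : (K : ℤ) * K = k + 1 := by exact_mod_cast hk
  simp only [predWeight]
  rw [h1, hk, sum_flowSum (by omega)]
  simp

lemma sum_predWeight_pos {K : ℕ} (hK : 0 < K) (h : Transcript) :
    0 < ∑ j ∈ range (K + 1), predWeight K h j := by
  rw [sum_predWeight hK]
  have := resolution_pos hK
  positivity

/-- Averaging the one-round increase over the prediction turns the score differences into the drift
of a single potential, which near-stationarity makes small for every loss `l`. -/
lemma sum_predWeight_mul_potential_le {m : ℕ} (h : Transcript) (l : Loss) :
    ∑ i ∈ range (2 ^ m + 1), (predWeight (2 ^ m) h i : ℝ) *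
        potential (2 ^ m) (h ++ [(gridPt (2 ^ m) i, l)]) ≤
      (∑ i ∈ range (2 ^ m + 1), (predWeight (2 ^ m) h i : ℝ)) *
        (potential (2 ^ m) h + (m + 8) / 2 ^ m) := by
  have hK : 0 < 2 ^ m := by positivity
  have hR := resolution_pos hK
  have hMe : (resolution (2 ^ m) : ℝ) = 12 * (2 ^ m) ^ 2 := by simp [resolution]
  set M : ℝ := ((resolution (2 ^ m) : ℤ) : ℝ) with hM
  have hM0 : 0 < M := by rw [hM]; exact_mod_cast hR
  set ψ : ℕ → ℝ := score m (0, l) with hψ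
  have h1 := drift_flowSum_le (n := 2 ^ m + 1) (B := 2 * (2 ^ m : ℕ) * resolution (2 ^ m))
    (A := rate (2 ^ m) h) (by omega)
    (fun i hi j _ => rate_nonneg hK h (by omega) j) (fun i hi => sum_rate_le hK h (by omega))
    (2 ^ m * 2 ^ m) (ψ := ψ) (D := 3 * (2 ^ m) ^ 2)
    (fun j hj => (le_abs_self _).trans (abs_score_sub_le (0, l) (by omega) (by omega)))
  have h2 : ∑ i ∈ range (2 ^ m + 1), (predWeight (2 ^ m) h i : ℝ) *
        potential (2 ^ m) (h ++ [(gridPt (2 ^ m) i, l)]) ≤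
      ∑ i ∈ range (2 ^ m + 1), (predWeight (2 ^ m) h i : ℝ) *
        (potential (2 ^ m) h + (m + 2) / 2 ^ m + 1 / (M * (2 ^ m) ^ 2) *
          ∑ j ∈ range (2 ^ m + 1), (rate (2 ^ m) h i j : ℝ) * (ψ i - ψ j)) := by
    refine sum_le_sum fun i hi => mul_le_mul_of_nonneg_left ?_ ?_
    · have hi' : i ≤ 2 ^ m := by have := mem_range.1 hi; omega
      refine (potential_append_le h hi' (cellOf_gridPt hK hi' l)).trans (le_of_eq ?_)
      change _ + (1 / M * ∑ j ∈ range (2 ^ m + 1), (rate (2 ^ m) h i j : ℝ) * (ψ i - ψ j) +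
        2 ^ m * (m + 2)) / (2 ^ m) ^ 2 = _
      field_simp
      ring
    · exact_mod_cast predWeight_nonneg hK h (by have := mem_range.1 hi; omega)
  refine h2.trans ?_
  have h3 : ∑ i ∈ range (2 ^ m + 1), (predWeight (2 ^ m) h i : ℝ)
      = 2 ^ m * 2 ^ m * (2 * 2 ^ m * M) ^ (2 ^ m * 2 ^ m - 1) := by
    have := sum_predWeight hK h
    rw [hM]
    exact_mod_cast this
  -- Averaging error: with range `3 K ^ 2`, scale `2 K M` and `K ^ 2` iterates it is `2 K M * 3 K ^
  -- 2 / (K ^ 2 * M * K ^ 2) = 6 / K`.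
  have h4 : 1 / (M * (2 ^ m) ^ 2) * ∑ i ∈ range (2 ^ m + 1), (predWeight (2 ^ m) h i : ℝ) *
      ∑ j ∈ range (2 ^ m + 1), (rate (2 ^ m) h i j : ℝ) * (ψ i - ψ j) ≤
      (∑ i ∈ range (2 ^ m + 1), (predWeight (2 ^ m) h i : ℝ)) * (6 / 2 ^ m) := by
    refine (mul_le_mul_of_nonneg_left h1 (by positivity)).trans (le_of_eq ?_)
    rw [h3]
    push_cast
    rw [← hM]
    have h5 : (2 * 2 ^ m * M) ^ (2 ^ m * 2 ^ m)
        = (2 * 2 ^ m * M) ^ (2 ^ m * 2 ^ m - 1) * (2 * 2 ^ m * M) := by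
      rw [← pow_succ]
      congr 1
      have := Nat.mul_pos hK hK
      omega
    rw [h5]
    field_simp
    ring
  have h6 : ∑ i ∈ range (2 ^ m + 1), (predWeight (2 ^ m) h i : ℝ) *
        (potential (2 ^ m) h + (m + 2) / 2 ^ m + 1 / (M * (2 ^ m) ^ 2) *
          ∑ j ∈ range (2 ^ m + 1), (rate (2 ^ m) h i j : ℝ) * (ψ i - ψ j))
      = (∑ i ∈ range (2 ^ m + 1), (predWeight (2 ^ m) h i : ℝ)) *
          (potential (2 ^ m) h + (m + 2) / 2 ^ m) +
        1 / (M * (2 ^ m) ^ 2) * ∑ i ∈ range (2 ^ m + 1), (predWeight (2 ^ m) h i : ℝ) *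
          ∑ j ∈ range (2 ^ m + 1), (rate (2 ^ m) h i j : ℝ) * (ψ i - ψ j) := by
    rw [sum_mul, mul_sum, ← sum_add_distrib]
    refine sum_congr rfl fun i _ => by ring
  rw [h6]
  have h7 : potential (2 ^ m) h + (m + 8) / 2 ^ m
      = (potential (2 ^ m) h + (m + 2) / 2 ^ m) + 6 / 2 ^ m := by ring
  rw [h7, mul_add]
  linarith

/-! ### The potential bounds the swap regret -/

/-- The sum of `f` over the rounds whose prediction is in the cell `i`. -/
def cellSum (K : ℕ) (h : Transcript) (i : ℕ) (f : I × Loss → ℝ) : ℝ :=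
  (h.map fun e => if cellOf K e = i then f e else 0).sum

lemma cellSum_mono (K : ℕ) (h : Transcript) (i : ℕ) {f g : I × Loss → ℝ} (hfg : ∀ e, f e ≤ g e) :
    cellSum K h i f ≤ cellSum K h i g :=
  List.sum_le_sum fun e _ => by
    split_ifs
    · exact hfg e
    · exact le_rfl

lemma cellSum_const_mul (K : ℕ) (h : Transcript) (i : ℕ) (c : ℝ) (f : I × Loss → ℝ) :
    cellSum K h i (fun e => c * f e) = c * cellSum K h i f := by
  unfold cellSum
  rw [← List.sum_map_mul_left]
  simp only [mul_ite, mul_zero]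

lemma cellSum_add (K : ℕ) (h : Transcript) (i : ℕ) (f g : I × Loss → ℝ) :
    cellSum K h i (fun e => f e + g e) = cellSum K h i f + cellSum K h i g := by
  unfold cellSum
  rw [← List.sum_map_add]
  congr 2
  funext e
  split_ifs <;> simp

lemma cellSum_one_nonneg (K : ℕ) (h : Transcript) (i : ℕ) : 0 ≤ cellSum K h i fun _ => 1 := by
  refine List.sum_nonneg fun x hx => ?_
  simp only [List.mem_map] at hx
  obtain ⟨e, _, rfl⟩ := hx
  split_ifs <;> norm_num

/-- The predictions of the transcript are grid points. -/
def OnGrid (K : ℕ) (h : Transcript) : Prop := ∀ e ∈ h, ∃ i ≤ K, e.1 = gridPt K i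

lemma sum_cellSum {K : ℕ} (hK : 0 < K) {h : Transcript} (hh : OnGrid K h) (f : ℕ → I × Loss → ℝ)
    (g : I × Loss → ℝ) (hfg : ∀ i ≤ K, ∀ l, f i (gridPt K i, l) = g (gridPt K i, l)) :
    ∑ i ∈ range (K + 1), cellSum K h i (f i) = (h.map g).sum := by
  induction h with
  | nil => simp [cellSum]
  | cons e h ih =>
    have h1 := ih fun e' he' => hh e' (List.mem_cons_of_mem _ he')
    obtain ⟨k, hk, hek⟩ := hh e List.mem_cons_self
    obtain ⟨p, l⟩ := e
    obtain rfl : p = gridPt K k := hek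
    simp only [cellSum] at h1
    simp only [cellSum, List.map_cons, List.sum_cons, sum_add_distrib, h1]
    congr 1
    rw [cellOf_gridPt hK hk, ← hfg k hk]
    rw [sum_eq_single_of_mem k (mem_range.2 (by omega))]
    · simp
    · intro i _ hik
      rw [if_neg]
      exact_mod_cast hik.symm

/-! ### Regret in one cell: against a move, then against an arbitrary point. -/

/-- The logarithm of the product weight is a sum over rounds, and in each round the bonus dominates
the quadratic loss. So the bound is linear in the gaps, with no second-order term. -/
lemma cellSum_gap_le_log {K : ℕ} (hK : 0 < K) (h : Transcript) {i j : ℕ} (hi : i ≤ K)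
    (hj : j ∈ near K i) :
    cellSum K h i (fun e => ((gridVal K e i - gridVal K e j : ℤ) : ℝ) /
        (16 * (i.gcd K : ℝ) ^ 2 * K)) ≤
      Real.log ((weight K h i j : ℝ) / (den K h i : ℝ)) := by
  induction h with
  | nil => simp [cellSum, weight, den]
  | cons e h ih =>
    have hw : (0 : ℝ) < weight K h i j := by exact_mod_cast weight_pos hK h hi hj
    have hd : (0 : ℝ) < den K h i := by exact_mod_cast den_pos hK h i
    have ew : weight K (e :: h) i j
        = (if cellOf K e = i then stepFactor K e i j else 1) * weight K h i j := by simp [weight]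
    have ed : den K (e :: h) i
        = (if cellOf K e = i then baseFactor K i else 1) * den K h i := by simp [den]
    have es : ∀ f, cellSum K (e :: h) i f
        = (if cellOf K e = i then f e else 0) + cellSum K h i f := by simp [cellSum]
    rw [ew, ed, es]
    split_ifs with hc
    · have hb : (baseFactor K i : ℝ) = 16 * (i.gcd K : ℝ) ^ 2 * K := by simp [baseFactor]
      have hb0 : (0 : ℝ) < baseFactor K i := by exact_mod_cast baseFactor_pos hK i
      have hs0 : (0 : ℝ) < stepFactor K e i j := by exact_mod_cast stepFactor_pos hK e hi hj
      have h1 := le_log_one_add (u := i.gcd K) (K := K)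
        (g := ((gridVal K e i - gridVal K e j : ℤ) : ℝ))
        (by exact_mod_cast one_le_gcd hK i) (by exact_mod_cast hK)
        (by exact_mod_cast abs_gap_le hK e hi hj)
      have h2 : (stepFactor K e i j : ℝ) = 16 * (i.gcd K : ℝ) ^ 2 * K +
          (((gridVal K e i - gridVal K e j : ℤ) : ℝ) + K) := by
        simp [stepFactor, baseFactor]
      push_cast at h1 h2 ih ⊢
      rw [mul_div_mul_comm, Real.log_mul (by positivity) (by positivity), h2, hb]
      linarith
    · simpa using ih

lemma log_weight_le_nearLog {K : ℕ} (hK : 0 < K) (h : Transcript) {i j : ℕ} (hi : i ≤ K)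
    (hj : j ∈ near K i) : Real.log ((weight K h i j : ℝ) / (den K h i : ℝ)) ≤ nearLog K h i := by
  have hw : (0 : ℝ) < weight K h i j := by exact_mod_cast weight_pos hK h hi hj
  have hd : (0 : ℝ) < den K h i := by exact_mod_cast den_pos hK h i
  have h1 : weight K h i j ≤ nearTotal K h i := by
    have := single_le_sum (fun j hj => (weight_pos hK h hi hj).le) hj
    have := den_pos hK h i
    unfold nearTotal
    linarith
  refine Real.log_le_log (by positivity) ?_
  gcongr

lemma log_weight_le_farLog {K : ℕ} (hK : 0 < K) (h : Transcript) {i j : ℕ} (hi : i ≤ K)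
    (hj : j ∈ far K i) : Real.log ((weight K h i j : ℝ) / (den K h i : ℝ)) ≤ farLog K h i := by
  have hw : (0 : ℝ) < weight K h i j := by
    exact_mod_cast weight_pos hK h hi (far_subset_near K i hj)
  have hd : (0 : ℝ) < den K h i := by exact_mod_cast den_pos hK h i
  have h1 : weight K h i j ≤ farTotal K h i := by
    have := single_le_sum (fun j hj => (weight_pos hK h hi (far_subset_near K i hj)).le) hj
    have := den_pos hK h i
    unfold farTotal
    linarith
  refine Real.log_le_log (by positivity) ?_
  gcongr

lemma cellSum_sub_gridPt_le {K : ℕ} (hK : 0 < K) (h : Transcript) {i j : ℕ} (hi : i ≤ K)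
    (hj : j ∈ near K i) :
    cellSum K h i (fun e => e.2 (gridPt K i) - e.2 (gridPt K j)) ≤
      16 * (i.gcd K : ℝ) ^ 2 / K * Real.log ((weight K h i j : ℝ) / (den K h i : ℝ)) +
        cellSum K h i (fun _ => 1) / (K : ℝ) ^ 2 := by
  have hu : (0 : ℝ) < i.gcd K := by exact_mod_cast one_le_gcd hK i
  have hK' : (0 : ℝ) < K := by exact_mod_cast hK
  have h1 := mul_le_mul_of_nonneg_left (cellSum_gap_le_log hK h hi hj)
    (show 0 ≤ 16 * (i.gcd K : ℝ) ^ 2 / K by positivity)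
  refine le_trans ?_ (add_le_add_left h1 _)
  rw [← cellSum_const_mul, div_eq_inv_mul (cellSum K h i fun _ => 1), ← cellSum_const_mul,
    ← cellSum_add]
  refine cellSum_mono K h i fun e => ?_
  have h2 := (abs_le.1 (abs_gridVal_sub_sub_le K e i j)).1
  have h3 : 16 * (i.gcd K : ℝ) ^ 2 / K * (((gridVal K e i - gridVal K e j : ℤ) : ℝ) /
      (16 * (i.gcd K : ℝ) ^ 2 * K)) = ((gridVal K e i - gridVal K e j : ℤ) : ℝ) / (K : ℝ) ^ 2 := by
    field_simp
  rw [h3, mul_one, inv_eq_one_div, ← add_div, le_div_iff₀ (by positivity)]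
  linarith

lemma Loss.mul_sub_le (l : Loss) {x y z : I} {θ : ℝ} (h0 : 0 ≤ θ) (h1 : θ ≤ 1)
    (hy : (y : ℝ) - x = θ * (z - x)) : θ * (l x - l z) ≤ l x - l y := by
  have h := l.convex.2 x.2 z.2 (sub_nonneg.2 h1) h0 (by ring)
  have e1 : (1 - θ) • (x : ℝ) + θ • (z : ℝ) = y := by
    simp only [smul_eq_mul]
    linarith
  rw [e1, Set.IccExtend_val, Set.IccExtend_val, Set.IccExtend_val] at h
  simp only [smul_eq_mul] at h
  linarith

/-- Round `K * s` towards `i`, so that the rounded point stays within distance `gcd i K` of `i`. -/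
lemma exists_near_gridPt {K : ℕ} (hK : 0 < K) {i : ℕ} (hi : i ≤ K) (s : I)
    (hs : |(s : ℝ) - i / K| ≤ (i.gcd K : ℝ) / K) :
    ∃ j ∈ near K i, |(gridPt K j : ℝ) - s| ≤ 1 / K := by
  have hK' : (0 : ℝ) < K := by exact_mod_cast hK
  have hs' : |(K : ℝ) * s - i| ≤ i.gcd K := by
    have e : (K : ℝ) * s - i = K * (s - i / K) := by field_simp
    rw [e, abs_mul, abs_of_pos hK']
    rw [le_div_iff₀ hK'] at hs
    linarith
  have hs0 : 0 ≤ (K : ℝ) * s := mul_nonneg hK'.le s.2.1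
  have hs1 : (K : ℝ) * s ≤ K := mul_le_of_le_one_right hK'.le s.2.2
  have key : ∀ j : ℕ, j ≤ K → |(i : ℤ) - j| ≤ i.gcd K → |(j : ℝ) - K * s| ≤ 1 →
      ∃ j ∈ near K i, |(gridPt K j : ℝ) - s| ≤ 1 / K := by
    intro j hjK hij hjs
    refine ⟨j, by simp only [near, mem_filter, mem_range]; exact ⟨by omega, hij⟩, ?_⟩
    rw [coe_gridPt hjK, le_div_iff₀ hK', ← abs_of_pos hK', ← abs_mul, abs_of_pos hK']
    have e : ((j : ℝ) / K - s) * K = j - K * s := by field_simp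
    rwa [e]
  rw [abs_le] at hs'
  rcases le_total (i : ℝ) (K * s) with hle | hle
  · have h1 := Nat.floor_le hs0
    have h2 := Nat.lt_floor_add_one ((K : ℝ) * s)
    have h3 : i ≤ ⌊(K : ℝ) * s⌋₊ := Nat.le_floor hle
    have h4 : ⌊(K : ℝ) * s⌋₊ ≤ i + i.gcd K := by
      have : (⌊(K : ℝ) * s⌋₊ : ℝ) ≤ (i + i.gcd K : ℕ) := by push_cast; linarith
      exact_mod_cast this
    refine key ⌊(K : ℝ) * s⌋₊ (by exact_mod_cast h1.trans hs1) ?_ ?_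
    · rw [abs_le]; omega
    · rw [abs_le]; constructor <;> linarith
  · have h1 := Nat.le_ceil ((K : ℝ) * s)
    have h2 := Nat.ceil_lt_add_one hs0
    have h3 : ⌈(K : ℝ) * s⌉₊ ≤ i := Nat.ceil_le.2 hle
    have h4 : i ≤ ⌈(K : ℝ) * s⌉₊ + i.gcd K := by
      have : (i : ℝ) ≤ (⌈(K : ℝ) * s⌉₊ + i.gcd K : ℕ) := by push_cast; linarith
      exact_mod_cast this
    refine key ⌈(K : ℝ) * s⌉₊ (by omega) ?_ ?_
    · rw [abs_le]; omega
    · rw [abs_le]; constructor <;> linarith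

/-- Since all distances are at most one, the hypothesis forces `gcd i K < K`; thus `i` is not an
endpoint, and both `i ± gcd i K` lie on the grid. -/
lemma exists_far_gridPt {K : ℕ} (hK : 0 < K) {i : ℕ} (hi : i ≤ K) (s : I)
    (hs : (i.gcd K : ℝ) / K < |(s : ℝ) - i / K|) :
    ∃ j ∈ far K i, (gridPt K j : ℝ) - gridPt K i =
      (i.gcd K : ℝ) / K / |(s : ℝ) - i / K| * (s - gridPt K i) := by
  have hK' : (0 : ℝ) < K := by exact_mod_cast hK
  have hu : 0 < i.gcd K := one_le_gcd hK i
  have hlt : i.gcd K < K := by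
    have h1 := abs_unitInterval_sub_le s (gridPt K i)
    rw [coe_gridPt hi] at h1
    have h2 := hs.trans_le h1
    rw [div_lt_one hK'] at h2
    exact_mod_cast h2
  have hi0 : i ≠ 0 := by
    rintro rfl
    simp at hlt
  have hiK : i ≠ K := by
    rintro rfl
    simp at hlt
  have h1 : i.gcd K ≤ i := Nat.gcd_le_left K (by omega)
  have h2 : i + i.gcd K ≤ K := by
    have h3 : i.gcd K ∣ K - i := Nat.dvd_sub (Nat.gcd_dvd_right i K) (Nat.gcd_dvd_left i K)
    have := Nat.le_of_dvd (by omega) h3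
    omega
  have ht : 0 < |(s : ℝ) - i / K| := lt_of_le_of_lt (by positivity) hs
  rcases le_total 0 ((s : ℝ) - i / K) with h0 | h0
  · refine ⟨i + i.gcd K, ?_, ?_⟩
    · simp only [far, mem_filter, mem_range]
      refine ⟨by omega, hlt, ?_⟩
      rw [Nat.cast_add, sub_add_cancel_left, abs_neg, abs_of_nonneg (by positivity)]
    · rw [coe_gridPt h2, coe_gridPt hi]
      rw [abs_of_nonneg h0] at ht ⊢
      rw [div_mul_cancel₀ _ ht.ne']
      push_cast
      ring
  · refine ⟨i - i.gcd K, ?_, ?_⟩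
    · simp only [far, mem_filter, mem_range]
      refine ⟨by omega, hlt, ?_⟩
      rw [Nat.cast_sub h1, sub_sub_cancel, abs_of_nonneg (by positivity)]
    · rw [coe_gridPt (by omega : i - i.gcd K ≤ K), coe_gridPt hi]
      rw [abs_of_nonpos h0] at ht ⊢
      have e : (i.gcd K : ℝ) / K / -((s : ℝ) - i / K) * (s - i / K) = -((i.gcd K : ℝ) / K) := by
        have : (s : ℝ) - i / K ≠ 0 := by linarith
        generalize (s : ℝ) - i / K = t at *
        field_simp
      rw [e, Nat.cast_sub h1]
      ring

/-- A close comparator is rounded to the target of a local move, losing `1 / K` per round. A distant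
one is replaced by a long move in its direction, and the inequality for that move is divided by the
convexity factor `θ`. Rounding the values costs `1 / K ^ 2` per round before this division, hence at
most `1 / K` after it. -/
lemma cellRegret_le {K : ℕ} (hK : 0 < K) (h : Transcript) {i : ℕ} (hi : i ≤ K) (s : I) :
    cellSum K h i (fun e => e.2 (gridPt K i) - e.2 s) ≤
      cellPotential K h i + 2 / K * cellSum K h i (fun _ => 1) := by
  have hK' : (0 : ℝ) < K := by exact_mod_cast hK
  have hK1 : (1 : ℝ) ≤ K := by exact_mod_cast hK
  have hu : (0 : ℝ) < i.gcd K := by exact_mod_cast one_le_gcd hK i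
  have hu1 : (1 : ℝ) ≤ i.gcd K := by exact_mod_cast one_le_gcd hK i
  have hn := cellSum_one_nonneg K h i
  set n := cellSum K h i (fun _ => 1) with hn_def
  have hnl := nearLog_nonneg hK h hi
  have hfl := farLog_nonneg hK h hi
  have hKsq : n / (K : ℝ) ^ 2 ≤ n / K := by
    gcongr
    nlinarith
  rcases le_or_gt |(s : ℝ) - i / K| ((i.gcd K : ℝ) / K) with hs | hs
  · obtain ⟨j, hj, hjs⟩ := exists_near_gridPt hK hi s hs
    have h1 := cellSum_sub_gridPt_le hK h hi hj
    have h2 := mul_le_mul_of_nonneg_left (log_weight_le_nearLog hK h hi hj)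
      (show 0 ≤ 16 * (i.gcd K : ℝ) ^ 2 / K by positivity)
    have h3 : cellSum K h i (fun e => e.2 (gridPt K i) - e.2 s) ≤
        cellSum K h i (fun e => e.2 (gridPt K i) - e.2 (gridPt K j)) + 1 / K * n := by
      rw [hn_def, ← cellSum_const_mul, ← cellSum_add]
      refine cellSum_mono K h i fun e => ?_
      have := (le_abs_self _).trans ((e.2.abs_sub_le (gridPt K j) s).trans hjs)
      linarith
    have h4 : 0 ≤ 16 * (i.gcd K : ℝ) * farLog K h i := by positivity
    have e1 : 2 / (K : ℝ) * n = n / K + 1 / K * n := by ring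
    rw [← hn_def] at h1
    unfold cellPotential
    rw [e1]
    linarith
  · obtain ⟨j, hj, hjs⟩ := exists_far_gridPt hK hi s hs
    have h1 := cellSum_sub_gridPt_le hK h hi (far_subset_near K i hj)
    have h2 := mul_le_mul_of_nonneg_left (log_weight_le_farLog hK h hi hj)
      (show 0 ≤ 16 * (i.gcd K : ℝ) ^ 2 / K by positivity)
    set d := |(s : ℝ) - i / K| with hd
    have hd0 : 0 < d := lt_of_le_of_lt (by positivity) hs
    have hd1 : d ≤ 1 := by
      have := abs_unitInterval_sub_le s (gridPt K i)
      rwa [coe_gridPt hi] at this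
    set θ := (i.gcd K : ℝ) / K / d with hθ
    have hθ0 : 0 < θ := by positivity
    have hθ1 : θ ≤ 1 := (div_le_one hd0).2 hs.le
    have h3 : θ * cellSum K h i (fun e => e.2 (gridPt K i) - e.2 s) ≤
        cellSum K h i (fun e => e.2 (gridPt K i) - e.2 (gridPt K j)) := by
      rw [← cellSum_const_mul]
      exact cellSum_mono K h i fun e => e.2.mul_sub_le hθ0.le hθ1 hjs
    -- The distance `d` is at most one, so dividing by `θ` amplifies by at most `K / u`.
    have h4 : (i.gcd K : ℝ) / K ≤ θ := by
      rw [hθ, le_div_iff₀ hd0]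
      exact mul_le_of_le_one_right (by positivity) hd1
    rw [← hn_def] at h1
    have h5 : θ * cellSum K h i (fun e => e.2 (gridPt K i) - e.2 s) ≤
        θ * (16 * (i.gcd K : ℝ) * farLog K h i + n / K) := by
      calc _ ≤ 16 * (i.gcd K : ℝ) ^ 2 / K * farLog K h i + n / (K : ℝ) ^ 2 := by linarith
        _ ≤ (i.gcd K : ℝ) / K * (16 * (i.gcd K : ℝ) * farLog K h i + n / K) := by
          have : n / (K : ℝ) ^ 2 ≤ (i.gcd K : ℝ) / K * (n / K) := by
            rw [div_mul_div_comm, ← sq]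
            gcongr
            nlinarith
          have e : 16 * (i.gcd K : ℝ) ^ 2 / K * farLog K h i
            = (i.gcd K : ℝ) / K * (16 * (i.gcd K : ℝ) * farLog K h i) := by ring
          rw [mul_add, e]
          linarith
        _ ≤ _ := by gcongr
    have h6 := le_of_mul_le_mul_left h5 hθ0
    have h7 : 0 ≤ 16 * (i.gcd K : ℝ) ^ 2 / K * nearLog K h i := by positivity
    have h8 : 0 ≤ n / K := by positivity
    have e1 : 2 / (K : ℝ) * n = n / K + n / K := by ring
    unfold cellPotential
    rw [e1]
    linarith

/-- A swap function sends each grid point to one comparator, so the regret splits over the cells. -/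
lemma swapRegret_le {K : ℕ} (hK : 0 < K) {h : Transcript} (hh : OnGrid K h) :
    swapRegret h ≤ potential K h + 2 * h.length / K := by
  refine ciSup_le fun f => ?_
  rw [← sum_cellSum hK hh (fun i e => e.2 (gridPt K i) - e.2 (f (gridPt K i)))
    (fun e => e.2 e.1 - e.2 (f e.1)) (fun _ _ _ => rfl)]
  have h1 := sum_cellSum hK hh (fun _ _ => (1 : ℝ)) (fun _ => 1) (fun _ _ _ => rfl)
  calc _ ≤ ∑ i ∈ range (K + 1), (cellPotential K h i + 2 / K * cellSum K h i (fun _ => 1)) :=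
        sum_le_sum fun i hi => cellRegret_le hK h (by have := mem_range.1 hi; omega) _
    _ = _ := by
        rw [sum_add_distrib, ← mul_sum, h1]
        simp [potential]
        ring

/-! ### The initial potential -/

/-- Odd indices contribute one each, even indices twice the sum at the previous level. The dyadic
scales thus cost only a logarithmic factor. -/
lemma sum_gcd_two_pow (m : ℕ) : 2 * ∑ i ∈ range (2 ^ m), i.gcd (2 ^ m) = 2 ^ m * (m + 2) := by
  induction m with
  | zero => simp
  | succ m ih =>
    have h1 : ∀ n, ∑ i ∈ range (2 * n), i.gcd (2 ^ (m + 1))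
        = 2 * (∑ i ∈ range n, i.gcd (2 ^ m)) + n := by
      intro n
      induction n with
      | zero => simp
      | succ n ih =>
        have ho : (2 * n + 1).gcd (2 ^ (m + 1)) = 1 :=
          Nat.Coprime.pow_right _ (by simp)
        have he : (2 * n).gcd (2 ^ (m + 1)) = 2 * n.gcd (2 ^ m) := by
          rw [pow_succ', Nat.gcd_mul_left]
        rw [show 2 * (n + 1) = 2 * n + 1 + 1 by ring, sum_range_succ, sum_range_succ, ih,
          sum_range_succ, ho, he]
        ring
    have h2 := h1 (2 ^ m)
    rw [← pow_succ'] at h2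
    rw [h2, mul_add, ih]
    ring

/-- The same recursion with factor four; the subtracted `2 ^ m` absorbs the odd indices and lets the
induction close. -/
lemma sum_gcd_sq_two_pow_le (m : ℕ) :
    ∑ i ∈ range (2 ^ m), i.gcd (2 ^ m) ^ 2 ≤ 2 * (2 ^ m) ^ 2 - 2 ^ m := by
  induction m with
  | zero => simp
  | succ m ih =>
    have h1 : ∀ n, ∑ i ∈ range (2 * n), i.gcd (2 ^ (m + 1)) ^ 2
        = 4 * (∑ i ∈ range n, i.gcd (2 ^ m) ^ 2) + n := by
      intro n
      induction n with
      | zero => simp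
      | succ n ih =>
        have ho : (2 * n + 1).gcd (2 ^ (m + 1)) = 1 :=
          Nat.Coprime.pow_right _ (by simp)
        have he : (2 * n).gcd (2 ^ (m + 1)) = 2 * n.gcd (2 ^ m) := by
          rw [pow_succ', Nat.gcd_mul_left]
        rw [show 2 * (n + 1) = 2 * n + 1 + 1 by ring, sum_range_succ, sum_range_succ, ih,
          sum_range_succ, ho, he]
        ring
    have h2 := h1 (2 ^ m)
    rw [← pow_succ'] at h2
    have h3 : 2 ^ m ≤ (2 ^ m) ^ 2 := Nat.le_self_pow (by norm_num) _
    rw [h2, pow_succ' 2 m, mul_pow]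
    generalize (2 ^ m) ^ 2 = x at *
    omega

lemma card_far_le (K i : ℕ) : #(far K i) ≤ 2 := by
  have : far K i ⊆ {i + i.gcd K, i - i.gcd K} := by
    intro j hj
    simp only [far, mem_filter] at hj
    simp only [mem_insert, mem_singleton]
    rcases abs_cases ((i : ℤ) - j) with h | h <;> omega
  exact (card_le_card this).trans card_le_two

/-- Initially all weights are one, so the logarithms only count targets: boundedly many long ones,
and at most `K + 1` local ones. -/
lemma potential_nil_le {m : ℕ} (hm : 1 ≤ m) : potential (2 ^ m) [] ≤ 200 * (2 ^ m * m) := by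
  have hK : 0 < 2 ^ m := by positivity
  have hmR : (1 : ℝ) ≤ m := by exact_mod_cast hm
  have h1 : ∀ i, farLog (2 ^ m) [] i ≤ 2 := by
    intro i
    simp only [farLog, farTotal, den, weight, List.map_nil, List.prod_nil, sum_const,
      Int.cast_one, div_one]
    have hc : (#(far (2 ^ m) i) : ℝ) ≤ 2 := by exact_mod_cast card_far_le (2 ^ m) i
    have hp : (0 : ℝ) < 1 + #(far (2 ^ m) i) := by positivity
    have := Real.log_le_sub_one_of_pos hp
    push_cast
    simp only [nsmul_eq_mul, mul_one, Int.cast_natCast]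
    linarith
  have h2 : ∀ i, nearLog (2 ^ m) [] i ≤ 2 * m := by
    intro i
    simp only [nearLog, nearTotal, den, weight, List.map_nil, List.prod_nil, sum_const,
      Int.cast_one, div_one]
    have hc : #(near (2 ^ m) i) ≤ 2 ^ m + 1 :=
      (card_filter_le _ _).trans (by simp)
    have hc2 : 1 + #(near (2 ^ m) i) ≤ 2 ^ (2 * m) := by
      have : 2 ≤ 2 ^ m := by
        calc 2 = 2 ^ 1 := rfl
          _ ≤ 2 ^ m := Nat.pow_le_pow_right (by norm_num) hm
      rw [two_mul, pow_add]
      nlinarith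
    have hc3 : (1 + #(near (2 ^ m) i) : ℝ) ≤ 2 ^ (2 * m) := by exact_mod_cast hc2
    push_cast
    simp only [nsmul_eq_mul, mul_one, Int.cast_natCast]
    refine (Real.log_le_log (by positivity) hc3).trans ?_
    rw [Real.log_pow]
    have := Real.log_two_lt_d9
    push_cast
    nlinarith
  have g1 : ∑ i ∈ range (2 ^ m + 1), (i.gcd (2 ^ m) : ℝ) ≤ 2 ^ m * (m + 2) / 2 + 2 ^ m := by
    rw [sum_range_succ, Nat.gcd_self]
    have h3 : (2 : ℝ) * ∑ i ∈ range (2 ^ m), (i.gcd (2 ^ m) : ℝ) = 2 ^ m * (m + 2) := by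
      exact_mod_cast sum_gcd_two_pow m
    push_cast
    linarith
  have g2 : ∑ i ∈ range (2 ^ m + 1), (i.gcd (2 ^ m) : ℝ) ^ 2 ≤ 3 * (2 ^ m) ^ 2 := by
    rw [sum_range_succ, Nat.gcd_self]
    have h3 : (∑ i ∈ range (2 ^ m), (i.gcd (2 ^ m) : ℝ) ^ 2) ≤ 2 * (2 ^ m) ^ 2 := by
      exact_mod_cast (sum_gcd_sq_two_pow_le m).trans (Nat.sub_le _ _)
    push_cast
    linarith
  calc potential (2 ^ m) []
      ≤ ∑ i ∈ range (2 ^ m + 1), (32 * (i.gcd (2 ^ m) : ℝ) +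
          32 * m / 2 ^ m * (i.gcd (2 ^ m) : ℝ) ^ 2) := by
        refine sum_le_sum fun i _ => ?_
        unfold cellPotential
        have a1 := mul_le_mul_of_nonneg_left (h1 i)
          (show 0 ≤ 16 * (i.gcd (2 ^ m) : ℝ) by positivity)
        have a2 := mul_le_mul_of_nonneg_left (h2 i)
          (show 0 ≤ 16 * (i.gcd (2 ^ m) : ℝ) ^ 2 / ((2 ^ m : ℕ) : ℝ) by positivity)
        have e : 32 * m / 2 ^ m * (i.gcd (2 ^ m) : ℝ) ^ 2
          = 16 * (i.gcd (2 ^ m) : ℝ) ^ 2 / ((2 ^ m : ℕ) : ℝ) * (2 * m) := by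
          push_cast
          ring
        rw [e]
        linarith
    _ ≤ 32 * (2 ^ m * (m + 2) / 2 + 2 ^ m) + 32 * m / 2 ^ m * (3 * (2 ^ m) ^ 2) := by
        rw [sum_add_distrib, ← mul_sum, ← mul_sum]
        gcongr
    _ = 112 * (2 ^ m * m) + 64 * 2 ^ m := by
        field_simp
        ring
    _ ≤ _ := by
        have : (0 : ℝ) < 2 ^ m := by positivity
        nlinarith

/-! ### Expectations over the play -/

/-- The expectation of a function with values in `[0,∞]`. -/
def expect {α : Type*} (p : PMF α) (f : α → ENNReal) : ENNReal := ∑' a, p a * f a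

lemma expect_pure {α : Type*} (a : α) (f : α → ENNReal) : expect (PMF.pure a) f = f a := by
  unfold expect
  rw [tsum_eq_single a]
  · simp
  · intro b hb
    simp [PMF.pure_apply, hb]

lemma expect_bind {α β : Type*} (p : PMF α) (g : α → PMF β) (f : β → ENNReal) :
    expect (p.bind g) f = expect p fun a => expect (g a) f := by
  simp only [expect, PMF.bind_apply, ← ENNReal.tsum_mul_right, ← ENNReal.tsum_mul_left]
  rw [ENNReal.tsum_comm]
  simp only [mul_assoc]

lemma expect_map {α β : Type*} (p : PMF α) (g : α → β) (f : β → ENNReal) :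
    expect (p.map g) f = expect p fun a => f (g a) := by
  rw [← PMF.bind_pure_comp, expect_bind]
  simp only [Function.comp, expect_pure]

lemma expect_mono {α : Type*} (p : PMF α) {f g : α → ENNReal}
    (hfg : ∀ a, p a ≠ 0 → f a ≤ g a) : expect p f ≤ expect p g := by
  refine ENNReal.tsum_le_tsum fun a => ?_
  by_cases ha : p a = 0
  · simp [ha]
  · exact mul_le_mul_right (hfg a ha) _

lemma expect_add_const {α : Type*} (p : PMF α) (f : α → ENNReal) (c : ENNReal) :
    expect p (fun a => f a + c) = expect p f + c := by
  simp only [expect, mul_add, ENNReal.tsum_add, ENNReal.tsum_mul_right, p.tsum_coe, one_mul]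

/-- The drift of the potential is controlled on every transcript, but its comparison with the swap
regret needs predictions on the grid. -/
lemma play_support {S : Strategy} {A : Adversary} {G : I → Prop}
    (hS : ∀ h p, S h p ≠ 0 → G p) (t : ℕ) :
    ∀ h, play S A t h ≠ 0 → h.length = t ∧ ∀ e ∈ h, G e.1 := by
  induction t with
  | zero =>
    intro h hh
    have : h ∈ (PMF.pure ([] : Transcript)).support := hh
    rw [PMF.support_pure] at this
    obtain rfl : h = [] := this
    simp
  | succ t ih =>
    intro h hh
    have h1 : h ∈ (play S A (t + 1)).support := hh
    simp only [play, PMF.mem_support_bind_iff, PMF.mem_support_map_iff] at h1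
    obtain ⟨h', hh', p, hp, rfl⟩ := h1
    obtain ⟨h2, h3⟩ := ih h' hh'
    refine ⟨by simp [h2], fun e he => ?_⟩
    rcases List.mem_append.1 he with he | he
    · exact h3 e he
    · obtain rfl : e = (p, A h') := by simpa using he
      exact hS h' p hp

/-- A function of the transcript that grows by at most `δ` in expectation in every round. -/
lemma expect_play_le {S : Strategy} {A : Adversary} {F : Transcript → ENNReal} {δ : ENNReal}
    (hF : ∀ h, expect (S h) (fun p => F (h ++ [(p, A h)])) ≤ F h + δ) (t : ℕ) :
    expect (play S A t) F ≤ F [] + t * δ := by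
  induction t with
  | zero => simp [play, expect_pure]
  | succ t ih =>
    simp only [play, expect_bind, expect_map]
    calc expect (play S A t) (fun h => expect (S h) fun p => F (h ++ [(p, A h)]))
        ≤ expect (play S A t) (fun h => F h + δ) := expect_mono _ fun h _ => hF h
      _ = expect (play S A t) F + δ := expect_add_const _ _ _
      _ ≤ F [] + t * δ + δ := by gcongr
      _ = _ := by push_cast; ring

/-! ### The expected swap regret of the strategy -/

lemma sum_predProb {K : ℕ} (hK : 0 < K) (h : Transcript) :
    ∑ j : Fin (K + 1), ENNReal.ofReal ((predWeight K h j : ℝ) /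
      ∑ k ∈ range (K + 1), (predWeight K h k : ℝ)) = 1 := by
  have h1 : (0 : ℝ) < ∑ k ∈ range (K + 1), (predWeight K h k : ℝ) := by
    exact_mod_cast sum_predWeight_pos hK h
  rw [← ENNReal.ofReal_sum_of_nonneg, ← sum_div,
    Fin.sum_univ_eq_sum_range (fun j => (predWeight K h j : ℝ)), div_self h1.ne',
    ENNReal.ofReal_one]
  intro j _
  have : 0 ≤ predWeight K h j := predWeight_nonneg hK h (Nat.lt_succ_iff.1 j.2)
  positivity

/-- The strategy on the grid of mesh `1 / K`. -/
def gridStrategy (K : ℕ) (hK : 0 < K) : Strategy := fun h =>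
  (PMF.ofFintype (fun j : Fin (K + 1) => ENNReal.ofReal ((predWeight K h j : ℝ) /
    ∑ k ∈ range (K + 1), (predWeight K h k : ℝ))) (sum_predProb hK h)).map
      fun j : Fin (K + 1) => gridPt K j

lemma gridStrategy_support {K : ℕ} (hK : 0 < K) (h : Transcript) (p : I)
    (hp : gridStrategy K hK h p ≠ 0) : ∃ i ≤ K, p = gridPt K i := by
  have h1 : p ∈ (gridStrategy K hK h).support := hp
  simp only [gridStrategy, PMF.mem_support_map_iff] at h1
  obtain ⟨j, _, rfl⟩ := h1
  exact ⟨j, Nat.lt_succ_iff.1 j.2, rfl⟩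

lemma expect_gridStrategy_potential_le {m : ℕ} (hK : 0 < 2 ^ m) (h : Transcript) (l : Loss) :
    expect (gridStrategy (2 ^ m) hK h)
        (fun p => ENNReal.ofReal (potential (2 ^ m) (h ++ [(p, l)]))) ≤
      ENNReal.ofReal (potential (2 ^ m) h) + ENNReal.ofReal ((m + 8) / 2 ^ m) := by
  set Z : ℝ := ∑ k ∈ range (2 ^ m + 1), (predWeight (2 ^ m) h k : ℝ) with hZ
  have hZ0 : 0 < Z := by
    rw [hZ]
    exact_mod_cast sum_predWeight_pos hK h
  have hw : ∀ j : Fin (2 ^ m + 1), 0 ≤ (predWeight (2 ^ m) h j : ℝ) := fun j => by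
    exact_mod_cast predWeight_nonneg hK h (Nat.lt_succ_iff.1 j.2)
  rw [gridStrategy, expect_map, expect, tsum_fintype]
  simp only [PMF.ofFintype_apply]
  rw [← hZ, ← ENNReal.ofReal_add (potential_nonneg hK h) (by positivity)]
  calc ∑ j : Fin (2 ^ m + 1), ENNReal.ofReal ((predWeight (2 ^ m) h j : ℝ) / Z) *
        ENNReal.ofReal (potential (2 ^ m) (h ++ [(gridPt (2 ^ m) j, l)]))
      = ENNReal.ofReal (∑ j : Fin (2 ^ m + 1), (predWeight (2 ^ m) h j : ℝ) / Z *
        potential (2 ^ m) (h ++ [(gridPt (2 ^ m) j, l)])) := by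
        rw [ENNReal.ofReal_sum_of_nonneg fun j _ => mul_nonneg (div_nonneg (hw j) hZ0.le)
          (potential_nonneg hK _)]
        exact sum_congr rfl fun j _ => (ENNReal.ofReal_mul (div_nonneg (hw j) hZ0.le)).symm
    _ ≤ _ := by
        refine ENNReal.ofReal_le_ofReal ?_
        rw [Fin.sum_univ_eq_sum_range (fun j => (predWeight (2 ^ m) h j : ℝ) / Z *
          potential (2 ^ m) (h ++ [(gridPt (2 ^ m) j, l)]))]
        have h1 := sum_predWeight_mul_potential_le (m := m) h l
        rw [← hZ] at h1
        simp only [div_mul_eq_mul_div]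
        rw [← sum_div, div_le_iff₀ hZ0]
        linarith

/-- As `T ≤ K ^ 2`, the initial potential, the accumulated drift `T * (m + 8) / K` and the
discretization `2 * T / K` are all of order at most `K * m`. -/
lemma expectedSwapRegret_gridStrategy_le {m T : ℕ} (hm : 1 ≤ m) (hK : 0 < 2 ^ m)
    (hT : T ≤ 2 ^ m * 2 ^ m) (A : Adversary) :
    expectedSwapRegret (gridStrategy (2 ^ m) hK) A T ≤ ENNReal.ofReal (300 * (2 ^ m * m)) := by
  set S := gridStrategy (2 ^ m) hK with hS
  have hK' : (0 : ℝ) < 2 ^ m := by positivity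
  have hmR : (1 : ℝ) ≤ m := by exact_mod_cast hm
  have h1 : expect (play S A T) (fun h => ENNReal.ofReal (swapRegret h)) ≤
      expect (play S A T) (fun h => ENNReal.ofReal (potential (2 ^ m) h) +
        ENNReal.ofReal (2 * T / 2 ^ m)) := by
    refine expect_mono _ fun h hh => ?_
    obtain ⟨h2, h3⟩ := play_support (G := fun p => ∃ i ≤ 2 ^ m, p = gridPt (2 ^ m) i)
      (gridStrategy_support hK) T h hh
    rw [← ENNReal.ofReal_add (potential_nonneg hK h) (by positivity)]
    refine ENNReal.ofReal_le_ofReal ?_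
    have := swapRegret_le hK (h := h) h3
    rw [h2] at this
    exact_mod_cast this
  have h2 := expect_play_le (A := A) (F := fun h => ENNReal.ofReal (potential (2 ^ m) h))
    (fun h => expect_gridStrategy_potential_le hK h (A h)) T
  have hTR : (T : ℝ) ≤ 2 ^ m * 2 ^ m := by exact_mod_cast hT
  have h3 : (T : ℝ) * ((m + 8) / 2 ^ m) ≤ 2 ^ m * (m + 8) := by
    rw [mul_div_assoc', div_le_iff₀ hK']
    nlinarith
  have h4 : (2 : ℝ) * T / 2 ^ m ≤ 2 * 2 ^ m := by
    rw [div_le_iff₀ hK']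
    nlinarith
  calc expectedSwapRegret S A T = expect (play S A T) (fun h => ENNReal.ofReal (swapRegret h)) := rfl
    _ ≤ expect (play S A T) (fun h => ENNReal.ofReal (potential (2 ^ m) h)) +
        ENNReal.ofReal (2 * T / 2 ^ m) := by rw [← expect_add_const]; exact h1
    _ ≤ ENNReal.ofReal (potential (2 ^ m) []) + T * ENNReal.ofReal ((m + 8) / 2 ^ m) +
        ENNReal.ofReal (2 * T / 2 ^ m) := by gcongr
    _ = ENNReal.ofReal (potential (2 ^ m) [] + T * ((m + 8) / 2 ^ m) + 2 * T / 2 ^ m) := by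
        have := potential_nonneg hK []
        rw [ENNReal.ofReal_add (by positivity) (by positivity),
          ENNReal.ofReal_add (by positivity) (by positivity),
          ENNReal.ofReal_mul (by positivity), ENNReal.ofReal_natCast]
    _ ≤ _ := by
        refine ENNReal.ofReal_le_ofReal ?_
        have := potential_nil_le hm
        nlinarith

/-! ### The program: arithmetic of the moves

The arrays `0` to `3` hold input and output, array `4` the mesh parameter `K`, array `5` the iterates
of the flow; the arrays from `6` on are registers. -/

/-- The cell `0` of array `x`, used as a variable. -/
def var (x : ℕ) : Expr := .read x (.const 0)

def meshE : Expr := var 4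

def roundE : Expr := .read 0 (.const 1)

def sqE (e : Expr) : Expr := .mul e e

/-- The remainder of a division. -/
def modE (a b : Expr) : Expr := .sub a (.mul (.div a b) b)

/-- `gcd i K`, for `i` in the variable `x`. -/
def gcdProg (x r : ℕ) : Prog :=
  foldProg r meshE (.const 0)
    (.cond (.sub (.const 1) (.add (modE (var x) (.add (var (r + 1)) (.const 1)))
        (modE meshE (.add (var (r + 1)) (.const 1)))))
      (.assign (r + 2) (.const 0) (.add (var (r + 1)) (.const 1)))
      (.assign (r + 2) (.const 0) (var r)))

/-- The product of `f` over the past rounds in the cell `i`, for `i` in the variable `x`. -/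
def prodProg (x r : ℕ) (f : Expr) : Prog :=
  foldProg r roundE (.const 1)
    (.cond (.sub (.const 1) (sqE (.sub (.pred (var (r + 1)) meshE) (var x))))
      (.assign (r + 2) (.const 0) (.mul (var r) f))
      (.assign (r + 2) (.const 0) (var r)))

def baseFactorE (u : ℕ) : Expr := .mul (.mul (.const 16) (sqE (var u))) meshE

def gridValE (s x : ℕ) : Expr := .loss (var s) (.mul (var x) meshE) (.mul meshE meshE)

def stepFactorE (u s x y : ℕ) : Expr :=
  .add (baseFactorE u) (.add (.sub (gridValE s x) (gridValE s y)) meshE)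

def weightProg (x y r : ℕ) : Prog :=
  letProg r (gcdProg x r) (prodProg x (r + 1) (stepFactorE r (r + 2) x y))

def denProg (x r : ℕ) : Prog :=
  letProg r (gcdProg x r) (prodProg x (r + 1) (baseFactorE r))

def nearE (u x y : ℕ) : Expr :=
  .sub (.add (sqE (var u)) (.const 1)) (sqE (.sub (var x) (var y)))

def farE (u x y : ℕ) : Expr :=
  .mul (.sub meshE (var u))
    (.sub (.const 1) (sqE (.sub (sqE (.sub (var x) (var y))) (sqE (var u)))))

/-- The denominator of the weights plus the weights of the targets selected by `test`. -/
def totalProg (test : ℕ → ℕ → ℕ → Expr) (x r : ℕ) : Prog :=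
  letProg r (denProg x r) <| letProg (r + 1) (gcdProg x (r + 1)) <|
    foldProg (r + 2) (.add meshE (.const 1)) (var r)
      (.cond (test (r + 1) x (r + 3))
        (letProg (r + 4) (weightProg x (r + 3) (r + 4))
          (.assign (r + 5) (.const 0) (.add (var (r + 2)) (var (r + 4)))))
        (.assign (r + 4) (.const 0) (var (r + 2))))

def resolutionE : Expr := .mul (.const 12) (sqE meshE)

def rateProg (x y r : ℕ) : Prog :=
  letProg r (gcdProg x r) <| letProg (r + 1) (weightProg x y (r + 1)) <|
    letProg (r + 2) (totalProg farE x (r + 2)) <| letProg (r + 3) (totalProg nearE x (r + 3)) <|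
      .cond (nearE r x y)
        (.cond (farE r x y)
          (.assign (r + 4) (.const 0)
            (.add (.div (.mul (.mul resolutionE meshE) (var (r + 1))) (.mul (var r) (var (r + 2))))
              (.div (.mul resolutionE (var (r + 1))) (var (r + 3)))))
          (.assign (r + 4) (.const 0) (.div (.mul resolutionE (var (r + 1))) (var (r + 3)))))
        (.assign (r + 4) (.const 0) (.const 0))

section Steps

variable {R : Type*} [CommSemiring R]

/-- The step counts are stated over any commutative semiring, so the same formulas give natural
numbers and polynomials. -/
def gcdSteps (K : R) : R := K * 5 + 3
def weightSteps (K : R) : R := gcdSteps K + (K * K * 5 + 3) + 1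
def totalSteps (K : R) : R :=
  weightSteps K + (gcdSteps K + ((K + 1) * (weightSteps K + 6) + 3) + 1) + 1
def rateSteps (K : R) : R :=
  gcdSteps K + (weightSteps K + (totalSteps K + (totalSteps K + 3 + 1) + 1) + 1) + 1

end Steps

/-- The digits `β` suffice for the numbers that occur for the mesh `1 / K`. -/
structure Params (h : Transcript) (β K : ℕ) : Prop where
  one_le : 1 ≤ β
  two_le : 2 ≤ K
  length_le : h.length ≤ K * K
  cap : ∀ z : ℤ, |z| ≤ (32 * (K : ℤ) ^ 3) ^ (K * K + 4) → bits z ≤ β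

/-- The memory holds the number of rounds and the mesh parameter. -/
structure Env (h : Transcript) (β K : ℕ) (m : Store) : Prop where
  bdd : Bdd β m
  mesh : m 4 0 = K
  rounds : m 0 1 = h.length

lemma Env.of_agree {h : Transcript} {β K : ℕ} {m m' : Store} (hE : Env h β K m) (hb : Bdd β m')
    {r : ℕ} (hr : 6 ≤ r) (ha : ∀ a < r, m' a = m a) : Env h β K m' :=
  ⟨hb, by rw [ha 4 (by omega), hE.mesh], by rw [ha 0 (by omega), hE.rounds]⟩

section Program

variable {h : Transcript} {β K : ℕ}

lemma Params.pos (hP : Params h β K) : 0 < K := by have := hP.two_le; omega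

lemma Params.one_le_base (hP : Params h β K) : (1 : ℤ) ≤ 32 * (K : ℤ) ^ 3 := by
  have : (1 : ℤ) ≤ (K : ℤ) ^ 3 := one_le_pow₀ (by exact_mod_cast hP.pos)
  linarith

lemma Params.bits_le (hP : Params h β K) {z : ℤ} {k : ℕ} (hk : k ≤ K * K + 4)
    (hz : |z| ≤ (32 * (K : ℤ) ^ 3) ^ k) : bits z ≤ β :=
  hP.cap z (hz.trans (pow_le_pow_right₀ hP.one_le_base hk))

lemma Params.bits_le_of_le (hP : Params h β K) {z : ℤ} (hz0 : 0 ≤ z)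
    (hz : z ≤ 32 * (K : ℤ) ^ 3) : bits z ≤ β :=
  hP.bits_le (k := 1) (by omega) (by rw [abs_of_nonneg hz0, pow_one]; exact hz)

lemma Params.bits_natCast_le (hP : Params h β K) {n : ℕ} (hn : n ≤ 32 * K ^ 3) :
    bits (n : ℤ) ≤ β :=
  hP.bits_le_of_le (by positivity) (by exact_mod_cast hn)

lemma le_cube (K : ℕ) : K ≤ K ^ 3 := Nat.le_self_pow (by norm_num) K

lemma Params.sq_le_cube (hP : Params h β K) : K * K ≤ K ^ 3 := by
  rw [← sq]
  exact Nat.pow_le_pow_right hP.pos (by norm_num)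

/-! ### Correctness of the routines for gcds, products, totals and rates. -/

lemma findGreatest_dvd_eq_gcd {i K : ℕ} (hK : 0 < K) :
    Nat.findGreatest (fun d => d ∣ i ∧ d ∣ K) K = i.gcd K := by
  rw [Nat.findGreatest_eq_iff]
  refine ⟨Nat.gcd_le_right i hK, fun _ => ⟨Nat.gcd_dvd_left i K, Nat.gcd_dvd_right i K⟩, ?_⟩
  rintro n hn - ⟨h1, h2⟩
  have := Nat.le_of_dvd (one_le_gcd hK i) (Nat.dvd_gcd h1 h2)
  omega

/-- The loop tries every candidate up to `K` and keeps the last common divisor; this is slower than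
Euclid but matches the recursion of `Nat.findGreatest`. -/
lemma computes_gcd (hP : Params h β K) {m : Store} (hE : Env h β K m) {x r i : ℕ} (hr : 6 ≤ r)
    (hx : x < r) (hi : m x 0 = i) :
    Computes h β (gcdProg x r) r m (i.gcd K : ℕ) (gcdSteps K) := by
  rw [← findGreatest_dvd_eq_gcd hP.pos]
  have hbd : ∀ k ≤ K, bits (k : ℤ) ≤ β := fun k hk =>
    hP.bits_natCast_le (by have := le_cube K; omega)
  refine Computes.mono (Computes.foldProg hP.one_le hE.bdd (N := K) (s := 2)
    (F := fun k => (Nat.findGreatest (fun d => d ∣ i ∧ d ∣ K) k : ℤ)) ?_ ?_ (hbd K le_rfl) ?_ ?_ ?_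
    ?_) (by simp [gcdSteps])
  · simp [meshE, var, Expr.weight]
  · simp [Expr.weight]
  · intro m' ha
    simp [meshE, var, Expr.eval, ha 4 (by omega), hE.mesh]
  · simp [Expr.eval]
  · exact fun k hk => hbd _ ((Nat.findGreatest_le k).trans hk)
  · intro k hk m' hb ha hacc hidx
    have hE' := hE.of_agree hb hr ha
    have e1 : m' x 0 = i := by rw [ha x hx, hi]
    -- The counter starts at zero, so the candidate is `k + 1`. Two nonnegative remainders have sum
    -- below one exactly when both vanish.
    have htest : (0 < (Expr.sub (.const 1) (.add (modE (var x) (.add (var (r + 1)) (.const 1)))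
        (modE meshE (.add (var (r + 1)) (.const 1))))).eval h m') ↔ (k + 1 ∣ i ∧ k + 1 ∣ K) := by
      simp only [modE, var, meshE, Expr.eval, e1, hidx, hE'.mesh]
      have h1 : (i : ℤ) - i / (k + 1) * (k + 1) = ((i % (k + 1) : ℕ) : ℤ) := by
        push_cast
        rw [Int.emod_def]
        ring
      have h2 : (K : ℤ) - K / (k + 1) * (k + 1) = ((K % (k + 1) : ℕ) : ℤ) := by
        push_cast
        rw [Int.emod_def]
        ring
      rw [h1, h2, Nat.dvd_iff_mod_eq_zero, Nat.dvd_iff_mod_eq_zero]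
      omega
    refine Computes.cond hP.one_le hb (by simp [modE, var, meshE, Expr.weight]) ?_ ?_
    · intro hp
      rw [htest] at hp
      refine Computes.expr hP.one_le hb (by simp [var, Expr.weight]) ?_ ?_
      · exact hbd _ ((Nat.findGreatest_le _).trans hk)
      · simp [var, Expr.eval, hidx, hp]
    · intro hp
      rw [htest] at hp
      refine Computes.expr hP.one_le hb (by simp [var, Expr.weight]) ?_ ?_
      · exact hbd _ ((Nat.findGreatest_le _).trans hk)
      · simp [var, Expr.eval, hacc, hp]

lemma predQuery_eq (h : Transcript) (K : ℕ) {k : ℕ} (hk : k < h.length) :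
    predQuery h k K = cellOf K h[k] := by
  simp [predQuery, cellOf, hk]

/-- Index and resolution are both multiplied by `K`: the query point remains `i / K` while the
precision becomes `1 / K ^ 2`. -/
lemma lossQuery_eq (h : Transcript) {K : ℕ} (hK : 0 < K) {k : ℕ} (hk : k < h.length) (i : ℕ) :
    lossQuery h k (i * K) (K * K) = gridVal K h[k] i := by
  have hK' : (K : ℝ) ≠ 0 := by positivity
  have e : (i : ℝ) * K / (K * K) = i / K := by field_simp
  simp [lossQuery, gridVal, gridPt, hk, e]

lemma abs_prod_map_le {Q : ℤ} (hQ : 1 ≤ Q) {g : I × Loss → ℤ} (hg : ∀ e, |g e| ≤ Q)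
    (l : Transcript) : |(l.map g).prod| ≤ Q ^ l.length := by
  induction l with
  | nil => simp
  | cons e l ih =>
    simp only [List.map_cons, List.prod_cons, List.length_cons, abs_mul, pow_succ']
    exact mul_le_mul (hg e) ih (abs_nonneg _) (by omega)

/-- The factor of a round in a product over the rounds in the cell `i`. -/
def cellFactor (K i : ℕ) (g : I × Loss → ℤ) (e : I × Loss) : ℤ :=
  if cellOf K e = i then g e else 1

lemma abs_cellFactor_le (hP : Params h β K) {i : ℕ} {g : I × Loss → ℤ}
    (hg : ∀ e, |g e| ≤ 32 * (K : ℤ) ^ 3) (e : I × Loss) :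
    |cellFactor K i g e| ≤ 32 * (K : ℤ) ^ 3 := by
  unfold cellFactor
  split_ifs
  · exact hg e
  · simpa using hP.one_le_base

lemma computes_prod (hP : Params h β K) {m : Store} (hE : Env h β K m) {x r i : ℕ} (hr : 6 ≤ r)
    (hx : x < r) (hi : m x 0 = i) {f : Expr} (hf : f.weight ≤ 10000) {g : I × Loss → ℤ}
    (hg : ∀ e, |g e| ≤ 32 * (K : ℤ) ^ 3)
    (hfg : ∀ k, ∀ hk : k < h.length, ∀ m' : Store, (∀ a < r, m' a = m a) → m' (r + 1) 0 = k →
      f.eval h m' = g h[k]) :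
    Computes h β (prodProg x r f) r m (h.map (cellFactor K i g)).prod (K * K * 5 + 3) := by
  have hlen := hP.length_le
  have hF : ∀ k ≤ h.length, bits ((h.take k).map (cellFactor K i g)).prod ≤ β := by
    intro k hk
    refine hP.bits_le (k := k) (by omega) ?_
    have := abs_prod_map_le hP.one_le_base (abs_cellFactor_le hP (i := i) hg) (h.take k)
    rwa [List.length_take, min_eq_left hk] at this
  have key := Computes.foldProg (h := h) hP.one_le hE.bdd (r := r) (N := h.length) (s := 2) (n := roundE)
    (init := .const 1)
    (P := .cond (.sub (.const 1) (sqE (.sub (.pred (var (r + 1)) meshE) (var x))))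
      (.assign (r + 2) (.const 0) (.mul (var r) f))
      (.assign (r + 2) (.const 0) (var r)))
    (F := fun k => ((h.take k).map (cellFactor K i g)).prod) (by simp [roundE, Expr.weight])
    (by simp [Expr.weight])
    (hP.bits_natCast_le (by have := hP.sq_le_cube; omega)) ?_ (by simp [Expr.eval]) hF ?_
  · rw [List.take_length] at key
    exact key.mono (by linarith)
  · intro m' ha
    simp [roundE, Expr.eval, ha 0 (by omega), hE.rounds]
  · intro k hk m' hb ha hacc hidx
    have hE' := hE.of_agree hb hr ha
    have e1 : m' x 0 = i := by rw [ha x hx, hi]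
    have hsucc : ((h.take (k + 1)).map (cellFactor K i g)).prod
        = ((h.take k).map (cellFactor K i g)).prod * cellFactor K i g h[k] := by
      rw [List.take_succ_eq_append_getElem hk, List.map_append, List.prod_append]
      simp
    -- For integers, one minus a square is positive exactly when the square is zero, so positivity
    -- tests equality.
    have htest : (0 < (Expr.sub (.const 1)
        (sqE (.sub (.pred (var (r + 1)) meshE) (var x)))).eval h m') ↔ cellOf K h[k] = i := by
      simp only [sqE, var, meshE, Expr.eval, e1, hidx, hE'.mesh, predQuery_eq h K hk]
      constructor
      · intro hp
        by_contra hne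
        have : 0 < (cellOf K h[k] - i) * (cellOf K h[k] - i) :=
          mul_self_pos.2 (sub_ne_zero.2 hne)
        omega
      · intro hp
        simp [hp]
    have hb' := hF (k + 1) hk
    refine Computes.cond hP.one_le hb (by simp [sqE, var, meshE, Expr.weight]) ?_ ?_
    · intro hp
      rw [htest] at hp
      refine Computes.expr hP.one_le hb (by simp [var, Expr.weight]; omega) hb' ?_
      rw [hsucc]
      simp [var, Expr.eval, hacc, hfg k hk m' ha hidx, cellFactor, hp]
    · intro hp
      rw [htest] at hp
      refine Computes.expr hP.one_le hb (by simp [var, Expr.weight]) hb' ?_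
      rw [hsucc]
      simp [var, Expr.eval, hacc, cellFactor, hp]

lemma gcd_le_mesh (hP : Params h β K) (i : ℕ) : (i.gcd K : ℤ) ≤ K := by
  exact_mod_cast Nat.gcd_le_right i hP.pos

lemma baseFactor_le (hP : Params h β K) (i : ℕ) : baseFactor K i ≤ 16 * (K : ℤ) ^ 3 := by
  have h1 := gcd_le_mesh hP i
  calc baseFactor K i ≤ 16 * (K : ℤ) ^ 2 * K := by unfold baseFactor; gcongr
    _ = _ := by ring

lemma abs_baseFactor_le (hP : Params h β K) (i : ℕ) : |baseFactor K i| ≤ 32 * (K : ℤ) ^ 3 := by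
  rw [abs_of_pos (baseFactor_pos hP.pos i)]
  have := baseFactor_le hP i
  have : (0 : ℤ) ≤ (K : ℤ) ^ 3 := by positivity
  linarith

lemma abs_stepFactor_le (hP : Params h β K) {i j : ℕ} (hi : i ≤ K) (hj : j ≤ K) (e : I × Loss) :
    |stepFactor K e i j| ≤ 32 * (K : ℤ) ^ 3 := by
  have h1 := baseFactor_le hP i
  have h2 := abs_gridVal_sub_le hP.pos e hi hj
  have h3 : |(i : ℤ) - j| ≤ K := by
    rw [abs_le]
    constructor <;> omega
  have h0 := baseFactor_pos hP.pos i
  have hK : (2 : ℤ) ≤ K := by exact_mod_cast hP.two_le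
  have h4 : (K : ℤ) * |(i : ℤ) - j| ≤ K * K := by gcongr
  have h5 : (K : ℤ) * K ≤ (K : ℤ) ^ 3 := by exact_mod_cast hP.sq_le_cube
  have h6 : (K : ℤ) ≤ (K : ℤ) ^ 3 := by exact_mod_cast le_cube K
  rw [abs_le] at h2 ⊢
  unfold stepFactor
  constructor <;> linarith

lemma weight_eq (K : ℕ) (h : Transcript) (i j : ℕ) :
    weight K h i j = (h.map (cellFactor K i fun e => stepFactor K e i j)).prod := rfl

lemma den_eq (K : ℕ) (h : Transcript) (i : ℕ) :
    den K h i = (h.map (cellFactor K i fun _ => baseFactor K i)).prod := rfl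

lemma abs_weight_le (hP : Params h β K) {i j : ℕ} (hi : i ≤ K) (hj : j ≤ K) :
    |weight K h i j| ≤ (32 * (K : ℤ) ^ 3) ^ (K * K) := by
  rw [weight_eq]
  exact (abs_prod_map_le hP.one_le_base
    (abs_cellFactor_le hP (i := i) (abs_stepFactor_le hP hi hj)) h).trans
    (pow_le_pow_right₀ hP.one_le_base hP.length_le)

lemma abs_den_le (hP : Params h β K) (i : ℕ) : |den K h i| ≤ (32 * (K : ℤ) ^ 3) ^ (K * K) := by
  rw [den_eq]
  exact (abs_prod_map_le hP.one_le_base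
    (abs_cellFactor_le hP (i := i) fun _ => abs_baseFactor_le hP i) h).trans
    (pow_le_pow_right₀ hP.one_le_base hP.length_le)

lemma computes_weight (hP : Params h β K) {m : Store} (hE : Env h β K m) {x y r i j : ℕ}
    (hr : 6 ≤ r) (hx : x < r) (hy : y < r) (hxi : m x 0 = i) (hyj : m y 0 = j) (hi : i ≤ K)
    (hj : j ≤ K) :
    Computes h β (weightProg x y r) r m (weight K h i j) (weightSteps K) := by
  refine Computes.letProg hP.one_le (hP.bits_le (Nat.le_add_right _ _) (abs_weight_le hP hi hj))
    (computes_gcd hP hE hr hx hxi) fun m₁ hb₁ ha₁ hu => ?_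
  have hE₁ := hE.of_agree hb₁ hr ha₁
  refine computes_prod hP hE₁ (by omega) (by omega) (by rw [ha₁ x hx, hxi]) ?_
    (abs_stepFactor_le hP hi hj) fun k hk m₂ ha₂ hs => ?_
  · simp [stepFactorE, baseFactorE, gridValE, sqE, var, meshE, Expr.weight]
  · have e1 : m₂ x 0 = i := by rw [ha₂ x (by omega), ha₁ x hx, hxi]
    have e2 : m₂ y 0 = j := by rw [ha₂ y (by omega), ha₁ y hy, hyj]
    have e3 : m₂ r 0 = (i.gcd K : ℕ) := by rw [ha₂ r (by omega), hu]
    have e4 : m₂ 4 0 = K := by rw [ha₂ 4 (by omega), hE₁.mesh]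
    have e5 : m₂ (r + 2) 0 = k := hs
    simp only [stepFactorE, baseFactorE, gridValE, sqE, var, meshE, Expr.eval, e1, e2, e3, e4, e5,
      lossQuery_eq h hP.pos hk, stepFactor, baseFactor]
    ring

lemma computes_den (hP : Params h β K) {m : Store} (hE : Env h β K m) {x r i : ℕ}
    (hr : 6 ≤ r) (hx : x < r) (hxi : m x 0 = i) :
    Computes h β (denProg x r) r m (den K h i) (weightSteps K) := by
  refine Computes.letProg hP.one_le (hP.bits_le (Nat.le_add_right _ _) (abs_den_le hP i))
    (computes_gcd hP hE hr hx hxi) fun m₁ hb₁ ha₁ hu => ?_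
  have hE₁ := hE.of_agree hb₁ hr ha₁
  refine computes_prod hP hE₁ (by omega) (by omega) (by rw [ha₁ x hx, hxi]) ?_
    (fun _ => abs_baseFactor_le hP i) fun k hk m₂ ha₂ hs => ?_
  · simp [baseFactorE, sqE, var, meshE, Expr.weight]
  · have e3 : m₂ r 0 = (i.gcd K : ℕ) := by rw [ha₂ r (by omega), hu]
    have e4 : m₂ 4 0 = K := by rw [ha₂ 4 (by omega), hE₁.mesh]
    simp only [baseFactorE, sqE, var, meshE, Expr.eval, e3, e4, baseFactor]
    ring

lemma computes_total (hP : Params h β K) {m : Store} (hE : Env h β K m) {x r i : ℕ}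
    (hr : 6 ≤ r) (hx : x < r) (hxi : m x 0 = i) (hi : i ≤ K) {test : ℕ → ℕ → ℕ → Expr}
    (hw : ∀ u x y, (test u x y).weight ≤ 10000) {E : Finset ℕ} (hER : E ⊆ range (K + 1))
    (htest : ∀ (m' : Store) (u x y j : ℕ), m' 4 0 = K → m' u 0 = (i.gcd K : ℕ) → m' x 0 = i →
      m' y 0 = j → j ≤ K → (0 < (test u x y).eval h m' ↔ j ∈ E)) :
    Computes h β (totalProg test x r) r m (den K h i + ∑ j ∈ E, weight K h i j)
      (totalSteps K) := by
  -- Every partial sum has at most `K + 2` terms counting `den`, and this number is below the base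
  -- `32 * K ^ 3`: one extra power suffices.
  have hF : ∀ k ≤ K + 1, bits (den K h i +
      ∑ j ∈ range k, if j ∈ E then weight K h i j else 0) ≤ β := by
    intro k hk
    refine hP.bits_le (k := K * K + 1) (by omega) ?_
    have h1 := abs_den_le hP i
    have h2 : |∑ j ∈ range k, if j ∈ E then weight K h i j else 0|
        ≤ ∑ j ∈ range k, (32 * (K : ℤ) ^ 3) ^ (K * K) := by
      refine (abs_sum_le_sum_abs _ _).trans (sum_le_sum fun j hj => ?_)
      split_ifs
      · exact abs_weight_le hP hi (by have := mem_range.1 hj; omega)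
      · rw [abs_zero]; positivity
    rw [sum_const, card_range, nsmul_eq_mul] at h2
    refine (abs_add_le _ _).trans ?_
    have h3 : (k : ℤ) + 1 ≤ 32 * (K : ℤ) ^ 3 := by
      have := le_cube K
      have := hP.two_le
      exact_mod_cast (by omega : k + 1 ≤ 32 * K ^ 3)
    have h4 : (0 : ℤ) ≤ (32 * (K : ℤ) ^ 3) ^ (K * K) := by positivity
    rw [pow_succ]
    nlinarith
  have hfin : den K h i + ∑ j ∈ E, weight K h i j
      = den K h i + ∑ j ∈ range (K + 1), if j ∈ E then weight K h i j else 0 := by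
    rw [sum_ite_mem, inter_eq_right.2 hER]
  rw [hfin]
  refine Computes.letProg hP.one_le (hF _ le_rfl) (computes_den hP hE hr hx hxi)
    fun m₁ hb₁ ha₁ hd => ?_
  have hE₁ := hE.of_agree hb₁ hr ha₁
  have hx₁ : m₁ x 0 = i := by rw [ha₁ x hx, hxi]
  refine Computes.letProg hP.one_le (hF _ le_rfl)
    (computes_gcd hP hE₁ (by omega) (by omega) hx₁) fun m₂ hb₂ ha₂ hu => ?_
  have hE₂ := hE₁.of_agree hb₂ (by omega) ha₂
  have hx₂ : m₂ x 0 = i := by rw [ha₂ x (by omega), hx₁]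
  have hd₂ : m₂ r 0 = den K h i := by rw [ha₂ r (by omega), hd]
  refine Computes.mono (Computes.foldProg hP.one_le hE₂.bdd (N := K + 1) (s := weightSteps K + 3)
    (F := fun k => den K h i + ∑ j ∈ range k, if j ∈ E then weight K h i j else 0)
    ?_ ?_ ?_ ?_ ?_ hF ?_) le_rfl
  · simp [meshE, var, Expr.weight]
  · simp [var, Expr.weight]
  · exact hP.bits_natCast_le (by have := le_cube K; have := hP.two_le; omega)
  · intro m' ha
    simp [meshE, var, Expr.eval, ha 4 (by omega), hE₂.mesh]
  · simp [var, Expr.eval, hd₂]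
  · intro k hk m₃ hb₃ ha₃ hacc hidx
    have hE₃ := hE₂.of_agree hb₃ (by omega) ha₃
    have hx₃ : m₃ x 0 = i := by rw [ha₃ x (by omega), hx₂]
    have hu₃ : m₃ (r + 1) 0 = (i.gcd K : ℕ) := by rw [ha₃ _ (by omega), hu]
    have ht := htest m₃ (r + 1) x (r + 2 + 1) k hE₃.mesh hu₃ hx₃ hidx (by omega)
    have hbk := hF (k + 1) hk
    refine Computes.cond hP.one_le hb₃ ((hw _ _ _).trans (by norm_num)) ?_ ?_
    · intro hp
      have hkE := ht.1 hp
      refine Computes.mono (Computes.letProg hP.one_le hbk (computes_weight hP hE₃ (by omega)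
        (by omega) (by omega) hx₃ hidx hi (by omega)) fun m₄ hb₄ ha₄ hw₄ =>
          Computes.expr hP.one_le hb₄ (by simp [var, Expr.weight]) hbk ?_) le_rfl
      have e1 : m₄ (r + 2) 0 = m₃ (r + 2) 0 := by rw [ha₄ _ (by omega)]
      have e2 : m₄ (r + 4) 0 = weight K h i k := hw₄
      simp only [var, Expr.eval, e1, hacc, e2, sum_range_succ, hkE, if_true]
      ring
    · intro hp
      have hkE : k ∉ E := fun hk => hp (ht.2 hk)
      refine Computes.mono (Computes.expr hP.one_le hb₃ (by simp [var, Expr.weight]) hbk ?_)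
        (by omega)
      simp only [var, Expr.eval, hacc, sum_range_succ, hkE, if_false, add_zero]

lemma nearE_test {i : ℕ} (m' : Store) (u x y j : ℕ)
    (hu : m' u 0 = (i.gcd K : ℕ)) (hx : m' x 0 = i) (hy : m' y 0 = j) (hj : j ≤ K) :
    0 < (nearE u x y).eval h m' ↔ j ∈ near K i := by
  simp only [nearE, sqE, var, Expr.eval, hu, hx, hy, near, mem_filter, mem_range]
  rw [← abs_of_nonneg (show (0 : ℤ) ≤ (i.gcd K : ℕ) by positivity), ← sq_le_sq]
  rw [abs_of_nonneg (show (0 : ℤ) ≤ (i.gcd K : ℕ) by positivity), sq, sq]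
  constructor
  · intro hp
    exact ⟨by omega, by linarith⟩
  · intro hp
    linarith [hp.2]

/-- The factor `K - u` is never negative, so the product is positive only if both factors are; the
second one tests `(i - j) ^ 2 = u ^ 2`. -/
lemma farE_test {i : ℕ} (hK : 0 < K) (m' : Store) (u x y j : ℕ) (hmesh : m' 4 0 = K)
    (hu : m' u 0 = (i.gcd K : ℕ)) (hx : m' x 0 = i) (hy : m' y 0 = j) (hj : j ≤ K) :
    0 < (farE u x y).eval h m' ↔ j ∈ far K i := by
  have hle : i.gcd K ≤ K := Nat.gcd_le_right i hK
  simp only [farE, sqE, var, meshE, Expr.eval, hmesh, hu, hx, hy, far, mem_filter, mem_range]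
  set u : ℤ := ((i.gcd K : ℕ) : ℤ) with hu
  set d : ℤ := (i : ℤ) - j with hd
  have hu0 : 0 ≤ u := by rw [hu]; positivity
  have e : |d| = u ↔ d * d - u * u = 0 := by
    rw [sub_eq_zero, ← sq, ← sq, sq_eq_sq_iff_abs_eq_abs, abs_of_nonneg hu0]
  rw [e]
  generalize d * d - u * u = w
  constructor
  · intro hp
    have h1 : 0 < (K : ℤ) - u := by
      rcases (show (K : ℤ) - u ≥ 0 by omega).lt_or_eq with h | h
      · exact h
      · rw [← h] at hp; simp at hp
    have h2 := (mul_pos_iff_of_pos_left h1).1 hp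
    refine ⟨by omega, by omega, ?_⟩
    by_contra hw
    have : 0 < w * w := mul_self_pos.2 hw
    omega
  · rintro ⟨-, h1, rfl⟩
    have : 0 < (K : ℤ) - u := by omega
    simpa using this

lemma computes_rate (hP : Params h β K) {m : Store} (hE : Env h β K m) {x y r i j : ℕ}
    (hr : 6 ≤ r) (hx : x < r) (hy : y < r) (hxi : m x 0 = i) (hyj : m y 0 = j) (hi : i ≤ K)
    (hj : j ≤ K) :
    Computes h β (rateProg x y r) r m (rate K h i j) (rateSteps K) := by
  have hbr : bits (rate K h i j) ≤ β := by
    refine hP.bits_le_of_le (rate_nonneg hP.pos h hi j) ((rate_le hP.pos h hi hj).trans ?_)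
    unfold resolution
    have : (0 : ℤ) ≤ (K : ℤ) ^ 3 := by positivity
    nlinarith
  refine Computes.letProg hP.one_le hbr (computes_gcd hP hE hr hx hxi) fun m₁ hb₁ ha₁ hu => ?_
  have hE₁ := hE.of_agree hb₁ hr ha₁
  have hx₁ : m₁ x 0 = i := by rw [ha₁ x hx, hxi]
  have hy₁ : m₁ y 0 = j := by rw [ha₁ y hy, hyj]
  refine Computes.letProg hP.one_le hbr (computes_weight hP hE₁ (by omega) (by omega) (by omega)
    hx₁ hy₁ hi hj) fun m₂ hb₂ ha₂ hw => ?_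
  have hE₂ := hE₁.of_agree hb₂ (by omega) ha₂
  have hx₂ : m₂ x 0 = i := by rw [ha₂ x (by omega), hx₁]
  refine Computes.letProg hP.one_le hbr (computes_total hP hE₂ (by omega) (by omega) hx₂ hi
    (fun u x y => by simp [farE, sqE, var, meshE, Expr.weight]) (filter_subset _ _)
    (fun m' u x y j => farE_test hP.pos m' u x y j)) fun m₃ hb₃ ha₃ hzf => ?_
  have hE₃ := hE₂.of_agree hb₃ (by omega) ha₃
  have hx₃ : m₃ x 0 = i := by rw [ha₃ x (by omega), hx₂]
  refine Computes.letProg hP.one_le hbr (computes_total hP hE₃ (by omega) (by omega) hx₃ hi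
    (fun u x y => by simp [nearE, sqE, var, Expr.weight]) (filter_subset _ _)
    (fun m' u x y j _ => nearE_test m' u x y j)) fun m₄ hb₄ ha₄ hzn => ?_
  have hE₄ := hE₃.of_agree hb₄ (by omega) ha₄
  have hx₄ : m₄ x 0 = i := by rw [ha₄ x (by omega), hx₃]
  have hy₄ : m₄ y 0 = j := by
    rw [ha₄ y (by omega), ha₃ y (by omega), ha₂ y (by omega), hy₁]
  have hu₄ : m₄ r 0 = (i.gcd K : ℕ) := by
    rw [ha₄ r (by omega), ha₃ r (by omega), ha₂ r (by omega), hu]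
  have hw₄ : m₄ (r + 1) 0 = weight K h i j := by rw [ha₄ _ (by omega), ha₃ _ (by omega), hw]
  have hzf₄ : m₄ (r + 2) 0 = farTotal K h i := by rw [ha₄ _ (by omega), hzf]; rfl
  have hzn₄ : m₄ (r + 3) 0 = nearTotal K h i := hzn
  have hnear := nearE_test (h := h) m₄ r x y j hu₄ hx₄ hy₄ hj
  have hfar := farE_test (h := h) hP.pos m₄ r x y j hE₄.mesh hu₄ hx₄ hy₄ hj
  have hres : ∀ z : ℤ, resolution K * z = 12 * ((K : ℤ) * K) * z := fun z => by
    unfold resolution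
    ring
  refine Computes.cond (s := 2) hP.one_le hb₄ (by simp [nearE, sqE, var, Expr.weight]) ?_ ?_
  · intro hp
    have hn := hnear.1 hp
    refine Computes.cond hP.one_le hb₄ (by simp [farE, sqE, var, meshE, Expr.weight]) ?_ ?_
    · intro hp'
      have hf := hfar.1 hp'
      refine Computes.expr hP.one_le hb₄
        (by simp [resolutionE, sqE, var, meshE, Expr.weight]) hbr ?_
      simp only [resolutionE, sqE, var, meshE, Expr.eval, hu₄, hw₄, hzf₄, hzn₄, hE₄.mesh, rate, hn,
        hf, if_true, hres]
    · intro hp'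
      have hf : j ∉ far K i := fun hf => hp' (hfar.2 hf)
      refine Computes.expr hP.one_le hb₄
        (by simp [resolutionE, sqE, var, meshE, Expr.weight]) hbr ?_
      simp only [resolutionE, sqE, var, meshE, Expr.eval, hw₄, hzn₄, hE₄.mesh, rate, hn,
        hf, if_true, if_false, hres, zero_add]
  · intro hp
    have hn : j ∉ near K i := fun hn => hp (hnear.2 hn)
    have hf : j ∉ far K i := fun hf => hn (far_subset_near K i hf)
    refine Computes.mono (Computes.expr hP.one_le hb₄ (by simp [Expr.weight]) hbr ?_) (by omega)
    simp only [Expr.eval, rate, hn, hf, if_false, add_zero]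

end Program

/-! ### The program: the flow and the output -/

def flowBase (K : ℕ) : ℤ := 2 * K * resolution K

def flowBaseE : Expr := .mul (.mul (.const 2) meshE) resolutionE

def sizeE : Expr := .add meshE (.const 1)

/-- The entry of the next iterate of the flow below the entry whose index is in array `6`. -/
def flowStepProg : Prog :=
  letProg 7 (.assign 7 (.const 0) (.div (var 6) sizeE)) <|
    letProg 8 (.assign 8 (.const 0) (.sub (var 6) (.mul (var 7) sizeE))) <|
      foldProg 9 sizeE (.mul flowBaseE (.read 5 (var 6)))
        (letProg 11 (rateProg 10 8 11) <| letProg 12 (rateProg 8 10 12) <|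
          .assign 13 (.const 0) (.add (var 9)
            (.sub (.mul (.read 5 (.add (.mul (var 7) sizeE) (var 10))) (var 11))
              (.mul (.read 5 (var 6)) (var 12)))))

/-- Fill array `5` with the iterates of the flow. -/
def flowProg : Prog :=
  fillProg 6 5 (.mul (.mul meshE meshE) sizeE) (.add (var 6) sizeE) flowStepProg

/-- Fill array `3` with the weights of the distribution. -/
def weightsProg : Prog :=
  fillProg 6 3 sizeE (var 6)
    (foldProg 7 (.mul meshE meshE) (.const 0)
      (.assign 9 (.const 0) (.add (.mul flowBaseE (var 7))
        (.read 5 (.add (.mul (var 8) sizeE) (var 6))))))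

/-- Fill array `2` with the numerators of the grid points. -/
def pointsProg : Prog := fillProg 6 2 sizeE (var 6) (.assign 7 (.const 0) (var 6))

/-- Compute the least power of two whose square is at least the horizon. -/
def meshProg : Prog :=
  foldProg 6 (.read 0 (.const 0)) (.const 1)
    (.cond (.sub (.read 0 (.const 0)) (sqE (var 6)))
      (.assign 8 (.const 0) (.mul (.const 2) (var 6)))
      (.assign 8 (.const 0) (var 6)))

def predictProg : Prog :=
  .seq meshProg <| .seq (.assign 4 (.const 0) (var 6)) <| .seq (.assign 5 (.const 0) (.const 1)) <|
    .seq flowProg <| .seq weightsProg <| .seq pointsProg <|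
      .seq (.assign 1 (.const 0) sizeE) (.assign 1 (.const 1) meshE)

section Steps

variable {R : Type*} [CommSemiring R]

def flowStepSteps (K : R) : R :=
  1 + (1 + ((K + 1) * (rateSteps K + (rateSteps K + 1 + 1) + 1 + 3) + 3) + 1) + 1
def predictSteps (K : R) : R :=
  K * K * 5 + 3 + (1 + (1 + (K * K * (K + 1) * (flowStepSteps K + 3) + 2 +
    ((K + 1) * (K * K * 4 + 3 + 3) + 2 + ((K + 1) * 4 + 2 + (1 + 1))))))

end Steps

section Program

variable {h : Transcript} {β K : ℕ}

/-- The iterates of the flow that the program computes. -/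
def flowOf (K : ℕ) (h : Transcript) : ℕ → ℕ → ℤ := flowIter (K + 1) (flowBase K) (rate K h)

lemma flowBase_nonneg (K : ℕ) : 0 ≤ flowBase K := by
  unfold flowBase resolution
  positivity

lemma flowBase_le (K : ℕ) : flowBase K ≤ 32 * (K : ℤ) ^ 3 := by
  unfold flowBase resolution
  have : (0 : ℤ) ≤ (K : ℤ) ^ 3 := by positivity
  nlinarith

lemma flowOf_nonneg (hK : 0 < K) (h : Transcript) (k : ℕ) {j : ℕ} (hj : j ≤ K) :
    0 ≤ flowOf K h k j :=
  flowIter_nonneg (fun _ hi j _ => rate_nonneg hK h (Nat.lt_succ_iff.1 hi) j)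
    (fun _ hi => sum_rate_le hK h (Nat.lt_succ_iff.1 hi)) k j (Nat.lt_succ_iff.2 hj)

lemma flowOf_le (hK : 0 < K) (h : Transcript) (k : ℕ) {j : ℕ} (hj : j ≤ K) :
    flowOf K h k j ≤ (32 * (K : ℤ) ^ 3) ^ k :=
  (flowIter_le (Nat.succ_pos K) (fun _ hi j _ => rate_nonneg hK h (Nat.lt_succ_iff.1 hi) j)
    (fun _ hi => sum_rate_le hK h (Nat.lt_succ_iff.1 hi)) k (Nat.lt_succ_iff.2 hj)).trans
    (pow_le_pow_left₀ (flowBase_nonneg K) (flowBase_le K) k)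

lemma rate_le_base (hK : 0 < K) (h : Transcript) {i j : ℕ} (hi : i ≤ K) (hj : j ≤ K) :
    rate K h i j ≤ 32 * (K : ℤ) ^ 3 :=
  (rate_le hK h hi hj).trans (flowBase_le K)

/-- The finished iterates are nonnegative, but a partly summed update may be negative, so the
accumulator is bounded in absolute value. -/
lemma abs_flow_partial_le (hP : Params h β K) {q j : ℕ} (hj : j ≤ K) {n : ℕ} (hn : n ≤ K + 1) :
    |flowBase K * flowOf K h q j +
      ∑ i ∈ range n, (flowOf K h q i * rate K h i j - flowOf K h q j * rate K h j i)| ≤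
      (32 * (K : ℤ) ^ 3) ^ (q + 2) := by
  set Q : ℤ := 32 * (K : ℤ) ^ 3 with hQ
  have hQ1 : 1 ≤ Q := hP.one_le_base
  have h0 : ∀ i ≤ K, 0 ≤ flowOf K h q i := fun i hi => flowOf_nonneg hP.pos h q hi
  have h1 : ∀ i ≤ K, flowOf K h q i ≤ Q ^ q := fun i hi => flowOf_le hP.pos h q hi
  have hQq : 0 ≤ Q ^ q := by positivity
  have hm : ∀ i ≤ K, ∀ a : ℤ, 0 ≤ a → a ≤ Q → flowOf K h q i * a ≤ Q ^ (q + 1) := by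
    intro i hi a ha haQ
    rw [pow_succ]
    exact mul_le_mul (h1 i hi) haQ ha hQq
  have h2 : |flowBase K * flowOf K h q j| ≤ Q ^ (q + 1) := by
    rw [abs_of_nonneg (mul_nonneg (flowBase_nonneg K) (h0 j hj)), mul_comm]
    exact hm j hj _ (flowBase_nonneg K) (flowBase_le K)
  have h3 : |∑ i ∈ range n, (flowOf K h q i * rate K h i j - flowOf K h q j * rate K h j i)|
      ≤ ∑ i ∈ range n, Q ^ (q + 1) := by
    refine (abs_sum_le_sum_abs _ _).trans (sum_le_sum fun i hi => ?_)
    have hi' : i ≤ K := by have := mem_range.1 hi; omega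
    have a1 := hm i hi' _ (rate_nonneg hP.pos h hi' j) (rate_le_base hP.pos h hi' hj)
    have a2 := hm j hj _ (rate_nonneg hP.pos h hj i) (rate_le_base hP.pos h hj hi')
    have a3 := mul_nonneg (h0 i hi') (rate_nonneg hP.pos h hi' j)
    have a4 := mul_nonneg (h0 j hj) (rate_nonneg hP.pos h hj i)
    rw [abs_le]
    constructor <;> linarith
  rw [sum_const, card_range, nsmul_eq_mul] at h3
  have h4 : (n : ℤ) + 1 ≤ Q := by
    have := le_cube K
    have := hP.two_le
    rw [hQ]
    exact_mod_cast (by omega : n + 1 ≤ 32 * K ^ 3)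
  have h5 : 0 ≤ Q ^ (q + 1) := by positivity
  refine (abs_add_le _ _).trans ?_
  rw [pow_succ Q (q + 1)]
  nlinarith

lemma eval_sizeE {m : Store} (hm : m 4 0 = K) : sizeE.eval h m = ((K + 1 : ℕ) : ℤ) := by
  simp [sizeE, meshE, var, Expr.eval, hm]

lemma eval_flowBaseE {m : Store} (hm : m 4 0 = K) : flowBaseE.eval h m = flowBase K := by
  simp only [flowBaseE, resolutionE, sqE, meshE, var, Expr.eval, hm, flowBase, resolution]
  ring

/-- Iterate `q` occupies a row of length `K + 1`; division with remainder recovers row and column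
from the running index, and only the preceding row is read. -/
lemma computes_flowStep (hP : Params h β K) {m : Store} (hE : Env h β K m) {k q j : ℕ}
    (hk : k = q * (K + 1) + j) (hj : j ≤ K) (hq : q < K * K) (hidx : m 6 0 = k)
    (hV : ∀ i ≤ K, m 5 ((q * (K + 1) + i : ℕ) : ℤ) = flowOf K h q i) :
    Computes h β flowStepProg 7 m (flowOf K h (q + 1) j) (flowStepSteps K) := by
  have hF : ∀ n ≤ K + 1, bits (flowBase K * flowOf K h q j +
      ∑ i ∈ range n, (flowOf K h q i * rate K h i j - flowOf K h q j * rate K h j i)) ≤ β :=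
    fun n hn => hP.bits_le (by omega) (abs_flow_partial_le hP hj hn)
  have hout : bits (flowOf K h (q + 1) j) ≤ β := hF (K + 1) le_rfl
  have hsmall : ∀ n ≤ K * K, bits (n : ℤ) ≤ β := fun n hn =>
    hP.bits_natCast_le (by have := hP.sq_le_cube; omega)
  refine Computes.letProg (v := (q : ℤ)) hP.one_le hout (Computes.expr hP.one_le hE.bdd
    (by simp [sizeE, meshE, var, Expr.weight]) (hsmall q hq.le) ?_) fun m₁ hb₁ ha₁ hq₁ => ?_
  · have : k / (K + 1) = q := by
      rw [hk, mul_comm, Nat.mul_add_div (by omega), Nat.div_eq_of_lt (by omega), add_zero]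
    simp only [Expr.eval, eval_sizeE hE.mesh, var, hidx]
    exact_mod_cast this
  have hE₁ := hE.of_agree hb₁ (by norm_num) ha₁
  have hidx₁ : m₁ 6 0 = k := by rw [ha₁ 6 (by norm_num), hidx]
  refine Computes.letProg (v := (j : ℤ)) hP.one_le hout (Computes.expr hP.one_le hE₁.bdd
    (by simp [sizeE, meshE, var, Expr.weight])
    (hsmall j (hj.trans (Nat.le_mul_self K))) ?_) fun m₂ hb₂ ha₂ hj₂ => ?_
  · simp only [Expr.eval, eval_sizeE hE₁.mesh, var, hidx₁, hq₁, hk]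
    push_cast
    ring
  have hE₂ := hE₁.of_agree hb₂ (by norm_num) ha₂
  have hidx₂ : m₂ 6 0 = k := by rw [ha₂ 6 (by norm_num), hidx₁]
  have hq₂ : m₂ 7 0 = q := by rw [ha₂ 7 (by norm_num), hq₁]
  have hV₂ : ∀ i ≤ K, m₂ 5 ((q * (K + 1) + i : ℕ) : ℤ) = flowOf K h q i := fun i hi => by
    rw [ha₂ 5 (by norm_num), ha₁ 5 (by norm_num), hV i hi]
  refine Computes.foldProg hP.one_le hE₂.bdd (N := K + 1)
    (s := rateSteps K + (rateSteps K + 1 + 1) + 1)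
    (F := fun n => flowBase K * flowOf K h q j +
      ∑ i ∈ range n, (flowOf K h q i * rate K h i j - flowOf K h q j * rate K h j i))
    (by simp [sizeE, meshE, var, Expr.weight])
    (by simp [flowBaseE, resolutionE, sqE, meshE, var, Expr.weight])
    (hsmall _ (by have := hP.two_le; nlinarith)) ?_ ?_ hF ?_
  · exact fun m' ha => eval_sizeE (by rw [ha 4 (by norm_num), hE₂.mesh])
  · simp only [Expr.eval, eval_flowBaseE hE₂.mesh, var, hidx₂, hk, hV₂ j hj, sum_range_zero,
      add_zero]
  · intro i hi m₃ hb₃ ha₃ hacc hi₃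
    have hi' : i ≤ K := by omega
    have hE₃ := hE₂.of_agree hb₃ (by norm_num) ha₃
    have hj₃ : m₃ 8 0 = j := by rw [ha₃ 8 (by norm_num), hj₂]
    have hbi := hF (i + 1) hi
    refine Computes.letProg hP.one_le hbi (computes_rate hP hE₃ (by norm_num) (by norm_num)
      (by norm_num) hi₃ hj₃ hi' hj) fun m₄ hb₄ ha₄ hr₄ => ?_
    have hE₄ := hE₃.of_agree hb₄ (by norm_num) ha₄
    have hi₄ : m₄ 10 0 = i := by rw [ha₄ 10 (by norm_num)]; exact hi₃
    have hj₄ : m₄ 8 0 = j := by rw [ha₄ 8 (by norm_num), hj₃]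
    refine Computes.letProg hP.one_le hbi (computes_rate hP hE₄ (by norm_num) (by norm_num)
      (by norm_num) hj₄ hi₄ hj hi') fun m₅ hb₅ ha₅ hr₅ => ?_
    have hE₅ := hE₄.of_agree hb₅ (by norm_num) ha₅
    refine Computes.expr hP.one_le hb₅ (by simp [sizeE, meshE, var, Expr.weight]) hbi ?_
    have e5 : m₅ 5 = m₂ 5 := by
      rw [ha₅ 5 (by norm_num), ha₄ 5 (by norm_num), ha₃ 5 (by norm_num)]
    have e6 : m₅ 6 0 = ((q * (K + 1) + j : ℕ) : ℤ) := by
      rw [ha₅ 6 (by norm_num), ha₄ 6 (by norm_num), ha₃ 6 (by norm_num), hidx₂, hk]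
    have e7 : m₅ 7 0 = q := by
      rw [ha₅ 7 (by norm_num), ha₄ 7 (by norm_num), ha₃ 7 (by norm_num), hq₂]
    have e9 : m₅ 9 0 = m₃ 9 0 := by rw [ha₅ 9 (by norm_num), ha₄ 9 (by norm_num)]
    have e10 : m₅ 10 0 = i := by rw [ha₅ 10 (by norm_num), hi₄]
    have e11 : m₅ 11 0 = rate K h i j := by rw [ha₅ 11 (by norm_num)]; exact hr₄
    have e12 : m₅ 12 0 = rate K h j i := hr₅
    have ei : (q : ℤ) * ((K + 1 : ℕ) : ℤ) + i = ((q * (K + 1) + i : ℕ) : ℤ) := by push_cast; ring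
    simp only [Expr.eval, eval_sizeE hE₅.mesh, var, e5, e6, e7, e9, e10, e11, e12, ei, hacc,
      hV₂ i hi', hV₂ j hj, sum_range_succ]
    ring

/-- The contents of array `5` after `k` steps. -/
def flowArray (K : ℕ) (h : Transcript) (k : ℕ) (z : ℤ) : ℤ :=
  if 0 ≤ z ∧ z < k + (K + 1) then flowOf K h (z.toNat / (K + 1)) (z.toNat % (K + 1)) else 0

lemma flowArray_zero (K : ℕ) (h : Transcript) :
    flowArray K h 0 = Function.update (fun _ => 0) 0 1 := by
  funext z
  unfold flowArray
  by_cases hz : z = 0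
  · subst hz
    have : (0 : ℤ) < K + 1 := by positivity
    simp [flowOf, flowIter, this]
  · rw [Function.update_of_ne hz]
    split_ifs with hc
    · have h1 : z.toNat < K + 1 := by omega
      rw [Nat.div_eq_of_lt h1, Nat.mod_eq_of_lt h1]
      simp only [flowOf, flowIter]
      rw [if_neg (by omega)]
    · rfl

/-- Writing one row ahead of the index `k` increments the quotient by `K + 1` and keeps the
remainder. -/
lemma flowArray_succ (K : ℕ) (h : Transcript) (k : ℕ) :
    flowArray K h (k + 1) = Function.update (flowArray K h k) ((k + (K + 1) : ℕ) : ℤ)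
      (flowOf K h (k / (K + 1) + 1) (k % (K + 1))) := by
  funext z
  by_cases hz : z = ((k + (K + 1) : ℕ) : ℤ)
  · subst hz
    rw [Function.update_self, flowArray, if_pos (by push_cast; omega), Int.toNat_natCast,
      Nat.add_div_right _ (by omega), Nat.add_mod_right]
  · rw [Function.update_of_ne hz]
    unfold flowArray
    have : (0 ≤ z ∧ z < ((k + 1 : ℕ) : ℤ) + (K + 1)) ↔ (0 ≤ z ∧ z < (k : ℤ) + (K + 1)) := by
      push_cast at hz ⊢
      omega
    simp only [this]

lemma flowArray_apply (K : ℕ) (h : Transcript) {k q i : ℕ} (hi : i ≤ K)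
    (hk : q * (K + 1) + i < k + (K + 1)) :
    flowArray K h k ((q * (K + 1) + i : ℕ) : ℤ) = flowOf K h q i := by
  rw [flowArray, if_pos ⟨by positivity, by exact_mod_cast hk⟩, Int.toNat_natCast]
  have h1 : (q * (K + 1) + i) / (K + 1) = q := by
    rw [mul_comm, Nat.mul_add_div (by omega), Nat.div_eq_of_lt (by omega), add_zero]
  have h2 : (q * (K + 1) + i) % (K + 1) = i := by
    rw [mul_comm, Nat.mul_add_mod, Nat.mod_eq_of_lt (by omega)]
  rw [h1, h2]

/-- Agreement of memories on the arrays below `6` other than `a`. -/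
lemma Env.of_agree_except {m m' : Store} (hE : Env h β K m) (hb : Bdd β m') {a : ℕ} (ha4 : 4 ≠ a)
    (ha0 : 0 ≠ a) (ha : ∀ b < 6, b ≠ a → m' b = m b) : Env h β K m' :=
  ⟨hb, by rw [ha 4 (by norm_num) ha4, hE.mesh], by rw [ha 0 (by norm_num) ha0, hE.rounds]⟩

lemma runs_flowProg (hP : Params h β K) {m : Store} (hE : Env h β K m)
    (hV : m 5 = Function.update (fun _ => 0) 0 1) :
    Runs h β flowProg m (K * K * (K + 1) * (flowStepSteps K + 3) + 2)
      fun m' => (∀ b < 6, b ≠ 5 → m' b = m b) ∧ m' 5 = flowArray K h (K * K * (K + 1)) := by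
  have hout : ∀ k < K * K * (K + 1), bits (flowOf K h (k / (K + 1) + 1) (k % (K + 1))) ≤ β := by
    intro k hk
    have h1 : k / (K + 1) < K * K := Nat.div_lt_of_lt_mul (by rwa [mul_comm])
    have h2 : k % (K + 1) ≤ K := Nat.lt_succ_iff.1 (Nat.mod_lt _ (by omega))
    refine hP.bits_le (k := k / (K + 1) + 1) (by omega) ?_
    rw [abs_of_nonneg (flowOf_nonneg hP.pos h _ h2)]
    exact flowOf_le hP.pos h _ h2
  refine Runs.fillProg hP.one_le hE.bdd (by norm_num) (v := fun k =>
    flowOf K h (k / (K + 1) + 1) (k % (K + 1))) (idx := fun k => ((k + (K + 1) : ℕ) : ℤ))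
    (G := flowArray K h) (by simp [sizeE, meshE, var, Expr.weight])
    (by simp [sizeE, meshE, var, Expr.weight]) ?_ ?_ ?_ (by rw [hV, flowArray_zero])
    (fun k _ => flowArray_succ K h k) hout ?_
  · refine hP.bits_le (k := 2) (by omega) ?_
    rw [abs_of_nonneg (by positivity)]
    have := le_cube K
    have := hP.sq_le_cube
    have := hP.two_le
    have h1 : K * K * (K + 1) ≤ (32 * K ^ 3) ^ 2 := by
      rw [sq]
      exact Nat.mul_le_mul (by omega) (by omega)
    exact_mod_cast h1
  · intro m' ha
    have e : m' 4 0 = K := by rw [ha 4 (by norm_num) (by norm_num), hE.mesh]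
    simp only [Expr.eval, eval_sizeE e, meshE, var, e]
    push_cast
    ring
  · intro k _ m' ha hidx
    have e : m' 4 0 = K := by rw [ha 4 (by norm_num) (by norm_num), hE.mesh]
    simp only [Expr.eval, eval_sizeE e, var, hidx]
    push_cast
    ring
  · intro k hk m' hb ha h5 hidx
    have hE' := hE.of_agree_except hb (by norm_num) (by norm_num) ha
    have h2 : k % (K + 1) ≤ K := Nat.lt_succ_iff.1 (Nat.mod_lt _ (by omega))
    have h3 : k = k / (K + 1) * (K + 1) + k % (K + 1) := (Nat.div_add_mod' k (K + 1)).symm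
    refine computes_flowStep hP hE' h3 h2 (Nat.div_lt_of_lt_mul (by rwa [mul_comm])) hidx
      fun i hi => ?_
    rw [h5]
    exact flowArray_apply K h hi (by omega)

/-- The array with the entries `f 0, …, f (k - 1)`. -/
def listArray (f : ℕ → ℤ) (k : ℕ) (z : ℤ) : ℤ := if 0 ≤ z ∧ z < k then f z.toNat else 0

lemma listArray_zero (f : ℕ → ℤ) : listArray f 0 = fun _ => 0 := by
  funext z
  unfold listArray
  rw [if_neg (by push_cast; omega)]

lemma listArray_succ (f : ℕ → ℤ) (k : ℕ) :
    listArray f (k + 1) = Function.update (listArray f k) (k : ℤ) (f k) := by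
  funext z
  by_cases hz : z = k
  · subst hz
    rw [Function.update_self, listArray, if_pos (by push_cast; omega), Int.toNat_natCast]
  · rw [Function.update_of_ne hz]
    unfold listArray
    have : (0 ≤ z ∧ z < ((k + 1 : ℕ) : ℤ)) ↔ (0 ≤ z ∧ z < (k : ℤ)) := by
      push_cast
      omega
    simp only [this]

lemma listArray_apply (f : ℕ → ℤ) {k n : ℕ} (hk : k < n) : listArray f n (k : ℤ) = f k := by
  rw [listArray, if_pos ⟨by positivity, by exact_mod_cast hk⟩, Int.toNat_natCast]

/-- Filling the array `a` with the entries for the grid points. -/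
lemma runs_fillGrid (hP : Params h β K) {m : Store} (hE : Env h β K m) {a s : ℕ} {P : Prog}
    {f : ℕ → ℤ} (ha6 : a < 6) (ha4 : 4 ≠ a) (ha0 : 0 ≠ a) (hz : m a = fun _ => 0)
    (hf : ∀ k ≤ K, bits (f k) ≤ β)
    (hPf : ∀ k ≤ K, ∀ m', Env h β K m' → (∀ b < 6, b ≠ a → m' b = m b) → m' 6 0 = k →
      Computes h β P 7 m' (f k) s) :
    Runs h β (fillProg 6 a sizeE (var 6) P) m ((K + 1) * (s + 3) + 2)
      fun m' => (∀ b < 6, b ≠ a → m' b = m b) ∧ m' a = listArray f (K + 1) := by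
  refine Runs.fillProg hP.one_le hE.bdd ha6 (v := f) (idx := fun k => (k : ℤ))
    (G := listArray f) (by simp [sizeE, meshE, var, Expr.weight]) (by simp [var, Expr.weight])
    (hP.bits_natCast_le (by have := le_cube K; have := hP.two_le; omega)) ?_ ?_
    (by rw [hz, listArray_zero]) (fun k _ => listArray_succ f k)
    (fun k hk => hf k (Nat.lt_succ_iff.1 hk)) ?_
  · exact fun m' ha => eval_sizeE (by rw [ha 4 (by norm_num) ha4, hE.mesh])
  · intro k _ m' _ hidx
    simp [var, Expr.eval, hidx]
  · intro k hk m' hb ha _ hidx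
    exact hPf k (Nat.lt_succ_iff.1 hk) m' (hE.of_agree_except hb ha4 ha0 ha) ha hidx

lemma runs_pointsProg (hP : Params h β K) {m : Store} (hE : Env h β K m) (hz : m 2 = fun _ => 0) :
    Runs h β pointsProg m ((K + 1) * 4 + 2)
      fun m' => (∀ b < 6, b ≠ 2 → m' b = m b) ∧
        m' 2 = listArray (fun k => (k : ℤ)) (K + 1) := by
  have hb : ∀ k ≤ K, bits (k : ℤ) ≤ β := fun k hk =>
    hP.bits_natCast_le (by have := le_cube K; omega)
  refine runs_fillGrid (s := 1) hP hE (by norm_num) (by norm_num) (by norm_num) hz hb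
    fun k hk m' hE' _ hidx => ?_
  exact Computes.expr hP.one_le hE'.bdd (by simp [var, Expr.weight]) (hb k hk)
    (by simp [var, Expr.eval, hidx])

lemma flowSum_le (hP : Params h β K) (k : ℕ) {j : ℕ} (hj : j ≤ K) :
    flowSum (K + 1) (flowBase K) (rate K h) k j ≤ k * (32 * (K : ℤ) ^ 3) ^ k := by
  have hQ := hP.one_le_base
  induction k with
  | zero => simp [flowSum]
  | succ k ih =>
    have h1 := flowOf_le hP.pos h k hj
    have h2 := flowBase_le K
    have h3 := flowBase_nonneg K
    change flowBase K * flowSum (K + 1) (flowBase K) (rate K h) k j + flowOf K h k j ≤ _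
    set Q : ℤ := 32 * (K : ℤ) ^ 3
    have h4 : 0 ≤ (k : ℤ) * Q ^ k := by positivity
    have h5 : Q ^ k ≤ Q ^ (k + 1) := pow_le_pow_right₀ hQ (by omega)
    calc flowBase K * flowSum (K + 1) (flowBase K) (rate K h) k j + flowOf K h k j
        ≤ flowBase K * (k * Q ^ k) + Q ^ (k + 1) := by gcongr; linarith
      _ ≤ Q * (k * Q ^ k) + Q ^ (k + 1) := by gcongr
      _ = _ := by push_cast; ring

/-- `flowSum` is evaluated by its Horner recursion along one column of the stored iterates. -/
lemma runs_weightsProg (hP : Params h β K) {m : Store} (hE : Env h β K m) (hz : m 3 = fun _ => 0)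
    (hV : m 5 = flowArray K h (K * K * (K + 1))) :
    Runs h β weightsProg m ((K + 1) * (K * K * 4 + 3 + 3) + 2)
      fun m' => (∀ b < 6, b ≠ 3 → m' b = m b) ∧ m' 3 = listArray (predWeight K h) (K + 1) := by
  have hb : ∀ k ≤ K * K, ∀ j ≤ K,
      bits (flowSum (K + 1) (flowBase K) (rate K h) k j) ≤ β := by
    intro k hk j hj
    refine hP.bits_le (k := K * K + 1) (by omega) ?_
    have h0 : 0 ≤ flowSum (K + 1) (flowBase K) (rate K h) k j :=
      flowSum_nonneg (fun _ hi j _ => rate_nonneg hP.pos h (Nat.lt_succ_iff.1 hi) j)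
        (fun _ hi => sum_rate_le hP.pos h (Nat.lt_succ_iff.1 hi)) (flowBase_nonneg K) k j
        (Nat.lt_succ_iff.2 hj)
    rw [abs_of_nonneg h0]
    refine (flowSum_le hP k hj).trans ?_
    have h1 : (k : ℤ) ≤ 32 * (K : ℤ) ^ 3 := by
      have := hP.sq_le_cube
      exact_mod_cast (by omega : k ≤ 32 * K ^ 3)
    have h2 := hP.one_le_base
    rw [pow_succ' _ (K * K)]
    exact mul_le_mul h1 (pow_le_pow_right₀ h2 hk) (by positivity) (by positivity)
  refine runs_fillGrid hP hE (by norm_num) (by norm_num) (by norm_num) hz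
    (fun j hj => hb (K * K) le_rfl j hj) fun j hj m' hE' ha hidx => ?_
  refine Computes.foldProg hP.one_le hE'.bdd (N := K * K) (s := 1)
    (F := fun k => flowSum (K + 1) (flowBase K) (rate K h) k j)
    (by simp [meshE, var, Expr.weight]) (by simp [Expr.weight])
    (hP.bits_natCast_le (by have := hP.sq_le_cube; omega)) ?_ (by simp [Expr.eval, flowSum])
    (fun k hk => hb k hk j hj) ?_
  · intro m₂ ha₂
    simp [meshE, var, Expr.eval, ha₂ 4 (by norm_num), hE'.mesh]
  · intro k hk m₂ hb₂ ha₂ hacc hk₂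
    have hE₂ := hE'.of_agree hb₂ (by norm_num) ha₂
    refine Computes.expr hP.one_le hb₂
      (by simp [flowBaseE, resolutionE, sqE, sizeE, meshE, var, Expr.weight]) (hb (k + 1) hk j hj) ?_
    have e5 : m₂ 5 = flowArray K h (K * K * (K + 1)) := by
      rw [ha₂ 5 (by norm_num), ha 5 (by norm_num) (by norm_num), hV]
    have e6 : m₂ 6 0 = j := by rw [ha₂ 6 (by norm_num), hidx]
    have e8 : m₂ 8 0 = k := hk₂
    have ei : (k : ℤ) * ((K + 1 : ℕ) : ℤ) + j = ((k * (K + 1) + j : ℕ) : ℤ) := by push_cast; ring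
    have hlt : k * (K + 1) + j < K * K * (K + 1) + (K + 1) := by
      have := Nat.mul_le_mul_right (K + 1) hk.le
      omega
    simp only [Expr.eval, eval_flowBaseE hE₂.mesh, eval_sizeE hE₂.mesh, var, hacc, e5, e6, e8, ei,
      flowArray_apply K h hj hlt]
    rfl

/-! ### The mesh parameter and the whole program. -/

lemma two_pow_sq_lt_iff {T k : ℕ} :
    2 ^ k * 2 ^ k < T ↔ k < Nat.clog 4 T := by
  rw [← mul_pow, ← not_le, ← not_le, Nat.clog_le_iff_le_pow (by norm_num)]
  norm_num

/-- The loop doubles while the square is below `T` and then idles, giving `2 ^ min k c` after `k`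
rounds; `T` rounds are enough because `c ≤ T`. -/
lemma computes_mesh {T : ℕ} (hP : Params h β (2 ^ Nat.clog 4 T)) {m : Store} (hm : Bdd β m)
    (hT : m 0 0 = T) (hTK : T ≤ 2 ^ Nat.clog 4 T * 2 ^ Nat.clog 4 T) :
    Computes h β meshProg 6 m ((2 ^ Nat.clog 4 T : ℕ) : ℤ)
      (2 ^ Nat.clog 4 T * 2 ^ Nat.clog 4 T * 5 + 3) := by
  set c := Nat.clog 4 T with hc
  have hcT : c ≤ T := (Nat.clog_le_iff_le_pow (by norm_num)).2 (Nat.lt_pow_self (by norm_num)).le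
  have hF : ∀ k, bits ((2 ^ min k c : ℕ) : ℤ) ≤ β := fun k => hP.bits_natCast_le (by
    have h1 : 2 ^ min k c ≤ 2 ^ c := Nat.pow_le_pow_right (by norm_num) (min_le_right k c)
    have := le_cube (2 ^ c)
    omega)
  have key := Computes.foldProg (h := h) hP.one_le hm (r := 6) (N := T) (s := 2)
    (n := .read 0 (.const 0)) (init := .const 1)
    (P := .cond (.sub (.read 0 (.const 0)) (sqE (var 6)))
      (.assign 8 (.const 0) (.mul (.const 2) (var 6)))
      (.assign 8 (.const 0) (var 6)))
    (F := fun k => ((2 ^ min k c : ℕ) : ℤ)) (by simp [Expr.weight]) (by simp [Expr.weight])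
    (hP.bits_natCast_le (by have := hP.sq_le_cube; omega)) ?_ (by simp [Expr.eval])
    (fun k _ => hF k) ?_
  · simp only [min_eq_right hcT] at key
    exact key.mono (by linarith)
  · intro m' ha
    simp [Expr.eval, ha 0 (by norm_num), hT]
  · intro k hk m' hb ha hacc hidx
    have e0 : m' 0 0 = T := by rw [ha 0 (by norm_num), hT]
    have htest : 0 < (Expr.sub (.read 0 (.const 0)) (sqE (var 6))).eval h m' ↔ k < c := by
      have h1 : (0 : ℤ) < T - ((2 ^ min k c : ℕ) : ℤ) * ((2 ^ min k c : ℕ) : ℤ) ↔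
          2 ^ min k c * 2 ^ min k c < T := by
        rw [sub_pos]
        exact_mod_cast Iff.rfl
      simp only [sqE, var, Expr.eval, e0, hacc]
      rw [h1, two_pow_sq_lt_iff, ← hc]
      omega
    refine Computes.cond hP.one_le hb (by simp [sqE, var, Expr.weight]) ?_ ?_
    · intro hp
      rw [htest] at hp
      refine Computes.expr hP.one_le hb (by simp [var, Expr.weight]) (hF _) ?_
      rw [min_eq_left hp.le] at hacc
      simp only [var, Expr.eval, hacc]
      rw [min_eq_left (by omega : k + 1 ≤ c), pow_succ']
      push_cast
      ring
    · intro hp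
      rw [htest] at hp
      refine Computes.expr hP.one_le hb (by simp [var, Expr.weight]) (hF _) ?_
      rw [min_eq_right (by omega)] at hacc
      simp only [var, Expr.eval, hacc]
      rw [min_eq_right (by omega)]

lemma runs_predictProg {T : ℕ} (hP : Params h β (2 ^ Nat.clog 4 T)) (hT : h.length < T)
    (hTK : T ≤ 2 ^ Nat.clog 4 T * 2 ^ Nat.clog 4 T) (hK : K = 2 ^ Nat.clog 4 T) :
    Runs h β predictProg (initStore T h.length) (predictSteps K) fun m =>
      m 1 0 = ((K + 1 : ℕ) : ℤ) ∧ m 1 1 = K ∧ m 2 = listArray (fun k => (k : ℤ)) (K + 1) ∧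
        m 3 = listArray (predWeight K h) (K + 1) := by
  have hm : Bdd β (initStore T h.length) := by
    intro a i
    have := hP.sq_le_cube
    unfold initStore
    split_ifs
    · exact hP.bits_natCast_le (by omega)
    · exact hP.bits_natCast_le (by omega)
    · simp [bits]
  have hmesh := computes_mesh hP hm (by simp [initStore]) hTK
  rw [← hK] at hmesh hP
  have hKb : bits (K : ℤ) ≤ β := hP.bits_natCast_le (by have := le_cube K; omega)
  refine Runs.seq hmesh fun m₁ hb₁ ⟨ha₁, h6⟩ => ?_
  have hz : ∀ a < 6, a ≠ 0 → m₁ a = fun _ => 0 := fun a ha ha0 => by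
    rw [ha₁ a ha]
    funext i
    simp [initStore, ha0]
  have ht₁ : m₁ 0 1 = h.length := by
    rw [ha₁ 0 (by norm_num)]
    simp [initStore]
  refine Runs.seq (R := fun m' => (∀ a < 6, a ≠ 4 → m' a = m₁ a) ∧ m' 4 0 = K)
    (Runs.assign hP.one_le hb₁ (by simp [Expr.weight]) (by simp [var, Expr.weight])
      (by simpa [var, Expr.eval, h6] using hKb)
      ⟨fun a _ h4 => put_of_ne _ h4 _ _, by simp [Expr.eval, var, put_same, h6]⟩)
    fun m₂ hb₂ ⟨ha₂, h4⟩ => ?_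
  -- A single `1` in zeroed memory is the whole initial row: the point mass at state `0`.
  refine Runs.seq (R := fun m' => (∀ a < 6, a ≠ 5 → m' a = m₂ a) ∧
      m' 5 = Function.update (fun _ => 0) 0 1)
    (Runs.assign hP.one_le hb₂ (by simp [Expr.weight]) (by simp [Expr.weight])
      (hP.bits_natCast_le (n := 1) (by have := le_cube K; have := hP.two_le; omega))
      ⟨fun a _ h5 => put_of_ne _ h5 _ _, by
        rw [put_array, ha₂ 5 (by norm_num) (by norm_num), hz 5 (by norm_num) (by norm_num)]
        rfl⟩)
    fun m₃ hb₃ ⟨ha₃, h5⟩ => ?_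
  have hE₃ : Env h β K m₃ := ⟨hb₃, by rw [ha₃ 4 (by norm_num) (by norm_num), h4],
    by rw [ha₃ 0 (by norm_num) (by norm_num), ha₂ 0 (by norm_num) (by norm_num), ht₁]⟩
  refine Runs.seq (runs_flowProg hP hE₃ h5) fun m₄ hb₄ ⟨ha₄, h5₄⟩ => ?_
  have hE₄ := hE₃.of_agree_except hb₄ (by norm_num) (by norm_num) ha₄
  have hz₄ : ∀ a < 4, a ≠ 0 → m₄ a = fun _ => 0 := fun a ha ha0 => by
    rw [ha₄ a (by omega) (by omega), ha₃ a (by omega) (by omega), ha₂ a (by omega) (by omega),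
      hz a (by omega) ha0]
  refine Runs.seq (runs_weightsProg hP hE₄ (hz₄ 3 (by norm_num) (by norm_num)) h5₄)
    fun m₅ hb₅ ⟨ha₅, h3₅⟩ => ?_
  have hE₅ := hE₄.of_agree_except hb₅ (by norm_num) (by norm_num) ha₅
  refine Runs.seq (runs_pointsProg hP hE₅ (by
    rw [ha₅ 2 (by norm_num) (by norm_num), hz₄ 2 (by norm_num) (by norm_num)]))
    fun m₆ hb₆ ⟨ha₆, h2₆⟩ => ?_
  have hE₆ := hE₅.of_agree_except hb₆ (by norm_num) (by norm_num) ha₆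
  have h3₆ : m₆ 3 = listArray (predWeight K h) (K + 1) := by
    rw [ha₆ 3 (by norm_num) (by norm_num), h3₅]
  refine Runs.seq (R := fun m' => (∀ a < 6, a ≠ 1 → m' a = m₆ a) ∧ m' 1 0 = ((K + 1 : ℕ) : ℤ))
    (Runs.assign hP.one_le hb₆ (by simp [Expr.weight])
      (by simp [sizeE, meshE, var, Expr.weight]) ?_
      ⟨fun a _ h1 => put_of_ne _ h1 _ _, by
        rw [eval_sizeE hE₆.mesh]
        simp [Expr.eval, put_same]⟩)
    fun m₇ hb₇ ⟨ha₇, h1₇⟩ => ?_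
  · rw [eval_sizeE hE₆.mesh]
    exact hP.bits_natCast_le (by have := le_cube K; have := hP.two_le; omega)
  have hE₇ := hE₆.of_agree_except hb₇ (by norm_num) (by norm_num) ha₇
  have e : meshE.eval h m₇ = K := by simp [meshE, var, Expr.eval, hE₇.mesh]
  refine Runs.assign hP.one_le hb₇ (by simp [Expr.weight]) (by simp [meshE, var, Expr.weight])
    (by rwa [e]) ⟨?_, ?_, ?_, ?_⟩
  · rw [put_array]
    simp [Expr.eval, h1₇]
  · rw [e]
    simp [Expr.eval, put_same]
  · rw [put_of_ne _ (by norm_num), ha₇ 2 (by norm_num) (by norm_num), h2₆]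
  · rw [put_of_ne _ (by norm_num), ha₇ 3 (by norm_num) (by norm_num), h3₆]

end Program

/-! ### Time and regret in terms of the horizon -/

section Digits

variable {R : Type*} [CommSemiring R]

/-- The number of digits that suffices for the mesh `1 / K`. -/
def digits (K : R) : R := (5 + 3 * K) * (K * K + 4) + 1

/-- The running time for the mesh `1 / K`, including the length of the output. -/
def predictTime (K : R) : R := predictSteps K * (100000 * digits K) + (K + 1)

end Digits

lemma params_digits {h : Transcript} {K : ℕ} (hK : 2 ≤ K) (hh : h.length ≤ K * K) :
    Params h (digits K) K where
  one_le := by unfold digits; omega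
  two_le := hK
  length_le := hh
  cap z hz := by
    rw [bits_le_iff]
    have h1 : 32 * K ^ 3 ≤ 2 ^ (5 + 3 * K) := by
      have h2 : K ^ 3 ≤ (2 ^ K) ^ 3 := Nat.pow_le_pow_left Nat.lt_two_pow_self.le 3
      rw [pow_add, mul_comm 3 K, pow_mul]
      omega
    have h3 : z.natAbs ≤ (32 * K ^ 3) ^ (K * K + 4) := by
      zify
      exact_mod_cast hz
    calc z.natAbs ≤ (32 * K ^ 3) ^ (K * K + 4) := h3
      _ ≤ (2 ^ (5 + 3 * K)) ^ (K * K + 4) := Nat.pow_le_pow_left h1 _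
      _ = 2 ^ ((5 + 3 * K) * (K * K + 4)) := by rw [← pow_mul]
      -- The final `+ 1` in `digits` makes the bound strict, as the bit length requires.
      _ < 2 ^ digits K := Nat.pow_lt_pow_right (by norm_num) (by simp [digits])

lemma gridStrategy_apply_toReal {K : ℕ} (hK : 0 < K) (h : Transcript) (x : I) :
    (gridStrategy K hK h x).toReal =
      (∑ k ∈ range (K + 1), if (k : ℝ) / K = x then (predWeight K h k : ℝ) else 0) /
        ∑ k ∈ range (K + 1), (predWeight K h k : ℝ) := by
  have hZ : (0 : ℝ) < ∑ k ∈ range (K + 1), (predWeight K h k : ℝ) := by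
    exact_mod_cast sum_predWeight_pos hK h
  rw [gridStrategy, PMF.map_apply, tsum_fintype, ENNReal.toReal_sum]
  · rw [sum_div, ← Fin.sum_univ_eq_sum_range (fun k => (if (k : ℝ) / K = x then
      (predWeight K h k : ℝ) else 0) / ∑ k ∈ range (K + 1), (predWeight K h k : ℝ))]
    refine sum_congr rfl fun j _ => ?_
    have hj : (j : ℕ) ≤ K := Nat.lt_succ_iff.1 j.2
    have hw : 0 ≤ (predWeight K h j : ℝ) := by exact_mod_cast predWeight_nonneg hK h hj
    have hiff : x = gridPt K j ↔ (j : ℝ) / K = x := by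
      rw [Subtype.ext_iff, coe_gridPt hj, eq_comm]
    simp only [hiff, PMF.ofFintype_apply]
    split_ifs
    · rw [ENNReal.toReal_ofReal (by positivity)]
    · simp
  · intro j _
    split_ifs
    · rw [PMF.ofFintype_apply]
      exact ENNReal.ofReal_ne_top
    · exact ENNReal.zero_ne_top

lemma computesInTime_predictProg {T K : ℕ} (hT : 2 ≤ T) (hK : K = 2 ^ Nat.clog 4 T) (hK0 : 0 < K)
    (hTK : T ≤ K * K) :
    predictProg.ComputesInTime T (gridStrategy K hK0) (predictTime K) := by
  intro h hh
  have hK2 : 2 ≤ K := by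
    by_contra hlt
    obtain rfl : K = 1 := by omega
    omega
  have hP : Params h (digits K) K := params_digits hK2 (by omega)
  have hP' : Params h (digits K) (2 ^ Nat.clog 4 T) := by rwa [← hK]
  obtain ⟨m, c, hc, hcs, -, h10, h11, h2, h3⟩ := runs_predictProg hP' hh (hK ▸ hTK) hK
  have e2 : ∀ k < K + 1, m 2 k = k := fun k hk => by rw [h2, listArray_apply _ hk]
  have e3 : ∀ k < K + 1, m 3 k = predWeight K h k := fun k hk => by rw [h3, listArray_apply _ hk]
  have s3 : ∑ k ∈ range (K + 1), m 3 k = ∑ k ∈ range (K + 1), predWeight K h k :=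
    sum_congr rfl fun k hk => e3 k (mem_range.1 hk)
  refine ⟨m, c, K + 1, hc, ⟨h10, ?_, ?_, ?_, ?_⟩, ?_⟩
  · rw [h11]
    exact_mod_cast hK0
  · intro k hk
    rw [e2 k hk, e3 k hk, h11]
    exact ⟨by positivity, by exact_mod_cast Nat.lt_succ_iff.1 hk,
      predWeight_nonneg hK0 h (Nat.lt_succ_iff.1 hk)⟩
  · rw [s3]
    exact sum_predWeight_pos hK0 h
  · intro x
    rw [gridStrategy_apply_toReal hK0 h x, h11]
    congr 1
    · refine sum_congr rfl fun k hk => ?_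
      rw [e2 k (mem_range.1 hk), e3 k (mem_range.1 hk)]
      simp
    · exact sum_congr rfl fun k hk => by rw [e3 k (mem_range.1 hk)]
  · unfold predictTime
    unfold unitTime at hcs
    omega

lemma polynomial_eval_mono (q : Polynomial ℕ) {a b : ℕ} (hab : a ≤ b) :
    q.eval a ≤ q.eval b := by
  rw [Polynomial.eval_eq_sum_range, Polynomial.eval_eq_sum_range]
  exact sum_le_sum fun i _ => Nat.mul_le_mul_left _ (Nat.pow_le_pow_left hab i)

lemma eval_predictTime (K : ℕ) :
    (predictTime (Polynomial.X : Polynomial ℕ)).eval K = predictTime K := by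
  simp [predictTime, digits, predictSteps, flowStepSteps, rateSteps, totalSteps, weightSteps,
    gcdSteps]

/-- The mesh parameter is of the order of the square root of the horizon. -/
lemma mesh_bounds {T : ℕ} (hT : 2 ≤ T) :
    1 ≤ Nat.clog 4 T ∧ T ≤ 2 ^ Nat.clog 4 T * 2 ^ Nat.clog 4 T ∧
      2 ^ Nat.clog 4 T * 2 ^ Nat.clog 4 T ≤ 4 * T ∧ 4 ^ (Nat.clog 4 T - 1) ≤ T := by
  have h1 : 1 ≤ Nat.clog 4 T := Nat.clog_pos (by norm_num) hT
  have h2 : T ≤ 4 ^ Nat.clog 4 T := Nat.le_pow_clog (by norm_num) T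
  have h3 : 4 ^ (Nat.clog 4 T - 1) < T := Nat.pow_pred_clog_lt_self (by norm_num) (by omega)
  have e : 2 ^ Nat.clog 4 T * 2 ^ Nat.clog 4 T = 4 ^ Nat.clog 4 T := by
    rw [← mul_pow]
    norm_num
  have e2 : 4 ^ Nat.clog 4 T = 4 * 4 ^ (Nat.clog 4 T - 1) := by
    rw [← pow_succ']
    congr 1
    omega
  rw [e]
  exact ⟨h1, h2, by omega, h3.le⟩

lemma mesh_mul_log_le {T : ℕ} (hT : 2 ≤ T) :
    (2 : ℝ) ^ Nat.clog 4 T * Nat.clog 4 T ≤ 6 * (Real.sqrt T * Real.log T) := by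
  obtain ⟨h1, -, h3, h4⟩ := mesh_bounds hT
  set c := Nat.clog 4 T
  have hTR : (2 : ℝ) ≤ T := by exact_mod_cast hT
  have hs : (2 : ℝ) ^ c ≤ 2 * Real.sqrt T := by
    have h5 : ((2 : ℝ) ^ c) ^ 2 ≤ (2 * Real.sqrt T) ^ 2 := by
      rw [mul_pow, Real.sq_sqrt (by positivity), sq]
      have : (2 : ℝ) ^ c * 2 ^ c ≤ 4 * T := by exact_mod_cast h3
      linarith
    exact le_of_sq_le_sq h5 (by positivity)
  have hlog2 := Real.log_two_gt_d9
  -- From `c ≤ 1 + log T / (2 log 2)`; the summand `1` is absorbed because `log T ≥ log 2`.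
  have hl : (c : ℝ) ≤ 3 * Real.log T := by
    have h5 : Real.log 2 ≤ Real.log T := Real.log_le_log (by norm_num) hTR
    have h6 : ((c - 1 : ℕ) : ℝ) * Real.log 4 ≤ Real.log T := by
      rw [← Real.log_pow]
      exact Real.log_le_log (by positivity) (by exact_mod_cast h4)
    have h7 : Real.log 4 = 2 * Real.log 2 := by
      rw [show (4 : ℝ) = 2 ^ 2 by norm_num, Real.log_pow]
      norm_num
    rw [Nat.cast_sub h1, h7] at h6
    push_cast at h6
    have h8 : (1 : ℝ) ≤ c := by exact_mod_cast h1
    nlinarith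
  calc (2 : ℝ) ^ c * c ≤ (2 * Real.sqrt T) * (3 * Real.log T) := by gcongr
    _ = _ := by ring

end SwapRegret

end

theorem theorem1 :
    ∃ (C : ℝ) (P : SwapRegret.Prog) (q : Polynomial ℕ), 0 < C ∧
      ∀ T : ℕ, 2 ≤ T →
        ∃ S : SwapRegret.Strategy,
          (∀ A : SwapRegret.Adversary,
            SwapRegret.expectedSwapRegret S A T ≤
              ENNReal.ofReal (C * (Real.sqrt T * Real.log T))) ∧
          P.ComputesInTime T S (q.eval T) := by
  -- The constant is `300 * 6`, from the regret in terms of the mesh and from `mesh_mul_log_le`. The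
  -- time polynomial in `K` is composed with `4 X` because `K ≤ K ^ 2 ≤ 4 T`.
  refine ⟨1800, SwapRegret.predictProg,
    (SwapRegret.predictTime (Polynomial.X : Polynomial ℕ)).comp (Polynomial.C 4 * Polynomial.X),
    by norm_num, fun T hT => ?_⟩
  obtain ⟨h1, h2, h3, -⟩ := SwapRegret.mesh_bounds hT
  have hK : 0 < 2 ^ Nat.clog 4 T := by positivity
  refine ⟨SwapRegret.gridStrategy (2 ^ Nat.clog 4 T) hK, fun A => ?_, fun h hh => ?_⟩
  · refine (SwapRegret.expectedSwapRegret_gridStrategy_le h1 hK h2 A).trans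
      (ENNReal.ofReal_le_ofReal ?_)
    have := SwapRegret.mesh_mul_log_le hT
    linarith
  · obtain ⟨m, c, N, hc, ho, hτ⟩ := SwapRegret.computesInTime_predictProg hT rfl hK h2 h hh
    refine ⟨m, c, N, hc, ho, hτ.trans ?_⟩
    rw [Polynomial.eval_comp, ← SwapRegret.eval_predictTime]
    refine SwapRegret.polynomial_eval_mono _ ?_
    have h4 := Nat.le_mul_self (2 ^ Nat.clog 4 T)
    simp only [Polynomial.eval_mul, Polynomial.eval_C, Polynomial.eval_X]
    exact h4.trans h3
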